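/- **Setting.** Let $\theta_j\ge 0$, $\kappa_j\ge 0$ ($j\in\mathbb N=\{1,2,\dots\}$). Assume that $(\kappa_j)$ is non-arithmetic (there is no integer $j_0>1$ dividing every $j$ with $\kappa_j\neq0$) and non-degenerate ($\kappa_j>0$ for some $j\ge2$). For $\sigma$ in the symmetric group $\mathfrak S_N$ let $C_j=C_j(\sigma)$ be the number of cycles of length $j$, and let $$P_N(\sigma)=\frac{1}{N!\,H_N}\prod_{j=1}^N(\theta_j+N\kappa_j)^{C_j},\qquad H_N=\frac1{N!}\sum_{\sigma\in\mathfrak S_N}\prod_{j=1}^N(\theta_j+N\kappa_j)^{C_j},$$ with expectation $E_N$. Let $L_1$ be the length of the cycle of $\sigma$ containing $1$, $L_2$ the length of the cycle containing the smallest element not in the previous cycle, and so on ($L_n=0$ if there are fewer than $n$ cycles). Put $$g_\theta(z)=\sum_{j\ge1}\frac{\theta_j}{j}z^j,\qquad g_\kappa(z)=\sum_{j\ge1}\frac{\kappa_j}{j}z^j,\qquad g^{\{n\}}(z)=z^n\frac{d^n g(z)}{dz^n},\qquad g_\kappa^{\{n\}}(R)=\lim_{r\uparrow R}g_\kappa^{\{n\}}(r)\in[0,\infty].$$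 **Assumptions** (supercritical case, $\theta^*=0$). The radius of convergence $R$ of $g_\kappa$ satisfies $0<R<\infty$. For some $\eta>0$ and $\varphi\in(0,\pi/2)$, both $g_\theta$ and $g_\kappa$ are given by their power series in $|z|<R$ and extend holomorphically to $$\Delta_0=\{z\in\mathbb C:\ |z|<|R(1+\eta e^{i\varphi})|,\ z\ne R,\ |\arg(z-R)|>\varphi\},$$ and $g_\theta$ is moreover regular (analytic) at $z=R$. There is a non-integer $s>1$ such that $g_\kappa^{\{n\}}(R)<\infty$ for all integers $0\le n<s$ and $g_\kappa^{\{n\}}(R)=\infty$ for all $n>s$, and there are a real $a_s\neq0$ and numbers $\delta_n>0$ such that, for every integer $n\ge0$, as $z\to R$ in $\Delta_0$, $$g_\kappa^{\{n\}}(z)=\Bigl(\frac zR\Bigr)^n\Bigl\{\sum_{n\le j<s}\frac{(-1)^{j-n}g_\kappa^{\{j\}}(R)}{(j-n)!}\Bigl(1-\frac zR\Bigr)^{j-n}+\frac{\Gamma(-s+n)\,a_s}{\Gamma(-s)}\Bigl(1-\frac zR\Bigr)^{s-n}\Bigr\}+O\Bigl(\Bigl|1-\frac zR\Bigr|^{s-n+\delta_n}\Bigr)$$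 (principal branch of the power; the sum is empty if $n>s$). Finally $g_\kappa^{\{1\}}(R)<1$. Put $\tilde\nu=1-g_\kappa^{\{1\}}(R)>0$. **Theorem.** $H_N>0$ for all sufficiently large $N$, so that $P_N$ is then well defined, and $\tilde\nu$ is the limiting expected fraction of points in long cycles: $$\lim_{K\to\infty}\liminf_{N\to\infty}\frac1N E_N\Bigl[\sum_{j>K}jC_j\Bigr]=\tilde\nu .$$ Let $\xi_1,\xi_2,\dots$ be independent Bernoulli random variables with success probability $\tilde\nu$, let $\tau_1=\min\{n\ge1:\xi_n=1\}$, and let $X_n=\mathbf 1_{\{\tau_1=n\}}$. Then $\tau_1$ is geometric, $P\{\tau_1=k\}=(1-\tilde\nu)^{k-1}\tilde\nu$ for $k\ge1$, and for each $m\in\mathbb N$, $$\frac{1}{N\tilde\nu}(L_1,\dots,L_m)\ \xrightarrow{\ d\ }\ (X_1,\dots,X_m)\qquad(N\to\infty),$$ where $L_1,\dots,L_m$ are taken under $P_N$. -/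

import Mathlib

open Filter Topology MeasureTheory ProbabilityTheory
open scoped NNReal ENNReal

namespace SurrogateSpatial

/-! ### The surrogate-spatial measure on permutations -/

/-- The cycle count `C_j(σ)`: the number of cycles of length `j` of `σ`, fixed points being counted
as cycles of length one. -/
def cycleCount {N : ℕ} (σ : Equiv.Perm (Fin N)) (j : ℕ) : ℕ :=
  σ.partition.parts.count j

/-- The multiplicative weight `∏_{j=1}^N (θ_j + N κ_j)^{C_j(σ)}`.  The values `θ 0`, `κ 0` are never
used. -/
noncomputable def weight (θ κ : ℕ → ℝ≥0) {N : ℕ} (σ : Equiv.Perm (Fin N)) : ℝ≥0 :=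
  ∏ j ∈ Finset.Icc 1 N, (θ j + N * κ j) ^ cycleCount σ j

/-- The normalization constant `H_N = (1 / N!) ∑_σ ∏_j (θ_j + N κ_j)^{C_j(σ)}`. -/
noncomputable def normConst (θ κ : ℕ → ℝ≥0) (N : ℕ) : ℝ≥0 :=
  (N.factorial : ℝ≥0)⁻¹ * ∑ σ : Equiv.Perm (Fin N), weight θ κ σ

/-- The probability `(N! H_N)⁻¹ ∏_j (θ_j + N κ_j)^{C_j(σ)}` of the permutation `σ`. -/
noncomputable def prob (θ κ : ℕ → ℝ≥0) {N : ℕ} (σ : Equiv.Perm (Fin N)) : ℝ≥0 :=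
  weight θ κ σ / (N.factorial * normConst θ κ N)

theorem sum_prob (θ κ : ℕ → ℝ≥0) (N : ℕ) (h : normConst θ κ N ≠ 0) :
    ∑ σ : Equiv.Perm (Fin N), (prob θ κ σ : ℝ≥0∞) = 1 := by
  have hN : (N.factorial : ℝ≥0) ≠ 0 := by exact_mod_cast N.factorial_ne_zero
  have h2 : (N.factorial : ℝ≥0) * normConst θ κ N
      = ∑ σ : Equiv.Perm (Fin N), weight θ κ σ := by
    rw [normConst, ← mul_assoc, mul_inv_cancel₀ hN, one_mul]
  have h3 : ∑ σ : Equiv.Perm (Fin N), prob θ κ σ = 1 := by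
    simp only [prob]
    rw [← Finset.sum_div, ← h2, div_self (mul_ne_zero hN h)]
  exact_mod_cast h3

open Classical in
/-- The surrogate-spatial distribution on the symmetric group.  It makes sense only if `H_N ≠ 0`; the
point mass at the identity is a filler for the degenerate case `H_N = 0`. -/
noncomputable def surrogatePMF (θ κ : ℕ → ℝ≥0) (N : ℕ) : PMF (Equiv.Perm (Fin N)) :=
  if h : normConst θ κ N ≠ 0 then
    PMF.ofFintype (fun σ => (prob θ κ σ : ℝ≥0∞)) (sum_prob θ κ N h)
  else PMF.pure 1

instance permMeasurableSpace (N : ℕ) : MeasurableSpace (Equiv.Perm (Fin N)) := ⊤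

instance permDiscrete (N : ℕ) : DiscreteMeasurableSpace (Equiv.Perm (Fin N)) :=
  ⟨fun _ => trivial⟩

/-- The surrogate-spatial probability measure `P_N` on the symmetric group. -/
noncomputable def surrogateMeasure (θ κ : ℕ → ℝ≥0) (N : ℕ) : Measure (Equiv.Perm (Fin N)) :=
  (surrogatePMF θ κ N).toMeasure

instance surrogateMeasure_isProbabilityMeasure (θ κ : ℕ → ℝ≥0) (N : ℕ) :
    IsProbabilityMeasure (surrogateMeasure θ κ N) := by
  unfold surrogateMeasure
  infer_instance

/-- `ν_K = liminf_N (1/N) E_N[∑_{j > K} j C_j]`: the limiting expected fraction of points in cycles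
longer than `K`. -/
noncomputable def longFraction (θ κ : ℕ → ℝ≥0) (K : ℕ) : ℝ :=
  liminf (fun N : ℕ => (1 / (N : ℝ)) *
    ∫ σ, (∑ j ∈ Finset.Ioc K N, (j : ℝ) * (cycleCount σ j : ℝ)) ∂(surrogateMeasure θ κ N)) atTop

/-! ### Lexicographically ordered cycle lengths -/

/-- The set of elements in the cycle of `σ` containing `x`. -/
def cyclePoints {N : ℕ} (σ : Equiv.Perm (Fin N)) (x : Fin N) : Finset (Fin N) :=
  Finset.univ.filter fun y => σ.SameCycle x y

/-- The elements that remain after removing the first `n` cycles, where one always removes the cycle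
containing the smallest remaining element. -/
def remaining {N : ℕ} (σ : Equiv.Perm (Fin N)) : ℕ → Finset (Fin N)
  | 0 => Finset.univ
  | n + 1 =>
    if h : (remaining σ n).Nonempty then
      remaining σ n \ cyclePoints σ ((remaining σ n).min' h)
    else ∅

/-- The length of the `(n+1)`-st cycle in the lexicographic order: `lexLength σ 0 = L_1`,
`lexLength σ 1 = L_2`, and so on, with value zero once all the cycles are exhausted. -/
def lexLength {N : ℕ} (σ : Equiv.Perm (Fin N)) (n : ℕ) : ℕ :=
  if h : (remaining σ n).Nonempty then (cyclePoints σ ((remaining σ n).min' h)).card else 0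

/-! ### Generating functions -/

/-- The coefficients `a_j / j` of the generating function `∑_{j ≥ 1} (a_j / j) z^j`; the coefficient
at `j = 0` is `a_0 / 0 = 0`. -/
noncomputable def genCoeff (a : ℕ → ℝ≥0) (j : ℕ) : ℂ :=
  ((a j : ℝ) : ℂ) / (j : ℂ)

/-- The domain `Δ₀(R, η, φ)`: a disk of radius larger than `R` with a sector at `R` cut out. -/
def deltaDomain (R η φ : ℝ) : Set ℂ :=
  {z | ‖z‖ < ‖(R : ℂ) * (1 + η * Complex.exp (φ * Complex.I))‖ ∧ z ≠ R ∧
    φ < |Complex.arg (z - R)|}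

/-- The modified derivative `g^{n}(z) = zⁿ dⁿg/dzⁿ`. -/
noncomputable def modDeriv (n : ℕ) (g : ℂ → ℂ) (z : ℂ) : ℂ :=
  z ^ n * iteratedDeriv n g z

/-- The main part, as `z → R`, of the `n`-th modified derivative of a function having the boundary
values `b j = g^{j}(R)` for `j < s` and the leading singular term `a (1 - z/R)^s`. -/
noncomputable def singularExpansion (R s a : ℝ) (b : ℕ → ℝ) (n : ℕ) (z : ℂ) : ℂ :=
  (z / R) ^ n *
    (∑ j ∈ Finset.Ico n ⌈s⌉₊,
        (-1 : ℂ) ^ (j - n) * (b j : ℂ) / ((j - n).factorial : ℂ) * (1 - z / R) ^ (j - n)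
      + ((Real.Gamma (-s + n) * a / Real.Gamma (-s) : ℝ) : ℂ) *
          (1 - z / R) ^ (((s - n : ℝ)) : ℂ))

/-! ### The limiting waiting time -/

/-- The time of the first success in a sequence of trials, the trial `ξ n` being performed at the time
`n + 1`; on the null event that there is no success the value is zero. -/
noncomputable def firstSuccess {Ω : Type*} (ξ : ℕ → Ω → Bool) (ω : Ω) : ℕ :=
  sInf {k | ∃ n, k = n + 1 ∧ ξ n ω = true}

end SurrogateSpatial

/-!
Put `x_l = (θ_l + N κ_l) R^l`, with `R^l` inserted since it does not change `P_N`. Splitting off the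
cycle of the smallest point gives `n h_n = ∑ x_l h_{n-l}` for the total weight `n! h_n` of the
permutations of `n` points, so that each successive cycle length is governed by the size-biased
weights `x_l h_{n-l} / (n h_n)`. The normalized sequence `h_n / ∑ h_k` is the law of `∑ l Y_l` with
independent Poisson variables `Y_l` of mean `x_l / l`. By singularity analysis,
`κ_l R^l ~ c l^(-s)`; hence this law has the mean `∑ x_l ~ (1 - ν) N`, satisfies a law of large
numbers, and its mass at `N - k` comes from a single jump of size about `ν N`: it is
`~ (c ν^(-s) / ν) N^(-s)`, independently of the fixed `k`.

Consequently the first cycle has the fixed length `l` with the asymptotic probability `κ_l R^l`,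
which leaves the situation unchanged, and otherwise, with probability `ν = 1 - ∑ κ_l R^l`, it is the
long cycle of length about `ν N`. Afterwards about `(1 - ν) N` points remain, which is the mean of
the law, and all further cycles are short. The asymptotic probabilities of these scenarios sum to
one, so that it suffices to bound them from below.
-/

namespace SurrogateSpatial

/-! ### Sums over permutations -/

/-- The Taylor coefficients of `exp (∑ x_l z^l / l)`, encoded by the recursion
`n e_n = ∑_{l=1}^n x_l e_{n-l}` obtained by differentiating; the value `x 0` is never used. -/
def expCoeff {𝕜 : Type*} [Field 𝕜] (x : ℕ → 𝕜) : ℕ → 𝕜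
  | 0 => 1
  | n + 1 => (∑ i : Fin (n + 1), x (i + 1) * expCoeff x (n - i)) / (n + 1)

open Classical in
/-- The operator `f ↦ n⁻¹ ∑ x_l f (n - l)`, summed over the `l ∈ A` with `1 ≤ l ≤ n`: if `f n` is
the total weight of a family of permutations of `n` points divided by `n!`, it prescribes an
additional cycle through a given point, of length in `A`. -/
noncomputable def cycleStep {𝕜 : Type*} [Field 𝕜] (x : ℕ → 𝕜) (A : Set ℕ) (f : ℕ → 𝕜) (n : ℕ) : 𝕜 :=
  (∑ l ∈ (Finset.Icc 1 n).filter (· ∈ A), x l * f (n - l)) / n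

/-- The total weight of the permutations of `n` points whose first cycle lengths, in lexicographic
order, are in the prescribed sets, divided by `n!`. -/
noncomputable def lexCoeff {𝕜 : Type*} [Field 𝕜] (x : ℕ → 𝕜) : List (Set ℕ) → ℕ → 𝕜
  | [] => expCoeff x
  | A :: As => cycleStep x A (lexCoeff x As)

theorem expCoeff_eq_cycleStep {𝕜 : Type*} [Field 𝕜] (x : ℕ → 𝕜) {n : ℕ} (hn : n ≠ 0) :
    expCoeff x n = cycleStep x Set.univ (expCoeff x) n := by
  obtain ⟨n, rfl⟩ := Nat.exists_eq_succ_of_ne_zero hn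
  have hshift := Finset.sum_Ico_add' (fun l => x l * expCoeff x (n + 1 - l)) 0 (n + 1) 1
  simp only [Nat.add_sub_add_right, zero_add] at hshift
  simp only [expCoeff, cycleStep, Set.mem_univ, Finset.filter_true]
  rw [Fin.sum_univ_eq_sum_range (fun i => x (i + 1) * expCoeff x (n - i)), Finset.range_eq_Ico,
    hshift, Nat.cast_succ]
  rfl

theorem sum_powerset_filter_mem_card {V R : Type*} [DecidableEq V] [CommSemiring R]
    (f : ℕ → R) {S : Finset V} {a : V} (ha : a ∈ S) :
    ∑ A ∈ S.powerset.filter (a ∈ ·), f A.card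
      = ∑ l ∈ Finset.Icc 1 S.card, ((S.card - 1).choose (l - 1) : R) * f l := by
  have herase : ∑ A ∈ S.powerset.filter (a ∈ ·), f A.card
      = ∑ B ∈ (S.erase a).powerset, f (B.card + 1) := by
    refine Finset.sum_bij' (fun A _ => A.erase a) (fun B _ => insert a B) ?_ ?_ ?_ ?_ ?_
    · intro A hA
      simp only [Finset.mem_filter, Finset.mem_powerset] at hA ⊢
      exact Finset.erase_subset_erase a hA.1
    · intro B hB
      simp only [Finset.mem_filter, Finset.mem_powerset] at hB ⊢
      exact ⟨Finset.insert_subset ha (hB.trans (Finset.erase_subset _ _)),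
        Finset.mem_insert_self _ _⟩
    · exact fun A hA => Finset.insert_erase (Finset.mem_filter.1 hA).2
    · exact fun B hB => Finset.erase_insert fun h => by simpa using Finset.mem_powerset.1 hB h
    · intro A hA
      rw [Finset.card_erase_add_one (Finset.mem_filter.1 hA).2]
  have hshift :=
    Finset.sum_Ico_add' (fun l => ((S.card - 1).choose (l - 1) : R) * f l) 0 S.card 1
  simp only [Nat.add_sub_cancel, zero_add] at hshift
  rw [herase, Finset.sum_powerset_apply_card (fun m => f (m + 1)), Finset.card_erase_of_mem ha,
    Nat.sub_add_cancel (Finset.card_pos.2 ⟨a, ha⟩), Finset.range_eq_Ico]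
  simp only [nsmul_eq_mul]
  rw [hshift]
  rfl

theorem choose_mul_factorial_pred_mul_factorial_sub {n l : ℕ} (hl : 1 ≤ l) (hln : l ≤ n) :
    (n - 1).choose (l - 1) * (l - 1).factorial * (n - l).factorial = (n - 1).factorial := by
  have h := Nat.choose_mul_factorial_mul_factorial (show l - 1 ≤ n - 1 by omega)
  rwa [show n - 1 - (l - 1) = n - l by omega] at h

theorem sum_powerset_filter_mem_factorial_mul {V R : Type*} [DecidableEq V] [CommSemiring R]
    (f : ℕ → R) {S : Finset V} {a : V} (ha : a ∈ S) :
    ∑ A ∈ S.powerset.filter (a ∈ ·),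
        ((A.card - 1).factorial : R) * ((S.card - A.card).factorial * f A.card)
      = (S.card - 1).factorial * ∑ l ∈ Finset.Icc 1 S.card, f l := by
  rw [sum_powerset_filter_mem_card
    (fun l => ((l - 1).factorial : R) * ((S.card - l).factorial * f l)) ha, Finset.mul_sum]
  refine Finset.sum_congr rfl fun l hl => ?_
  rw [Finset.mem_Icc] at hl
  rw [← choose_mul_factorial_pred_mul_factorial_sub hl.1 hl.2]
  push_cast
  ring

section Perm

variable {V : Type*} [Fintype V] [DecidableEq V]

/-- The set of points of the cycle of `σ` through `a`, equal to `{a}` if `a` is a fixed point. -/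
def cycleSet (σ : Equiv.Perm V) (a : V) : Finset V :=
  Finset.univ.filter fun b => σ.SameCycle a b

theorem mem_cycleSet {σ : Equiv.Perm V} {a b : V} : b ∈ cycleSet σ a ↔ σ.SameCycle a b := by
  simp [cycleSet]

theorem mem_cycleSet_self (σ : Equiv.Perm V) (a : V) : a ∈ cycleSet σ a :=
  mem_cycleSet.2 (Equiv.Perm.SameCycle.refl _ _)

theorem cycleSet_eq_insert_support (σ : Equiv.Perm V) (a : V) :
    cycleSet σ a = insert a (σ.cycleOf a).support := by
  ext b
  rw [mem_cycleSet, Finset.mem_insert, Equiv.Perm.mem_support_cycleOf_iff, Equiv.Perm.mem_support]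
  constructor
  · intro h
    by_cases hfix : σ a = a
    · exact Or.inl (h.eq_of_left hfix).symm
    · exact Or.inr ⟨h, hfix⟩
  · rintro (rfl | h)
    · exact Equiv.Perm.SameCycle.refl _ _
    · exact h.1

theorem cycleSet_eq_support_cycleOf {σ : Equiv.Perm V} {a : V} (ha : a ∈ σ.support) :
    cycleSet σ a = (σ.cycleOf a).support := by
  rw [cycleSet_eq_insert_support, Finset.insert_eq_of_mem]
  exact Equiv.Perm.mem_support_cycleOf_iff.2 ⟨Equiv.Perm.SameCycle.refl _ _, ha⟩

theorem cycleSet_eq_singleton {σ : Equiv.Perm V} {a : V} (ha : a ∉ σ.support) :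
    cycleSet σ a = {a} := by
  rw [cycleSet_eq_insert_support,
    (Equiv.Perm.cycleOf_eq_one_iff σ).2 (Equiv.Perm.notMem_support.1 ha)]
  simp

theorem cycleSet_congr {σ τ : Equiv.Perm V} {a : V} (h : σ.cycleOf a = τ.cycleOf a) :
    cycleSet σ a = cycleSet τ a := by
  rw [cycleSet_eq_insert_support, cycleSet_eq_insert_support, h]

theorem cycleSet_cycleOf (σ : Equiv.Perm V) (a : V) :
    cycleSet (σ.cycleOf a) a = cycleSet σ a := by
  refine cycleSet_congr ?_
  by_cases ha : σ a = a
  · simp [(Equiv.Perm.cycleOf_eq_one_iff σ).2 ha]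
  · refine (Equiv.Perm.isCycle_cycleOf σ ha).cycleOf_eq ?_
    rwa [Equiv.Perm.cycleOf_apply_self]

/-- The permutations of `V` that move only points of `S`, encoding the permutations of `S`. -/
def permsOn (S : Finset V) : Finset (Equiv.Perm V) :=
  Finset.univ.filter fun σ => σ.support ⊆ S

theorem mem_permsOn {S : Finset V} {σ : Equiv.Perm V} : σ ∈ permsOn S ↔ σ.support ⊆ S := by
  simp [permsOn]

theorem permsOn_univ : permsOn (Finset.univ : Finset V) = Finset.univ := by
  ext σ
  simp [mem_permsOn]

theorem permsOn_empty : permsOn (∅ : Finset V) = {1} := by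
  ext σ
  simp [mem_permsOn]

theorem card_permsOn (S : Finset V) : (permsOn S).card = S.card.factorial := by
  have h := Fintype.card_congr (Equiv.Perm.subtypeEquivSubtypePerm (fun a => a ∈ S))
  rw [Fintype.card_perm, Fintype.card_coe] at h
  rw [h, Fintype.card_subtype]
  congr 1
  ext σ
  simp only [mem_permsOn, Finset.mem_filter, Finset.mem_univ, true_and, Finset.subset_iff,
    Equiv.Perm.mem_support]
  exact forall_congr' fun b => not_imp_comm

theorem cycleSet_subset {S : Finset V} {σ : Equiv.Perm V} (h : σ ∈ permsOn S) {a : V}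
    (ha : a ∈ S) : cycleSet σ a ⊆ S := by
  rw [cycleSet_eq_insert_support]
  exact Finset.insert_subset ha ((Equiv.Perm.support_cycleOf_le σ a).trans (mem_permsOn.1 h))

theorem disjoint_of_mem_permsOn {A S : Finset V} {c τ : Equiv.Perm V} (hc : c ∈ permsOn A)
    (hτ : τ ∈ permsOn (S \ A)) : c.Disjoint τ :=
  Equiv.Perm.disjoint_iff_disjoint_support.2 <|
    Finset.disjoint_of_subset_left (mem_permsOn.1 hc)
      (Finset.disjoint_of_subset_right (mem_permsOn.1 hτ) Finset.disjoint_sdiff)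

theorem mul_mem_permsOn {A S : Finset V} {c τ : Equiv.Perm V} (hA : A ⊆ S) (hc : c ∈ permsOn A)
    (hτ : τ ∈ permsOn (S \ A)) : c * τ ∈ permsOn S := by
  rw [mem_permsOn, (disjoint_of_mem_permsOn hc hτ).support_mul]
  exact Finset.union_subset ((mem_permsOn.1 hc).trans hA)
    ((mem_permsOn.1 hτ).trans Finset.sdiff_subset)

theorem cycleOf_mul_of_mem {A S : Finset V} {c τ : Equiv.Perm V} {a : V} (ha : a ∈ A)
    (hc : c ∈ permsOn A) (hτ : τ ∈ permsOn (S \ A)) : (c * τ).cycleOf a = c.cycleOf a := by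
  rw [(disjoint_of_mem_permsOn hc hτ).cycleOf_mul_distrib, (Equiv.Perm.cycleOf_eq_one_iff τ).2,
    mul_one]
  exact Equiv.Perm.notMem_support.1 fun h => (Finset.mem_sdiff.1 (mem_permsOn.1 hτ h)).2 ha

theorem cycleOf_mul_of_notMem {A S : Finset V} {c τ : Equiv.Perm V} {a : V} (ha : a ∉ A)
    (hc : c ∈ permsOn A) (hτ : τ ∈ permsOn (S \ A)) : (c * τ).cycleOf a = τ.cycleOf a := by
  rw [(disjoint_of_mem_permsOn hc hτ).cycleOf_mul_distrib, (Equiv.Perm.cycleOf_eq_one_iff c).2,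
    one_mul]
  exact Equiv.Perm.notMem_support.1 fun h => ha (mem_permsOn.1 hc h)

/-- The cyclic permutations of `A`, for `a ∈ A`. -/
def cyclesOn (A : Finset V) (a : V) : Finset (Equiv.Perm V) :=
  (permsOn A).filter fun c => cycleSet c a = A

theorem mem_cyclesOn {A : Finset V} {a : V} {c : Equiv.Perm V} :
    c ∈ cyclesOn A a ↔ c ∈ permsOn A ∧ cycleSet c a = A :=
  Finset.mem_filter

theorem cycleOf_mem_cyclesOn (σ : Equiv.Perm V) (a : V) :
    σ.cycleOf a ∈ cyclesOn (cycleSet σ a) a := by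
  refine mem_cyclesOn.2 ⟨mem_permsOn.2 ?_, cycleSet_cycleOf σ a⟩
  rw [cycleSet_eq_insert_support]
  exact Finset.subset_insert _ _

theorem cycleOf_eq_self_of_mem_cyclesOn {A : Finset V} {a : V} {c : Equiv.Perm V}
    (hc : c ∈ cyclesOn A a) : c.cycleOf a = c := by
  obtain ⟨hcA, rfl⟩ := mem_cyclesOn.1 hc
  ext b
  by_cases h : c.SameCycle a b
  · rw [h.cycleOf_apply]
  · have hb : b ∉ c.support := fun hb => h (mem_cycleSet.1 (mem_permsOn.1 hcA hb))
    rw [Equiv.Perm.cycleOf_apply_of_not_sameCycle h, Equiv.Perm.notMem_support.1 hb]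

theorem mul_inv_cycleOf_mem_permsOn {S : Finset V} {σ : Equiv.Perm V} (hσ : σ ∈ permsOn S)
    (a : V) : σ * (σ.cycleOf a)⁻¹ ∈ permsOn (S \ cycleSet σ a) := by
  refine mem_permsOn.2 fun b hb => ?_
  rw [Equiv.Perm.mem_support, Equiv.Perm.mul_apply] at hb
  by_cases hab : σ.SameCycle a b
  · have hpre : (σ.cycleOf a)⁻¹ b = σ⁻¹ b := by
      have hab' : σ.SameCycle a (σ⁻¹ b) := Equiv.Perm.sameCycle_symm_apply_right.2 hab
      rw [Equiv.Perm.inv_eq_iff_eq, hab'.cycleOf_apply]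
      simp
    exact absurd (by simp [hpre]) hb
  · have hfix : (σ.cycleOf a)⁻¹ b = b := by
      rw [Equiv.Perm.inv_eq_iff_eq, Equiv.Perm.cycleOf_apply_of_not_sameCycle hab]
    rw [hfix] at hb
    exact Finset.mem_sdiff.2
      ⟨mem_permsOn.1 hσ (Equiv.Perm.mem_support.2 hb), fun h => hab (mem_cycleSet.1 h)⟩

theorem cycleOf_mul_mul_inv_cycleOf (σ : Equiv.Perm V) (a : V) :
    σ.cycleOf a * (σ * (σ.cycleOf a)⁻¹) = σ := by
  have hσ : σ ∈ permsOn Finset.univ := by simp [permsOn_univ]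
  rw [(disjoint_of_mem_permsOn (mem_cyclesOn.1 (cycleOf_mem_cyclesOn σ a)).1
    (mul_inv_cycleOf_mem_permsOn hσ a)).commute.eq, inv_mul_cancel_right]

section Weight

variable {R : Type*} [CommSemiring R]

/-- The product of the weights `x l` over the cycle lengths `l` of a permutation of `S`, the fixed
points in `S` being counted as cycles of length one. -/
def weightOn (x : ℕ → R) (S : Finset V) (σ : Equiv.Perm V) : R :=
  (σ.cycleType.map x).prod * x 1 ^ (S.card - σ.support.card)

theorem weightOn_mul (x : ℕ → R) {A S : Finset V} {c τ : Equiv.Perm V} (hA : A ⊆ S)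
    (hc : c ∈ permsOn A) (hτ : τ ∈ permsOn (S \ A)) :
    weightOn x S (c * τ) = weightOn x A c * weightOn x (S \ A) τ := by
  have hd := disjoint_of_mem_permsOn hc hτ
  have hcA : c.support.card ≤ A.card := Finset.card_le_card (mem_permsOn.1 hc)
  have hτS : τ.support.card ≤ (S \ A).card := Finset.card_le_card (mem_permsOn.1 hτ)
  have hSA : (S \ A).card + A.card = S.card := Finset.card_sdiff_add_card_eq_card hA
  have hexp : S.card - (c.support.card + τ.support.card)
      = (A.card - c.support.card) + ((S \ A).card - τ.support.card) := by omega
  rw [weightOn, weightOn, weightOn, hd.cycleType_mul, hd.card_support_mul, Multiset.map_add,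
    Multiset.prod_add, hexp, pow_add]
  ring

theorem weightOn_of_mem_cyclesOn (x : ℕ → R) {A : Finset V} {a : V} {c : Equiv.Perm V}
    (hc : c ∈ cyclesOn A a) : weightOn x A c = x A.card := by
  have hcc := cycleOf_eq_self_of_mem_cyclesOn hc
  have hA := (mem_cyclesOn.1 hc).2
  by_cases ha : a ∈ c.support
  · rw [cycleSet_eq_support_cycleOf ha, hcc] at hA
    have hcyc : c.IsCycle := by
      rw [← hcc]
      exact Equiv.Perm.isCycle_cycleOf c (Equiv.Perm.mem_support.1 ha)
    rw [weightOn, hcyc.cycleType, hA]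
    simp
  · have hc1 : c = 1 := by
      rw [← hcc, Equiv.Perm.cycleOf_eq_one_iff]
      exact Equiv.Perm.notMem_support.1 ha
    rw [cycleSet_eq_singleton ha] at hA
    simp [weightOn, hc1, ← hA]

/-- The bijection `σ ↔ (c, τ)` with `σ = c τ`, where `c` is the cycle of `a`. -/
theorem sum_permsOn_weightOn_mul (x : ℕ → R) (g : Finset V → Equiv.Perm V → R)
    {S : Finset V} {a : V} (ha : a ∈ S) :
    ∑ σ ∈ permsOn S, weightOn x S σ * g (cycleSet σ a) (σ * (σ.cycleOf a)⁻¹)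
      = ∑ A ∈ S.powerset.filter (a ∈ ·), (cyclesOn A a).card * (x A.card *
          ∑ τ ∈ permsOn (S \ A), weightOn x (S \ A) τ * g A τ) := by
  have hprod : ∀ A ∈ S.powerset.filter (a ∈ ·), ((cyclesOn A a).card : R) * (x A.card *
          ∑ τ ∈ permsOn (S \ A), weightOn x (S \ A) τ * g A τ)
      = ∑ p ∈ cyclesOn A a ×ˢ permsOn (S \ A), x A.card * (weightOn x (S \ A) p.2 * g A p.2) := by
    intro A _
    rw [Finset.sum_product]
    simp only [Finset.mul_sum, Finset.sum_const, nsmul_eq_mul]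
  rw [Finset.sum_congr rfl hprod, Finset.sum_sigma']
  refine Finset.sum_bij' (fun σ _ => ⟨cycleSet σ a, (σ.cycleOf a, σ * (σ.cycleOf a)⁻¹)⟩)
    (fun p _ => p.2.1 * p.2.2) ?_ ?_ ?_ ?_ ?_
  · intro σ hσ
    simp only [Finset.mem_sigma, Finset.mem_filter, Finset.mem_powerset, Finset.mem_product]
    exact ⟨⟨cycleSet_subset hσ ha, mem_cycleSet_self σ a⟩, cycleOf_mem_cyclesOn σ a,
      mul_inv_cycleOf_mem_permsOn hσ a⟩
  · rintro ⟨A, c, τ⟩ hp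
    simp only [Finset.mem_sigma, Finset.mem_filter, Finset.mem_powerset, Finset.mem_product] at hp
    exact mul_mem_permsOn hp.1.1 (mem_cyclesOn.1 hp.2.1).1 hp.2.2
  · exact fun σ _ => cycleOf_mul_mul_inv_cycleOf σ a
  · rintro ⟨A, c, τ⟩ hp
    simp only [Finset.mem_sigma, Finset.mem_filter, Finset.mem_powerset, Finset.mem_product] at hp
    obtain ⟨⟨-, haA⟩, hc, hτ⟩ := hp
    obtain ⟨hcA, hcycle⟩ := mem_cyclesOn.1 hc
    have hcycleOf : (c * τ).cycleOf a = c.cycleOf a := cycleOf_mul_of_mem haA hcA hτ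
    have hrest : c * τ * c⁻¹ = τ := by
      rw [(disjoint_of_mem_permsOn hcA hτ).commute.eq, mul_inv_cancel_right]
    simp only [cycleSet_congr hcycleOf, hcycle, hcycleOf, cycleOf_eq_self_of_mem_cyclesOn hc, hrest]
  · intro σ hσ
    have hcycle := cycleOf_mem_cyclesOn σ a
    have hmul := weightOn_mul x (cycleSet_subset hσ ha) (mem_cyclesOn.1 hcycle).1
      (mul_inv_cycleOf_mem_permsOn hσ a)
    rw [cycleOf_mul_mul_inv_cycleOf, weightOn_of_mem_cyclesOn x hcycle] at hmul
    rw [hmul, mul_assoc]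

end Weight

theorem card_cyclesOn {A : Finset V} {a : V} (ha : a ∈ A) :
    (cyclesOn A a).card = (A.card - 1).factorial := by
  induction hn : A.card using Nat.strong_induction_on generalizing A with
  | _ n ih =>
  -- Counting all the permutations of `A` by the cycle of `a` determines the count by induction.
  have hcount := sum_permsOn_weightOn_mul (fun _ => (1 : ℕ)) (fun _ _ => 1) ha
  simp only [weightOn, Multiset.map_const', Multiset.prod_replicate, one_pow, mul_one, one_mul,
    Finset.sum_const, smul_eq_mul, card_permsOn, Nat.cast_id] at hcount
  have hfact := sum_powerset_filter_mem_factorial_mul (fun _ => (1 : ℕ)) ha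
  have hA : A ∈ A.powerset.filter (a ∈ ·) := by simp [ha]
  have hproper : ∀ B ∈ (A.powerset.filter (a ∈ ·)).erase A,
      (cyclesOn B a).card * (A \ B).card.factorial
        = (B.card - 1).factorial * (A.card - B.card).factorial := by
    intro B hB
    simp only [Finset.mem_erase, Finset.mem_filter, Finset.mem_powerset] at hB
    have hlt : B.card < n :=
      hn ▸ Finset.card_lt_card (Finset.ssubset_iff_subset_ne.2 ⟨hB.2.1, hB.1⟩)
    rw [ih _ hlt hB.2.2 rfl, Finset.card_sdiff_of_subset hB.2.1]
  rw [← Finset.add_sum_erase _ _ hA] at hcount hfact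
  rw [Finset.sum_congr rfl hproper] at hcount
  simp only [mul_one, Nat.cast_id, Finset.sum_const, Nat.card_Icc, smul_eq_mul,
    Nat.add_sub_cancel, Nat.sub_self, Finset.sdiff_self, Finset.card_empty, Nat.factorial_zero,
    mul_comm ((A.card - 1).factorial) A.card,
    Nat.mul_factorial_pred (Finset.card_pos.2 ⟨a, ha⟩).ne'] at hcount hfact
  rw [← hn]
  omega

section Field

variable {𝕜 : Type*} [Field 𝕜] [CharZero 𝕜]

theorem sum_permsOn_weightOn_mul_eq_sum_Icc (x : ℕ → 𝕜) (g : Finset V → Equiv.Perm V → 𝕜)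
    {S : Finset V} {a : V} (ha : a ∈ S) (f : ℕ → 𝕜)
    (hf : ∀ A ⊆ S, a ∈ A → ∑ τ ∈ permsOn (S \ A), weightOn x (S \ A) τ * g A τ
      = (S.card - A.card).factorial * f A.card) :
    ∑ σ ∈ permsOn S, weightOn x S σ * g (cycleSet σ a) (σ * (σ.cycleOf a)⁻¹)
      = S.card.factorial * ((∑ l ∈ Finset.Icc 1 S.card, x l * f l) / S.card) := by
  have hterm : ∀ A ∈ S.powerset.filter (a ∈ ·), ((cyclesOn A a).card : 𝕜) * (x A.card *
          ∑ τ ∈ permsOn (S \ A), weightOn x (S \ A) τ * g A τ)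
      = ((A.card - 1).factorial : 𝕜) * ((S.card - A.card).factorial * (x A.card * f A.card)) := by
    intro A hA
    simp only [Finset.mem_filter, Finset.mem_powerset] at hA
    rw [card_cyclesOn hA.2, hf A hA.1 hA.2]
    ring
  have hcard : S.card ≠ 0 := (Finset.card_pos.2 ⟨a, ha⟩).ne'
  have hcard' : (S.card : 𝕜) ≠ 0 := Nat.cast_ne_zero.2 hcard
  rw [sum_permsOn_weightOn_mul x g ha, Finset.sum_congr rfl hterm,
    sum_powerset_filter_mem_factorial_mul (fun l => x l * f l) ha, ← Nat.mul_factorial_pred hcard]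
  push_cast
  field_simp

theorem sum_weightOn (x : ℕ → 𝕜) (S : Finset V) :
    ∑ σ ∈ permsOn S, weightOn x S σ = S.card.factorial * expCoeff x S.card := by
  induction hn : S.card using Nat.strong_induction_on generalizing S with
  | _ n ih =>
  rcases S.eq_empty_or_nonempty with rfl | ⟨a, ha⟩
  · obtain rfl : 0 = n := hn
    simp [permsOn_empty, weightOn, expCoeff]
  · have hpos : 0 < n := hn ▸ Finset.card_pos.2 ⟨a, ha⟩
    have hsplit := sum_permsOn_weightOn_mul_eq_sum_Icc x (fun _ _ => 1) ha
      (fun l => expCoeff x (n - l)) fun A hA haA => by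
        have hcard : (S \ A).card = n - A.card := by rw [Finset.card_sdiff_of_subset hA, hn]
        have hApos : 0 < A.card := Finset.card_pos.2 ⟨a, haA⟩
        simp only [mul_one]
        rw [ih (n - A.card) (by omega) (S \ A) hcard, hn]
    simp only [mul_one] at hsplit
    rw [hsplit, hn, expCoeff_eq_cycleStep x hpos.ne']
    simp [cycleStep]

theorem sum_weightOn_mul_card_cycleSet_mem (x : ℕ → 𝕜) (A : Set ℕ) [DecidablePred (· ∈ A)]
    {S : Finset V} {a : V} (ha : a ∈ S) :
    ∑ σ ∈ permsOn S, weightOn x S σ * (if (cycleSet σ a).card ∈ A then 1 else 0)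
      = S.card.factorial * cycleStep x A (expCoeff x) S.card := by
  rw [sum_permsOn_weightOn_mul_eq_sum_Icc x (fun B _ => if B.card ∈ A then 1 else 0) ha
    (fun l => if l ∈ A then expCoeff x (S.card - l) else 0), cycleStep, Finset.sum_filter]
  · simp only [mul_ite, mul_zero]
    congr!
  · intro B hB _
    by_cases hBA : B.card ∈ A
    · simp only [hBA, if_true, mul_one]
      rw [sum_weightOn, Finset.card_sdiff_of_subset hB]
    · simp [hBA]

end Field

end Perm

section Lexicographic

variable {N : ℕ}

/-- The lengths of the first cycles of a permutation of `S`, the cycle of the smallest remaining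
point being removed each time, are in the prescribed sets. -/
def LexMem (σ : Equiv.Perm (Fin N)) : List (Set ℕ) → Finset (Fin N) → Prop
  | [], _ => True
  | A :: As, S => ∃ h : S.Nonempty, (cyclePoints σ (S.min' h)).card ∈ A ∧
      LexMem σ As (S \ cyclePoints σ (S.min' h))

theorem lexMem_congr {σ τ : Equiv.Perm (Fin N)} (As : List (Set ℕ)) {S : Finset (Fin N)}
    (h : ∀ a ∈ S, cyclePoints σ a = cyclePoints τ a) : LexMem σ As S ↔ LexMem τ As S := by
  induction As generalizing S with
  | nil => rfl
  | cons A As ih =>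
    refine exists_congr fun hS => ?_
    rw [h _ (S.min'_mem hS), ih]
    exact fun a ha => h a (Finset.mem_sdiff.1 ha).1

theorem lexMem_cons_iff {σ : Equiv.Perm (Fin N)} {A : Set ℕ} {As : List (Set ℕ)}
    {S : Finset (Fin N)} (hσ : σ ∈ permsOn S) (hS : S.Nonempty) :
    LexMem σ (A :: As) S ↔ (cycleSet σ (S.min' hS)).card ∈ A ∧
      LexMem (σ * (σ.cycleOf (S.min' hS))⁻¹) As (S \ cycleSet σ (S.min' hS)) := by
  set a := S.min' hS
  have hcons : LexMem σ (A :: As) S ↔ (cycleSet σ a).card ∈ A ∧ LexMem σ As (S \ cycleSet σ a) :=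
    ⟨fun ⟨_, h⟩ => h, fun h => ⟨hS, h⟩⟩
  refine hcons.trans (and_congr_right fun _ => lexMem_congr _ fun b hb => cycleSet_congr ?_)
  conv_lhs => rw [← cycleOf_mul_mul_inv_cycleOf σ a]
  exact cycleOf_mul_of_notMem (Finset.mem_sdiff.1 hb).2
    (mem_cyclesOn.1 (cycleOf_mem_cyclesOn σ a)).1 (mul_inv_cycleOf_mem_permsOn hσ a)

open Classical in
theorem sum_weightOn_mul_lexMem {𝕜 : Type*} [Field 𝕜] [CharZero 𝕜] (x : ℕ → 𝕜)
    (As : List (Set ℕ)) (S : Finset (Fin N)) :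
    ∑ σ ∈ permsOn S, weightOn x S σ * (if LexMem σ As S then 1 else 0)
      = S.card.factorial * lexCoeff x As S.card := by
  induction As generalizing S with
  | nil => simpa [LexMem, lexCoeff] using sum_weightOn x S
  | cons A As ih =>
    rcases S.eq_empty_or_nonempty with rfl | hS
    · simp [LexMem, lexCoeff, cycleStep]
    · have hsplit := sum_permsOn_weightOn_mul_eq_sum_Icc x
        (fun B τ => if B.card ∈ A ∧ LexMem τ As (S \ B) then 1 else 0) (S.min'_mem hS)
        (fun l => if l ∈ A then lexCoeff x As (S.card - l) else 0) fun B hB _ => by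
          by_cases hBA : B.card ∈ A
          · simp only [hBA, true_and, if_true]
            rw [ih, Finset.card_sdiff_of_subset hB]
          · simp [hBA]
      rw [lexCoeff, cycleStep, Finset.sum_filter]
      simp only [mul_ite, mul_zero] at hsplit ⊢
      rw [← hsplit]
      exact Finset.sum_congr rfl fun σ hσ => if_congr (lexMem_cons_iff hσ hS) rfl rfl

end Lexicographic

/-! ### The surrogate-spatial measure through lexicographic coefficients -/

section CycleCount

variable {V : Type*} [Fintype V] [DecidableEq V]

theorem card_filter_card_cycleSet_eq_one (σ : Equiv.Perm V) :
    (Finset.univ.filter fun a => (cycleSet σ a).card = 1).card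
      = Fintype.card V - σ.support.card := by
  rw [← Finset.card_compl]
  congr 1
  ext a
  simp only [Finset.mem_filter, Finset.mem_univ, true_and, Finset.mem_compl]
  refine ⟨fun h ha => ?_, fun ha => by rw [cycleSet_eq_singleton ha, Finset.card_singleton]⟩
  have htwo := Equiv.Perm.two_le_card_support_cycleOf_iff.2 (Equiv.Perm.mem_support.1 ha)
  rw [← cycleSet_eq_support_cycleOf ha] at htwo
  omega

theorem mem_support_of_card_cycleSet_ne_one {σ : Equiv.Perm V} {a : V}
    (h : (cycleSet σ a).card ≠ 1) : a ∈ σ.support := by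
  by_contra ha
  exact h (by rw [cycleSet_eq_singleton ha, Finset.card_singleton])

theorem filter_cycleOf_eq {σ c : Equiv.Perm V} (hc : c ∈ σ.cycleFactorsFinset) :
    (Finset.univ.filter fun a => σ.cycleOf a = c) = c.support := by
  ext a
  simp only [Finset.mem_filter, Finset.mem_univ, true_and]
  refine ⟨?_, fun ha => (Equiv.Perm.cycle_is_cycleOf ha hc).symm⟩
  rintro rfl
  have ha : a ∈ σ.support := Equiv.Perm.cycleOf_mem_cycleFactorsFinset_iff.1 hc
  exact Equiv.Perm.mem_support_cycleOf_iff.2 ⟨Equiv.Perm.SameCycle.refl _ _, ha⟩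

theorem card_filter_card_cycleSet_of_ne_one (σ : Equiv.Perm V) {j : ℕ} (hj : j ≠ 1) :
    (Finset.univ.filter fun a => (cycleSet σ a).card = j).card = j * σ.cycleType.count j := by
  have hsupp : ∀ a, (cycleSet σ a).card = j → a ∈ σ.support := fun a ha =>
    mem_support_of_card_cycleSet_ne_one (ha ▸ hj)
  have hmaps : ∀ a ∈ Finset.univ.filter (fun a => (cycleSet σ a).card = j),
      σ.cycleOf a ∈ σ.cycleFactorsFinset.filter (fun c => c.support.card = j) := by
    intro a ha
    have haj := (Finset.mem_filter.1 ha).2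
    rw [Finset.mem_filter, Equiv.Perm.cycleOf_mem_cycleFactorsFinset_iff,
      ← cycleSet_eq_support_cycleOf (hsupp a haj)]
    exact ⟨hsupp a haj, haj⟩
  have hfiber : ∀ c ∈ σ.cycleFactorsFinset.filter (fun c => c.support.card = j),
      ((Finset.univ.filter (fun a => (cycleSet σ a).card = j)).filter
        (fun a => σ.cycleOf a = c)).card = j := by
    intro c hc
    rw [Finset.mem_filter] at hc
    refine Eq.trans (congrArg Finset.card ?_) hc.2
    rw [← filter_cycleOf_eq hc.1, Finset.filter_filter]
    refine Finset.filter_congr fun a _ => and_iff_right_of_imp ?_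
    rintro rfl
    rw [cycleSet_eq_support_cycleOf (Equiv.Perm.cycleOf_mem_cycleFactorsFinset_iff.1 hc.1), hc.2]
  rw [Finset.card_eq_sum_card_fiberwise hmaps, Finset.sum_congr rfl hfiber, Finset.sum_const,
    smul_eq_mul, mul_comm, Equiv.Perm.cycleType_def, Multiset.count_map, Finset.card_def,
    Finset.filter_val]
  congr 2
  exact Multiset.filter_congr fun c _ => eq_comm

theorem card_filter_card_cycleSet (σ : Equiv.Perm V) {j : ℕ} (hj : j ≠ 0) :
    (Finset.univ.filter fun a => (cycleSet σ a).card = j).card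
      = j * σ.partition.parts.count j := by
  rw [Equiv.Perm.parts_partition, Multiset.count_add, Multiset.count_replicate]
  rcases eq_or_ne j 1 with rfl | hj1
  · have hcount : Multiset.count 1 σ.cycleType = 0 :=
      Multiset.count_eq_zero.2 fun h => absurd (Equiv.Perm.two_le_of_mem_cycleType h) (by norm_num)
    rw [card_filter_card_cycleSet_eq_one, hcount, if_pos rfl, zero_add, one_mul]
  · rw [card_filter_card_cycleSet_of_ne_one σ hj1, if_neg hj1.symm, add_zero]

end CycleCount

section Measure

variable {N : ℕ}

theorem sum_Ioc_mul_cycleCount (σ : Equiv.Perm (Fin N)) (K : ℕ) :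
    ∑ j ∈ Finset.Ioc K N, (j : ℝ) * cycleCount σ j
      = ∑ a : Fin N, if (cycleSet σ a).card ∈ Set.Ioi K then 1 else 0 := by
  have hterm : ∀ j ∈ Finset.Ioc K N, (j : ℝ) * cycleCount σ j
      = ∑ a : Fin N, if (cycleSet σ a).card = j then 1 else 0 := by
    intro j hj
    rw [Finset.mem_Ioc] at hj
    rw [cycleCount, ← Nat.cast_mul, ← card_filter_card_cycleSet σ (by omega), Finset.sum_boole]
  rw [Finset.sum_congr rfl hterm, Finset.sum_comm]
  refine Finset.sum_congr rfl fun a _ => ?_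
  rw [Finset.sum_ite_eq]
  have hle : (cycleSet σ a).card ≤ N := by simpa using Finset.card_le_univ (cycleSet σ a)
  exact if_congr (by simp [hle]) rfl rfl

/-- The cycle weights `α_l + N β_l`, a bounded perturbation of `N β_l`; here `α = θ` and `β = κ` up
to the scaling `l ↦ R ^ l`. -/
def cycleWeight (α β : ℕ → ℝ) (N l : ℕ) : ℝ := α l + N * β l

theorem weight_eq_weightOn (θ κ : ℕ → ℝ≥0) (σ : Equiv.Perm (Fin N)) :
    (weight θ κ σ : ℝ) = weightOn (cycleWeight (θ ·) (κ ·) N) Finset.univ σ := by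
  have hcoe : (weight θ κ σ : ℝ)
      = ∏ j ∈ Finset.Icc 1 N, cycleWeight (θ ·) (κ ·) N j ^ σ.partition.parts.count j := by
    simp [weight, cycleWeight, cycleCount]
  have hparts : σ.partition.parts.toFinset ⊆ Finset.Icc 1 N := by
    intro j hj
    rw [Multiset.mem_toFinset] at hj
    have hle := Multiset.le_sum_of_mem hj
    rw [σ.partition.parts_sum, Fintype.card_fin] at hle
    exact Finset.mem_Icc.2 ⟨σ.partition.parts_pos hj, hle⟩
  rw [hcoe, ← Finset.prod_subset hparts, ← Finset.prod_multiset_map_count,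
    Equiv.Perm.parts_partition, Multiset.map_add, Multiset.prod_add, weightOn]
  · simp
  · intro j _ hj
    rw [Multiset.mem_toFinset] at hj
    rw [Multiset.count_eq_zero.2 hj, pow_zero]

theorem normConst_eq_expCoeff (θ κ : ℕ → ℝ≥0) (N : ℕ) :
    (normConst θ κ N : ℝ) = expCoeff (cycleWeight (θ ·) (κ ·) N) N := by
  have h := sum_weightOn (cycleWeight (θ ·) (κ ·) N) (Finset.univ : Finset (Fin N))
  rw [permsOn_univ, Finset.card_univ, Fintype.card_fin] at h
  rw [normConst]
  push_cast
  simp only [weight_eq_weightOn]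
  rw [h, inv_mul_cancel_left₀ (by exact_mod_cast N.factorial_ne_zero)]

theorem integral_surrogateMeasure (θ κ : ℕ → ℝ≥0) (hN : normConst θ κ N ≠ 0)
    (g : Equiv.Perm (Fin N) → ℝ) :
    ∫ σ, g σ ∂(surrogateMeasure θ κ N)
      = (∑ σ ∈ permsOn Finset.univ, weightOn (cycleWeight (θ ·) (κ ·) N) Finset.univ σ * g σ)
        / (N.factorial * expCoeff (cycleWeight (θ ·) (κ ·) N) N) := by
  rw [surrogateMeasure, PMF.integral_eq_sum, permsOn_univ, Finset.sum_div]
  refine Finset.sum_congr rfl fun σ _ => ?_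
  rw [surrogatePMF, dif_pos hN, PMF.ofFintype_apply, ← weight_eq_weightOn, ← normConst_eq_expCoeff,
    ENNReal.coe_toReal, smul_eq_mul, prob]
  push_cast
  ring

theorem lexMem_cons_remaining_iff (σ : Equiv.Perm (Fin N)) {A : Set ℕ} (hA : 0 ∉ A)
    (As : List (Set ℕ)) (k : ℕ) :
    LexMem σ (A :: As) (remaining σ k) ↔
      lexLength σ k ∈ A ∧ LexMem σ As (remaining σ (k + 1)) := by
  by_cases h : (remaining σ k).Nonempty
  · rw [lexLength, dif_pos h, remaining, dif_pos h]
    exact ⟨fun ⟨_, hmem⟩ => hmem, fun hmem => ⟨h, hmem⟩⟩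
  · rw [lexLength, dif_neg h]
    exact ⟨fun ⟨h', _⟩ => absurd h' h, fun hmem => absurd hmem.1 hA⟩

theorem lexMem_remaining_iff (σ : Equiv.Perm (Fin N)) (As : List (Set ℕ)) (h0 : ∀ A ∈ As, 0 ∉ A)
    (k : ℕ) : LexMem σ As (remaining σ k) ↔
      ∀ (i : ℕ) (hi : i < As.length), lexLength σ (k + i) ∈ As[i] := by
  induction As generalizing k with
  | nil => simp [LexMem]
  | cons A As ih =>
    rw [lexMem_cons_remaining_iff σ (h0 A List.mem_cons_self),
      ih fun B hB => h0 B (List.mem_cons_of_mem _ hB)]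
    refine Iff.trans ?_ Nat.and_forall_add_one
    simp [add_assoc, add_comm 1]

theorem measureReal_lexLength (θ κ : ℕ → ℝ≥0) (hN : normConst θ κ N ≠ 0) (As : List (Set ℕ))
    (h0 : ∀ A ∈ As, 0 ∉ A) :
    (surrogateMeasure θ κ N).real
        {σ | ∀ (i : ℕ) (hi : i < As.length), lexLength σ i ∈ As[i]}
      = lexCoeff (cycleWeight (θ ·) (κ ·) N) As N / expCoeff (cycleWeight (θ ·) (κ ·) N) N := by
  classical
  have hfact : (N.factorial : ℝ) ≠ 0 := by exact_mod_cast N.factorial_ne_zero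
  have h := sum_weightOn_mul_lexMem (cycleWeight (θ ·) (κ ·) N) As (Finset.univ : Finset (Fin N))
  rw [Finset.card_univ, Fintype.card_fin] at h
  rw [← integral_indicator_one MeasurableSet.of_discrete, integral_surrogateMeasure θ κ hN,
    ← mul_div_mul_left (lexCoeff _ As N) _ hfact, ← h]
  congr 1
  refine Finset.sum_congr rfl fun σ _ => ?_
  rw [Set.indicator_apply]
  congr 1
  have hlex := lexMem_remaining_iff σ As h0 0
  simp only [remaining, zero_add] at hlex
  exact if_congr hlex.symm rfl rfl

theorem integral_sum_Ioc_mul_cycleCount (θ κ : ℕ → ℝ≥0) (hN : normConst θ κ N ≠ 0) (K : ℕ) :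
    ∫ σ, (∑ j ∈ Finset.Ioc K N, (j : ℝ) * (cycleCount σ j : ℝ)) ∂(surrogateMeasure θ κ N)
      = N * (lexCoeff (cycleWeight (θ ·) (κ ·) N) [Set.Ioi K] N
        / expCoeff (cycleWeight (θ ·) (κ ·) N) N) := by
  have hfact : (N.factorial : ℝ) ≠ 0 := by exact_mod_cast N.factorial_ne_zero
  have hpoint : ∀ a : Fin N, ∑ σ ∈ permsOn Finset.univ,
      weightOn (cycleWeight (θ ·) (κ ·) N) Finset.univ σ *
        (if (cycleSet σ a).card ∈ Set.Ioi K then 1 else 0)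
      = N.factorial * lexCoeff (cycleWeight (θ ·) (κ ·) N) [Set.Ioi K] N := by
    intro a
    have hsum := sum_weightOn_mul_card_cycleSet_mem (cycleWeight (θ ·) (κ ·) N) (Set.Ioi K)
      (Finset.mem_univ a)
    rw [Finset.card_univ, Fintype.card_fin] at hsum
    exact hsum
  rw [integral_surrogateMeasure θ κ hN]
  simp only [sum_Ioc_mul_cycleCount, Finset.mul_sum]
  rw [Finset.sum_comm, Finset.sum_congr rfl fun a _ => hpoint a, Finset.sum_const,
    Finset.card_univ, Fintype.card_fin, nsmul_eq_mul,
    ← mul_div_mul_left _ (expCoeff (cycleWeight (θ ·) (κ ·) N) N) hfact]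
  ring

end Measure

/-! ### The probability distribution proportional to `expCoeff` -/

theorem nat_mul_expCoeff {𝕜 : Type*} [Field 𝕜] [CharZero 𝕜] (x : ℕ → 𝕜) (n : ℕ) :
    n * expCoeff x n = ∑ l ∈ Finset.Icc 1 n, x l * expCoeff x (n - l) := by
  rcases eq_or_ne n 0 with rfl | hn
  · simp
  · have hn' : (n : 𝕜) ≠ 0 := Nat.cast_ne_zero.2 hn
    conv_lhs => rw [expCoeff_eq_cycleStep x hn, cycleStep, mul_div_cancel₀ _ hn']
    simp

theorem nat_add_mul_expCoeff {𝕜 : Type*} [Field 𝕜] [CharZero 𝕜] (x : ℕ → 𝕜) (n : ℕ) :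
    (n + x 0) * expCoeff x n
      = ∑ p ∈ Finset.HasAntidiagonal.antidiagonal n, x p.1 * expCoeff x p.2 := by
  have hshift := Finset.sum_Ico_add' (fun l => x l * expCoeff x (n - l)) 0 n 1
  rw [Finset.Nat.sum_antidiagonal_eq_sum_range_succ (fun i j => x i * expCoeff x j),
    Finset.sum_range_succ', Finset.range_eq_Ico, hshift, add_mul, nat_mul_expCoeff, tsub_zero]
  rfl

theorem expCoeff_nonneg {𝕜 : Type*} [Field 𝕜] [LinearOrder 𝕜] [IsStrictOrderedRing 𝕜]
    {x : ℕ → 𝕜} (hx : ∀ l, 0 ≤ x l) (n : ℕ) : 0 ≤ expCoeff x n := by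
  induction n using Nat.strong_induction_on with
  | _ n ih =>
  rcases eq_or_ne n 0 with rfl | hn
  · simp [expCoeff]
  · rw [expCoeff_eq_cycleStep x hn, cycleStep]
    refine div_nonneg (Finset.sum_nonneg fun l hl => ?_) (Nat.cast_nonneg n)
    simp only [Set.mem_univ, Finset.filter_true, Finset.mem_Icc] at hl
    exact mul_nonneg (hx l) (ih _ (by omega))

theorem sum_range_sum_antidiagonal_le {f g : ℕ → ℝ} (hf : ∀ n, 0 ≤ f n) (hg : ∀ n, 0 ≤ g n)
    (k : ℕ) : ∑ n ∈ Finset.range k, ∑ p ∈ Finset.HasAntidiagonal.antidiagonal n, f p.1 * g p.2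
      ≤ (∑ n ∈ Finset.range k, f n) * ∑ n ∈ Finset.range k, g n := by
  have hfiber : ∀ n ∈ Finset.range k, Finset.HasAntidiagonal.antidiagonal n
      = (Finset.range k ×ˢ Finset.range k).filter fun p => p.1 + p.2 = n := by
    intro n hn
    ext p
    simp only [Finset.mem_range, Finset.HasAntidiagonal.mem_antidiagonal, Finset.mem_filter,
      Finset.mem_product] at hn ⊢
    omega
  rw [Finset.sum_congr rfl fun n hn => by rw [hfiber n hn], Finset.sum_mul_sum,
    ← Finset.sum_product']
  exact Finset.sum_fiberwise_le_sum_of_sum_fiber_nonneg fun n _ =>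
    Finset.sum_nonneg fun p _ => mul_nonneg (hf _) (hg _)

theorem summable_of_sum_range_nat_mul_le {f : ℕ → ℝ} {B : ℝ} (hf : ∀ n, 0 ≤ f n)
    (hB : ∀ k, ∑ n ∈ Finset.range k, n * f n ≤ B * ∑ n ∈ Finset.range k, f n) : Summable f := by
  obtain ⟨M, hM⟩ := exists_nat_gt (B + 1)
  refine summable_of_sum_range_le hf (c := M * ∑ n ∈ Finset.range M, f n) fun k => ?_
  have hterm : ∀ n : ℕ, (B + 1) * f n ≤ n * f n + if n < M then M * f n else 0 := by
    intro n
    split_ifs with hn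
    · nlinarith [hf n, (Nat.cast_nonneg n : (0 : ℝ) ≤ n)]
    · have hMn : (M : ℝ) ≤ n := by exact_mod_cast not_lt.1 hn
      nlinarith [hf n]
  have hshort : (∑ n ∈ Finset.range k, if n < M then M * f n else 0)
      ≤ M * ∑ n ∈ Finset.range M, f n := by
    rw [← Finset.sum_filter, ← Finset.mul_sum]
    refine mul_le_mul_of_nonneg_left ?_ (Nat.cast_nonneg M)
    exact Finset.sum_le_sum_of_subset_of_nonneg
      (fun n hn => Finset.mem_range.2 (Finset.mem_filter.1 hn).2) fun n _ _ => hf n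
  have hsum := Finset.sum_le_sum fun n (_ : n ∈ Finset.range k) => hterm n
  rw [Finset.sum_add_distrib, ← Finset.mul_sum] at hsum
  linarith [hB k]

section Weights

variable {x : ℕ → ℝ}

theorem summable_expCoeff (hx : ∀ l, 0 ≤ x l) (hs : Summable x) : Summable (expCoeff x) := by
  have he := expCoeff_nonneg hx
  refine summable_of_sum_range_nat_mul_le (B := ∑' l, x l) he fun k => ?_
  calc ∑ n ∈ Finset.range k, n * expCoeff x n
      ≤ ∑ n ∈ Finset.range k, (n + x 0) * expCoeff x n := Finset.sum_le_sum fun n _ =>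
        mul_le_mul_of_nonneg_right (le_add_of_nonneg_right (hx 0)) (he n)
    _ ≤ (∑ l ∈ Finset.range k, x l) * ∑ n ∈ Finset.range k, expCoeff x n := by
        simp only [nat_add_mul_expCoeff]
        exact sum_range_sum_antidiagonal_le hx he k
    _ ≤ (∑' l, x l) * ∑ n ∈ Finset.range k, expCoeff x n :=
        mul_le_mul_of_nonneg_right (hs.sum_le_tsum _ fun l _ => hx l)
          (Finset.sum_nonneg fun n _ => he n)

theorem hasSum_nat_add_mul_expCoeff (hx : ∀ l, 0 ≤ x l) (hs : Summable x) {f : ℕ → ℝ} {B : ℝ}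
    (hf : ∀ n, |f n| ≤ B) :
    HasSum (fun n : ℕ => (n + x 0) * f n * expCoeff x n)
      (∑' l, x l * ∑' m, expCoeff x m * f (l + m)) := by
  have he := expCoeff_nonneg hx
  set F : ℕ × ℕ → ℝ := fun p => x p.1 * (expCoeff x p.2 * f (p.1 + p.2)) with hF
  have hFs : Summable F := by
    refine Summable.of_norm_bounded ((hs.mul_of_nonneg (summable_expCoeff hx hs) hx he).mul_right B)
      fun p => ?_
    rw [hF, Real.norm_eq_abs, abs_mul, abs_mul, abs_of_nonneg (hx _), abs_of_nonneg (he _),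
      ← mul_assoc]
    exact mul_le_mul_of_nonneg_left (hf _) (mul_nonneg (hx _) (he _))
  have htsum : ∑' l, x l * ∑' m, expCoeff x m * f (l + m) = ∑' p, F p := by
    rw [hFs.tsum_prod]
    simp only [hF, tsum_mul_left]
  rw [htsum]
  have hdiag := ((Finset.HasAntidiagonal.sigmaAntidiagonalEquivProd (A := ℕ)).hasSum_iff.2
    hFs.hasSum).sigma fun n => hasSum_fintype _
  convert hdiag using 2 with n
  rw [mul_right_comm, nat_add_mul_expCoeff, Finset.sum_mul, ← Finset.sum_coe_sort]
  refine Finset.sum_congr rfl fun p _ => ?_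
  have hp := Finset.HasAntidiagonal.mem_antidiagonal.1 p.2
  simp [hF, Finset.HasAntidiagonal.sigmaAntidiagonalEquivProd, hp, mul_assoc]

/-- The probability distribution on `ℕ` proportional to `expCoeff x`: the law of a sum of
independent Poisson multiples of `l` with parameters `x l / l`. -/
noncomputable def massFn (x : ℕ → ℝ) (n : ℕ) : ℝ := expCoeff x n / ∑' k, expCoeff x k

theorem nat_mul_massFn (x : ℕ → ℝ) (n : ℕ) :
    n * massFn x n = ∑ l ∈ Finset.Icc 1 n, x l * massFn x (n - l) := by
  simp only [massFn, ← mul_div_assoc]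
  rw [← Finset.sum_div, nat_mul_expCoeff]

theorem massFn_nonneg (hx : ∀ l, 0 ≤ x l) (n : ℕ) : 0 ≤ massFn x n :=
  div_nonneg (expCoeff_nonneg hx n) (tsum_nonneg (expCoeff_nonneg hx))

theorem tsum_expCoeff_pos (hx : ∀ l, 0 ≤ x l) (hs : Summable x) : 0 < ∑' k, expCoeff x k :=
  (summable_expCoeff hx hs).tsum_pos (expCoeff_nonneg hx) 0 (by simp [expCoeff])

theorem hasSum_massFn (hx : ∀ l, 0 ≤ x l) (hs : Summable x) : HasSum (massFn x) 1 := by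
  have hsum := (summable_expCoeff hx hs).hasSum.div_const (∑' k, expCoeff x k)
  rwa [div_self (tsum_expCoeff_pos hx hs).ne'] at hsum

theorem massFn_le_one (hx : ∀ l, 0 ≤ x l) (hs : Summable x) (n : ℕ) : massFn x n ≤ 1 :=
  le_hasSum (hasSum_massFn hx hs) n fun _ _ => massFn_nonneg hx _

theorem summable_massFn_mul (hx : ∀ l, 0 ≤ x l) (hs : Summable x) {f : ℕ → ℝ} {B : ℝ}
    (hf : ∀ n, |f n| ≤ B) : Summable fun n => massFn x n * f n := by
  refine Summable.of_norm_bounded ((hasSum_massFn hx hs).summable.mul_right B) fun n => ?_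
  rw [Real.norm_eq_abs, abs_mul, abs_of_nonneg (massFn_nonneg hx n)]
  exact mul_le_mul_of_nonneg_left (hf n) (massFn_nonneg hx n)

theorem tsum_massFn_mul_le (hx : ∀ l, 0 ≤ x l) (hs : Summable x) {f : ℕ → ℝ} {B : ℝ}
    (hsum : Summable fun n => massFn x n * f n) (hf : ∀ n, f n ≤ B) :
    ∑' n, massFn x n * f n ≤ B := by
  refine (hsum.tsum_le_tsum (fun n => mul_le_mul_of_nonneg_left (hf n) (massFn_nonneg hx n))
    ((hasSum_massFn hx hs).summable.mul_right B)).trans_eq ?_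
  rw [tsum_mul_right, (hasSum_massFn hx hs).tsum_eq, one_mul]

/-- The size-bias identity `E[(Z + x₀) f(Z)] = ∑ x_l E[f(Z + l)]`. -/
theorem hasSum_nat_add_mul_massFn (hx : ∀ l, 0 ≤ x l) (hs : Summable x) {f : ℕ → ℝ} {B : ℝ}
    (hf : ∀ n, |f n| ≤ B) :
    HasSum (fun n : ℕ => (n + x 0) * f n * massFn x n)
      (∑' l, x l * ∑' m, massFn x m * f (l + m)) := by
  have hsum := (hasSum_nat_add_mul_expCoeff hx hs hf).div_const (∑' k, expCoeff x k)
  have htsum : (∑' l, x l * ∑' m, expCoeff x m * f (l + m)) / ∑' k, expCoeff x k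
      = ∑' l, x l * ∑' m, massFn x m * f (l + m) := by
    simp only [massFn, div_mul_eq_mul_div, tsum_div_const, mul_div_assoc']
  rw [htsum] at hsum
  simpa only [massFn, mul_div_assoc'] using hsum

end Weights

/-! ### Comparison principles for the recursion -/

section Comparison

variable {y f : ℕ → ℝ} {P : ℕ → Prop} [DecidablePred P] {N : ℕ} {m a D E : ℝ}

theorem one_le_exp_neg_mul_sub (ha : 0 ≤ a) {t : ℝ} (ht : t ≤ m) :
    1 ≤ Real.exp (-(a * (t - m))) := by
  rw [Real.one_le_exp_iff]
  nlinarith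

theorem exp_neg_mul_nat_sub {l n : ℕ} (hl : l ≤ n) :
    Real.exp (-(a * ((n - l : ℕ) - m))) = Real.exp (a * l) * Real.exp (-(a * (n - m))) := by
  rw [← Real.exp_add, Nat.cast_sub hl]
  ring_nf

theorem sum_Icc_filter_mono (hy : ∀ l, 0 ≤ y l) {n : ℕ} (hn : n ≤ N) :
    ∑ l ∈ (Finset.Icc 1 n).filter P, y l ≤ ∑ l ∈ (Finset.Icc 1 N).filter P, y l :=
  Finset.sum_le_sum_of_subset_of_nonneg
    (Finset.filter_subset_filter _ (Finset.Icc_subset_Icc_right hn)) fun l _ _ => hy l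

theorem le_exp_add_of_recursion (hy : ∀ l, 0 ≤ y l) (ha : 0 ≤ a) (hm : 0 ≤ m) (hD : 0 ≤ D)
    (hf_le : ∀ n : ℕ, n ≤ m → f n ≤ 1)
    (hf : ∀ n ≤ N, m < n → n * f n ≤ ∑ l ∈ (Finset.Icc 1 n).filter P, y l * f (n - l) + E)
    (hexp : ∑ l ∈ (Finset.Icc 1 N).filter P, y l * Real.exp (a * l) ≤ m)
    (hDE : (∑ l ∈ (Finset.Icc 1 N).filter P, y l) * D + E ≤ m * D) {n : ℕ} (hn : n ≤ N) :
    f n ≤ Real.exp (-(a * (n - m))) + D := by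
  induction n using Nat.strong_induction_on with
  | _ n ih =>
  rcases le_or_gt (n : ℝ) m with hnm | hnm
  · linarith [hf_le n hnm, one_le_exp_neg_mul_sub ha hnm]
  set w := Real.exp (-(a * (n - m)))
  have hw : 0 ≤ w := (Real.exp_pos _).le
  have hterm : ∀ l ∈ (Finset.Icc 1 n).filter P,
      y l * f (n - l) ≤ y l * Real.exp (a * l) * w + y l * D := by
    intro l hl
    rw [Finset.mem_filter, Finset.mem_Icc] at hl
    rw [mul_assoc, ← exp_neg_mul_nat_sub hl.1.2, ← mul_add]
    exact mul_le_mul_of_nonneg_left (ih (n - l) (by omega) (by omega)) (hy l)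
  have hsum := Finset.sum_le_sum hterm
  rw [Finset.sum_add_distrib, ← Finset.sum_mul, ← Finset.sum_mul] at hsum
  have hexp' := mul_le_mul_of_nonneg_right ((sum_Icc_filter_mono (fun l =>
    mul_nonneg (hy l) (Real.exp_pos (a * l)).le) hn).trans hexp) hw
  have hyD := mul_le_mul_of_nonneg_right (sum_Icc_filter_mono (P := P) hy hn) hD
  refine le_of_mul_le_mul_left ?_ (hm.trans_lt hnm)
  calc n * f n ≤ m * w + m * D := by linarith [hf n hn hnm]
    _ = m * (w + D) := (mul_add _ _ _).symm
    _ ≤ n * (w + D) := mul_le_mul_of_nonneg_right hnm.le (add_nonneg hw hD)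

theorem ge_of_recursion (hy : ∀ l, 0 ≤ y l) (ha : 0 ≤ a) (hm : 0 ≤ m) (hD : 0 ≤ D)
    (hf_nonneg : ∀ n, 0 ≤ f n)
    (hf : ∀ n ≤ N, m < n → ∑ l ∈ (Finset.Icc 1 n).filter P, y l * f (n - l) + E ≤ n * f n)
    (hexp : ∑ l ∈ (Finset.Icc 1 N).filter P, y l * Real.exp (a * l) ≤ m)
    (hDE : ∀ n ≤ N, m < n → n * D ≤ (∑ l ∈ (Finset.Icc 1 n).filter P, y l) * D + E)
    {n : ℕ} (hn : n ≤ N) : D * (1 - Real.exp (-(a * (n - m)))) ≤ f n := by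
  induction n using Nat.strong_induction_on with
  | _ n ih =>
  rcases le_or_gt (n : ℝ) m with hnm | hnm
  · have hexp_ge := one_le_exp_neg_mul_sub ha hnm
    exact (mul_nonpos_of_nonneg_of_nonpos hD (by linarith)).trans (hf_nonneg n)
  set w := Real.exp (-(a * (n - m)))
  have hwD : 0 ≤ w * D := mul_nonneg (Real.exp_pos _).le hD
  have hterm : ∀ l ∈ (Finset.Icc 1 n).filter P,
      y l * D - y l * Real.exp (a * l) * (w * D) ≤ y l * f (n - l) := by
    intro l hl
    rw [Finset.mem_filter, Finset.mem_Icc] at hl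
    have hprev := ih (n - l) (by omega) (by omega)
    rw [exp_neg_mul_nat_sub hl.1.2] at hprev
    refine le_trans (le_of_eq ?_) (mul_le_mul_of_nonneg_left hprev (hy l))
    ring
  have hsum := Finset.sum_le_sum hterm
  rw [Finset.sum_sub_distrib, ← Finset.sum_mul, ← Finset.sum_mul] at hsum
  have hexp' := mul_le_mul_of_nonneg_right (((sum_Icc_filter_mono (fun l =>
    mul_nonneg (hy l) (Real.exp_pos (a * l)).le) hn).trans hexp).trans hnm.le) hwD
  refine le_of_mul_le_mul_left ?_ (hm.trans_lt hnm)
  calc n * (D * (1 - w)) = n * D - n * (w * D) := by ring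
    _ ≤ n * f n := by linarith [hf n hn hnm, hDE n hn hnm]

end Comparison

/-! ### Concentration -/

/-- The truncation of a real number to `[-1, 1]`: a bounded test function replacing the identity in
the second-moment estimate, since the distributions considered have infinite variance. -/
def clamp (t : ℝ) : ℝ := max (-1) (min 1 t)

theorem abs_clamp_le_one (t : ℝ) : |clamp t| ≤ 1 :=
  abs_le.2 ⟨le_max_left _ _, max_le (by norm_num) (min_le_left _ _)⟩

theorem clamp_add_sub_clamp_le {t : ℝ} (ht : 0 ≤ t) (d : ℝ) :
    clamp (d + t) - clamp d ≤ min 2 t := by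
  refine le_min ?_ ?_
  · linarith [(abs_le.1 (abs_clamp_le_one (d + t))).2, (abs_le.1 (abs_clamp_le_one d)).1]
  · rw [sub_le_iff_le_add']
    refine max_le ((le_max_left _ _).trans (le_add_of_nonneg_right ht)) ?_
    refine le_trans ?_ (add_le_add_left (le_max_right _ _) t)
    rw [← min_add_add_right]
    exact min_le_min_right _ (le_add_of_nonneg_right ht)

theorem sq_mul_indicator_le_mul_clamp {e ε : ℝ} (he0 : 0 ≤ e) (he1 : e ≤ 1) (heε : e ≤ ε) (d : ℝ) :
    e ^ 2 * (if ε < |d| then 1 else 0) ≤ d * clamp d := by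
  have he_sq : e ^ 2 * (if ε < |d| then 1 else 0) ≤ e ^ 2 :=
    mul_le_of_le_one_right (sq_nonneg e) (by split_ifs <;> norm_num)
  rw [clamp]
  rcases le_total d (-1) with hd | hd
  · rw [min_eq_right (by linarith), max_eq_left hd]
    nlinarith
  rcases le_total d 1 with hd' | hd'
  · rw [min_eq_right hd', max_eq_right hd]
    split_ifs with hε
    · rw [mul_one, ← pow_two, ← sq_abs d]
      exact pow_le_pow_left₀ he0 (by linarith) 2
    · nlinarith
  · rw [min_eq_left hd', max_eq_right (by norm_num)]
    nlinarith

/-- Nonnegative summable sequences defining the weights `cycleWeight α β N`, the second one having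
the sum `μ`. -/
structure SummableWeights (α β : ℕ → ℝ) (μ : ℝ) : Prop where
  alpha_nonneg : ∀ l, 0 ≤ α l
  beta_nonneg : ∀ l, 0 ≤ β l
  alpha_zero : α 0 = 0
  beta_zero : β 0 = 0
  summable_alpha : Summable α
  hasSum : HasSum β μ

/-- The `massFn (cycleWeight α β N)` restricted to the points outside of the `ε N`-neighbourhood of
the mean `μ N`. -/
noncomputable def farMassFn (α β : ℕ → ℝ) (μ ε : ℝ) (N n : ℕ) : ℝ :=
  if ε * N < |(n : ℝ) - μ * N| then massFn (cycleWeight α β N) n else 0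

/-- The probability of the complement of the `ε N`-neighbourhood of `μ N` under
`massFn (cycleWeight α β N)`. -/
noncomputable def farMass (α β : ℕ → ℝ) (μ ε : ℝ) (N : ℕ) : ℝ := ∑' n, farMassFn α β μ ε N n

namespace SummableWeights

variable {α β : ℕ → ℝ} {μ : ℝ}

theorem weight_nonneg (h : SummableWeights α β μ) (N l : ℕ) : 0 ≤ cycleWeight α β N l :=
  add_nonneg (h.alpha_nonneg l) (mul_nonneg (Nat.cast_nonneg N) (h.beta_nonneg l))

theorem weight_zero (h : SummableWeights α β μ) (N : ℕ) : cycleWeight α β N 0 = 0 := by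
  simp [cycleWeight, h.alpha_zero, h.beta_zero]

theorem summable_weight (h : SummableWeights α β μ) (N : ℕ) : Summable (cycleWeight α β N) :=
  h.summable_alpha.add (h.hasSum.summable.mul_left _)

theorem massFn_nonneg (h : SummableWeights α β μ) (N n : ℕ) :
    0 ≤ massFn (cycleWeight α β N) n :=
  SurrogateSpatial.massFn_nonneg (h.weight_nonneg N) n

theorem hasSum_massFn (h : SummableWeights α β μ) (N : ℕ) :
    HasSum (massFn (cycleWeight α β N)) 1 :=
  SurrogateSpatial.hasSum_massFn (h.weight_nonneg N) (h.summable_weight N)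

theorem massFn_le_one (h : SummableWeights α β μ) (N n : ℕ) :
    massFn (cycleWeight α β N) n ≤ 1 :=
  SurrogateSpatial.massFn_le_one (h.weight_nonneg N) (h.summable_weight N) n

theorem farMassFn_nonneg (h : SummableWeights α β μ) (ε : ℝ) (N n : ℕ) :
    0 ≤ farMassFn α β μ ε N n := by
  rw [farMassFn]
  split_ifs
  exacts [h.massFn_nonneg N n, le_rfl]

theorem farMassFn_le (h : SummableWeights α β μ) (ε : ℝ) (N n : ℕ) :
    farMassFn α β μ ε N n ≤ massFn (cycleWeight α β N) n := by
  rw [farMassFn]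
  split_ifs
  exacts [le_rfl, h.massFn_nonneg N n]

theorem summable_farMassFn (h : SummableWeights α β μ) (ε : ℝ) (N : ℕ) :
    Summable (farMassFn α β μ ε N) :=
  (h.hasSum_massFn N).summable.of_nonneg_of_le (h.farMassFn_nonneg ε N) (h.farMassFn_le ε N)

theorem farMass_nonneg (h : SummableWeights α β μ) (ε : ℝ) (N : ℕ) : 0 ≤ farMass α β μ ε N :=
  tsum_nonneg (h.farMassFn_nonneg ε N)

theorem mul_min_le (h : SummableWeights α β μ) (N l : ℕ) :
    0 ≤ β l * min 2 ((l : ℝ) / N) ∧ β l * min 2 ((l : ℝ) / N) ≤ β l * 2 :=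
  ⟨mul_nonneg (h.beta_nonneg l) (le_min two_pos.le (by positivity)),
    mul_le_mul_of_nonneg_left (min_le_left _ _) (h.beta_nonneg l)⟩

theorem tendsto_tsum_mul_min (h : SummableWeights α β μ) :
    Tendsto (fun N : ℕ => ∑' l : ℕ, β l * min 2 ((l : ℝ) / N)) atTop (𝓝 0) := by
  have hlim : ∀ l : ℕ, Tendsto (fun N : ℕ => β l * min 2 ((l : ℝ) / N)) atTop (𝓝 0) := fun l => by
    simpa using ((tendsto_const_nhds (x := (2 : ℝ))).min
      (tendsto_const_div_atTop_nhds_zero_nat (l : ℝ))).const_mul (β l)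
  have htsum := tendsto_tsum_of_dominated_convergence (h.hasSum.summable.mul_right 2) hlim
    (Eventually.of_forall fun N l => by
      rw [Real.norm_eq_abs, abs_of_nonneg (h.mul_min_le N l).1]
      exact (h.mul_min_le N l).2)
  rwa [tsum_zero] at htsum

/-- The expectation of the truncated deviation of `l + Z`, where `Z` has the distribution
`massFn (cycleWeight α β N)`, from the mean `μ N` in the scale `N`. -/
noncomputable def clampedMean (α β : ℕ → ℝ) (μ : ℝ) (N l : ℕ) : ℝ :=
  ∑' m, massFn (cycleWeight α β N) m * clamp (((l + m : ℕ) : ℝ) / N - μ)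

theorem summable_massFn_mul_clamp (h : SummableWeights α β μ) (N l : ℕ) :
    Summable fun m : ℕ => massFn (cycleWeight α β N) m * clamp (((l + m : ℕ) : ℝ) / N - μ) :=
  summable_massFn_mul (h.weight_nonneg N) (h.summable_weight N) fun _ => abs_clamp_le_one _

theorem abs_clampedMean_le_one (h : SummableWeights α β μ) (N l : ℕ) :
    |clampedMean α β μ N l| ≤ 1 := by
  have hsum := h.summable_massFn_mul_clamp N l
  refine abs_le'.2 ⟨tsum_massFn_mul_le (h.weight_nonneg N) (h.summable_weight N) hsum
    fun m => (abs_le.1 (abs_clamp_le_one _)).2, ?_⟩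
  rw [clampedMean, ← tsum_neg]
  simp only [← mul_neg]
  refine tsum_massFn_mul_le (h.weight_nonneg N) (h.summable_weight N) ?_
    fun m => neg_le.1 (abs_le.1 (abs_clamp_le_one _)).1
  simpa only [mul_neg] using hsum.neg

theorem clampedMean_le_add (h : SummableWeights α β μ) (N l : ℕ) :
    clampedMean α β μ N l ≤ clampedMean α β μ N 0 + min 2 ((l : ℝ) / N) := by
  rw [← sub_le_iff_le_add', clampedMean, clampedMean,
    ← (h.summable_massFn_mul_clamp N l).tsum_sub (h.summable_massFn_mul_clamp N 0)]
  have hdiff := (h.summable_massFn_mul_clamp N l).sub (h.summable_massFn_mul_clamp N 0)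
  simp only [← mul_sub] at hdiff ⊢
  refine tsum_massFn_mul_le (h.weight_nonneg N) (h.summable_weight N) hdiff fun m => ?_
  have hadd : ((l + m : ℕ) : ℝ) / N - μ = ((0 + m : ℕ) : ℝ) / N - μ + l / N := by
    push_cast
    ring
  rw [hadd]
  exact clamp_add_sub_clamp_le (by positivity) _

theorem tsum_weight_mul_clampedMean_le (h : SummableWeights α β μ) (N : ℕ) :
    ∑' l, cycleWeight α β N l * clampedMean α β μ N l ≤ ∑' l, α l
      + N * (μ * clampedMean α β μ N 0 + ∑' l : ℕ, β l * min 2 ((l : ℝ) / N)) := by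
  set a := clampedMean α β μ N
  have hmin : Summable fun l : ℕ => β l * min 2 ((l : ℝ) / N) :=
    (h.hasSum.summable.mul_right 2).of_nonneg_of_le (fun l => (h.mul_min_le N l).1)
      fun l => (h.mul_min_le N l).2
  have hbound : HasSum (fun l : ℕ => α l + N * (β l * a 0 + β l * min 2 ((l : ℝ) / N)))
      (∑' l, α l + N * (μ * a 0 + ∑' l : ℕ, β l * min 2 ((l : ℝ) / N))) :=
    h.summable_alpha.hasSum.add (((h.hasSum.mul_right (a 0)).add hmin.hasSum).mul_left _)
  have hsum : Summable fun l => cycleWeight α β N l * a l := by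
    refine Summable.of_norm_bounded (h.summable_weight N) fun l => ?_
    rw [Real.norm_eq_abs, abs_mul, abs_of_nonneg (h.weight_nonneg N l)]
    exact mul_le_of_le_one_right (h.weight_nonneg N l) (h.abs_clampedMean_le_one N l)
  rw [← hbound.tsum_eq]
  refine hsum.tsum_le_tsum (fun l => ?_) hbound.summable
  rw [cycleWeight, add_mul, mul_assoc, ← mul_add (β l)]
  refine add_le_add ?_ (mul_le_mul_of_nonneg_left ?_ (Nat.cast_nonneg N))
  · exact mul_le_of_le_one_right (h.alpha_nonneg l) (abs_le.1 (h.abs_clampedMean_le_one N l)).2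
  · exact mul_le_mul_of_nonneg_left (h.clampedMean_le_add N l) (h.beta_nonneg l)

theorem sq_mul_farMass_le (h : SummableWeights α β μ) {e ε : ℝ} (he0 : 0 ≤ e) (he1 : e ≤ 1)
    (heε : e ≤ ε) {N : ℕ} (hN : 0 < N) :
    e ^ 2 * farMass α β μ ε N
      ≤ (∑' l, cycleWeight α β N l * clampedMean α β μ N l) / N - μ * clampedMean α β μ N 0 := by
  have hN' : (0 : ℝ) < N := Nat.cast_pos.2 hN
  have hmoment : HasSum
      (fun n : ℕ => ((n : ℝ) / N - μ) * clamp (n / N - μ) * massFn (cycleWeight α β N) n)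
      ((∑' l, cycleWeight α β N l * clampedMean α β μ N l) / N - μ * clampedMean α β μ N 0) := by
    have hbias := (hasSum_nat_add_mul_massFn (h.weight_nonneg N) (h.summable_weight N)
      (f := fun n : ℕ => clamp (n / N - μ)) fun _ => abs_clamp_le_one _).div_const (N : ℝ)
    have hzero := (h.summable_massFn_mul_clamp N 0).hasSum.mul_left μ
    simp only [h.weight_zero, add_zero] at hbias
    refine (hbias.sub hzero).congr_fun fun n => ?_
    rw [zero_add]
    ring
  rw [farMass, ← tsum_mul_left, ← hmoment.tsum_eq]
  refine Summable.tsum_le_tsum (fun n => ?_) ((h.summable_farMassFn ε N).mul_left _)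
    hmoment.summable
  have hfar : ε * N < |(n : ℝ) - μ * N| ↔ ε < |(n : ℝ) / N - μ| := by
    rw [div_sub' hN'.ne', abs_div, abs_of_pos hN', lt_div_iff₀ hN', mul_comm μ]
  refine le_trans (le_of_eq ?_) (mul_le_mul_of_nonneg_right
    (sq_mul_indicator_le_mul_clamp he0 he1 heε ((n : ℝ) / N - μ)) (h.massFn_nonneg N n))
  rw [farMassFn, if_congr hfar rfl rfl]
  split_ifs <;> simp

/-- A weak law of large numbers; the second moment being possibly infinite, Chebyshev's argument is
applied to the truncated deviation `clamp`. -/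
theorem tendsto_farMass (h : SummableWeights α β μ) {ε : ℝ} (hε : 0 < ε) :
    Tendsto (farMass α β μ ε) atTop (𝓝 0) := by
  set e := min ε 1
  have he0 : 0 < e := lt_min hε one_pos
  have hlim : Tendsto (fun N : ℕ => (e ^ 2)⁻¹ *
      (∑' l : ℕ, β l * min 2 ((l : ℝ) / N) + (∑' l, α l) / N)) atTop (𝓝 0) := by
    simpa using (h.tendsto_tsum_mul_min.add
      (tendsto_const_div_atTop_nhds_zero_nat (∑' l, α l))).const_mul _
  refine squeeze_zero' (Eventually.of_forall fun N => h.farMass_nonneg ε N) ?_ hlim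
  filter_upwards [eventually_gt_atTop 0] with N hN
  have hN' : (0 : ℝ) < N := Nat.cast_pos.2 hN
  rw [inv_mul_eq_div, le_div_iff₀ (by positivity), mul_comm]
  refine (h.sq_mul_farMass_le he0.le (min_le_right _ _) (min_le_left _ _) hN).trans ?_
  rw [sub_le_iff_le_add, div_le_iff₀ hN']
  refine (h.tsum_weight_mul_clampedMean_le N).trans (le_of_eq ?_)
  field_simp
  ring

end SummableWeights

/-! ### Local asymptotics -/

theorem sum_Icc_sub_eq (g : ℕ → ℝ) (n : ℕ) :
    ∑ l ∈ Finset.Icc 1 n, g (n - l) = ∑ m ∈ Finset.range n, g m := by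
  refine Finset.sum_bij' (fun l _ => n - l) (fun m _ => n - m) ?_ ?_ ?_ ?_ ?_
  all_goals
    intro l hl
    simp only [Finset.mem_Icc, Finset.mem_range] at hl ⊢
    try omega

theorem sum_filter_sub_le_tsum {g : ℕ → ℝ} (hg : ∀ m, 0 ≤ g m) (hs : Summable g) (n : ℕ)
    (P : ℕ → Prop) [DecidablePred P] :
    ∑ l ∈ (Finset.Icc 1 n).filter P, g (n - l) ≤ ∑' m, g m := by
  refine (Finset.sum_le_sum_of_subset_of_nonneg (Finset.filter_subset _ _)
    fun _ _ _ => hg _).trans ?_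
  rw [sum_Icc_sub_eq]
  exact hs.sum_le_tsum _ fun _ _ => hg _

theorem eventually_le_mul_nat (a : ℝ) {δ : ℝ} (hδ : 0 < δ) : ∀ᶠ N : ℕ in atTop, a ≤ δ * N :=
  (tendsto_natCast_atTop_atTop.const_mul_atTop hδ).eventually_ge_atTop a

theorem exp_mul_log_div_mul_le {A δ : ℝ} (hA : 0 ≤ A) {N l : ℕ} (hl : 1 ≤ l) (hN : 1 ≤ N)
    (hlN : (l : ℝ) ≤ δ * N) :
    Real.exp (A * Real.log N / N * l) ≤ Real.exp A * (l : ℝ) ^ (A * δ) := by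
  have hl' : (0 : ℝ) < l := Nat.cast_pos.2 hl
  have hN' : (0 : ℝ) < N := Nat.cast_pos.2 hN
  have hlog : Real.log N - Real.log l ≤ N / l - 1 := by
    rw [← Real.log_div hN'.ne' hl'.ne']
    exact Real.log_le_sub_one_of_pos (by positivity)
  have hdiv : (l : ℝ) / N * Real.log l ≤ δ * Real.log l :=
    mul_le_mul_of_nonneg_right ((div_le_iff₀ hN').2 hlN) (Real.log_nonneg (Nat.one_le_cast.2 hl))
  have hbound : (l : ℝ) / N * Real.log N ≤ 1 + δ * Real.log l := calc
    (l : ℝ) / N * Real.log N = l / N * (Real.log N - Real.log l) + l / N * Real.log l := by ring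
    _ ≤ l / N * (N / l - 1) + δ * Real.log l := by gcongr
    _ = 1 - l / N + δ * Real.log l := by field_simp
    _ ≤ 1 + δ * Real.log l := by gcongr; exact sub_le_self _ (by positivity)
  rw [Real.rpow_def_of_pos hl', ← Real.exp_add, Real.exp_le_exp]
  calc A * Real.log N / N * l = A * (l / N * Real.log N) := by ring
    _ ≤ A * (1 + δ * Real.log l) := mul_le_mul_of_nonneg_left hbound hA
    _ = A + Real.log l * (A * δ) := by ring

theorem exp_neg_log_mul_le_rpow {A ε s : ℝ} (hAε : 4 * s ≤ A * ε) (hA : 0 ≤ A) {N k : ℕ}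
    (hN : 1 ≤ N) (hk : 2 * (k : ℝ) ≤ ε * N) (hkN : k ≤ N) :
    Real.exp (-(A * Real.log N / N * (((N - k : ℕ) : ℝ) - (1 - ε) * N)))
      ≤ (N : ℝ) ^ (-(2 * s)) := by
  have hN' : (0 : ℝ) < N := Nat.cast_pos.2 hN
  have : 0 ≤ Real.log N := Real.log_nonneg (Nat.one_le_cast.2 hN)
  rw [Real.rpow_def_of_pos hN', Real.exp_le_exp, Nat.cast_sub hkN, mul_neg, neg_le_neg_iff]
  calc Real.log N * (2 * s) ≤ Real.log N * (A * ε / 2) := by gcongr; linarith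
    _ = A * Real.log N / N * (ε * N / 2) := by field_simp
    _ ≤ A * Real.log N / N * ((N : ℝ) - k - (1 - ε) * N) := by gcongr; linarith

/-- The points of the `ε N`-neighbourhood of `μ N` are all of the form `n - l` with
`δ N < l ≤ n`. -/
theorem SummableWeights.one_sub_farMass_eq_sum {α β : ℕ → ℝ} {μ : ℝ} (h : SummableWeights α β μ)
    {ε δ : ℝ} (hδ : 0 ≤ δ) {N n : ℕ} (hn : (μ + ε + δ) * N < n) :
    1 - farMass α β μ ε N = ∑ l ∈ (Finset.Icc 1 n).filter (fun l : ℕ => ¬ (l : ℝ) ≤ δ * N),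
      (massFn (cycleWeight α β N) (n - l) - farMassFn α β μ ε N (n - l)) := by
  have hzero : ∀ m : ℕ, (n : ℝ) - δ * N ≤ m →
      massFn (cycleWeight α β N) m - farMassFn α β μ ε N m = 0 := by
    intro m hm
    rw [farMassFn, if_pos, sub_self]
    exact lt_of_lt_of_le (by linarith) (le_abs_self _)
  rw [farMass, ← ((h.hasSum_massFn N).sub (h.summable_farMassFn ε N).hasSum).tsum_eq,
    tsum_eq_sum (s := Finset.range n), ← sum_Icc_sub_eq]
  · refine (Finset.sum_subset (Finset.filter_subset _ _) fun l hl hl' => hzero _ ?_).symm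
    rw [Finset.mem_filter, not_and, not_not] at hl'
    rw [Nat.cast_sub (Finset.mem_Icc.1 hl).2]
    linarith [hl' hl]
  · intro m hm
    rw [Finset.mem_range, not_lt] at hm
    exact hzero m ((sub_le_self _ (by positivity)).trans (Nat.cast_le.2 hm))

/-- Weights `cycleWeight α β N` for which `β` has the tail `c l^{-s}` and the sum `μ < 1`, and `α`
is of no larger order. -/
structure HeavyTail (α β : ℕ → ℝ) (s c μ : ℝ) : Prop extends SummableWeights α β μ where
  one_lt : 1 < s
  c_pos : 0 < c
  tendsto : Tendsto (fun l : ℕ => β l * (l : ℝ) ^ s) atTop (𝓝 c)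
  bdd : ∃ C, ∀ l : ℕ, α l * (l : ℝ) ^ s ≤ C
  mu_lt : μ < 1

/-- The normalised weights, exponentially tilted at the rate `A log N / N` and truncated at
`δ N`. -/
noncomputable def tiltedWeight (α β : ℕ → ℝ) (A δ : ℝ) (N l : ℕ) : ℝ :=
  if (l : ℝ) ≤ δ * N then cycleWeight α β N l / N * Real.exp (A * Real.log N / N * l) else 0

namespace HeavyTail

variable {α β : ℕ → ℝ} {s c μ : ℝ}

theorem mu_pos (h : HeavyTail α β s c μ) : 0 < μ := by
  obtain ⟨l, hl⟩ := (h.tendsto.eventually (lt_mem_nhds h.c_pos)).exists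
  rw [← h.hasSum.tsum_eq]
  exact h.hasSum.summable.tsum_pos h.beta_nonneg l (pos_of_mul_pos_left hl (by positivity))

theorem exists_le_rpow (h : HeavyTail α β s c μ) :
    ∃ C, 0 < C ∧ ∀ l : ℕ, α l ≤ C * (l : ℝ) ^ (-s) ∧ β l ≤ C * (l : ℝ) ^ (-s) := by
  obtain ⟨C₁, hC₁⟩ := h.bdd
  obtain ⟨C₂, hC₂⟩ := h.tendsto.bddAbove_range
  refine ⟨max 1 (max C₁ C₂), lt_max_of_lt_left one_pos, fun l => ?_⟩
  rcases Nat.eq_zero_or_pos l with rfl | hl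
  · rw [h.alpha_zero, h.beta_zero, and_self]
    positivity
  · have hl' : (0 : ℝ) < l := Nat.cast_pos.2 hl
    have hpow : 0 < (l : ℝ) ^ s := Real.rpow_pos_of_pos hl' s
    rw [Real.rpow_neg hl'.le, ← div_eq_mul_inv, le_div_iff₀ hpow, le_div_iff₀ hpow]
    exact ⟨(hC₁ l).trans (le_max_of_le_right (le_max_left _ _)),
      (hC₂ ⟨l, rfl⟩).trans (le_max_of_le_right (le_max_right _ _))⟩

theorem exists_weight_div_le (h : HeavyTail α β s c μ) :
    ∃ C, 0 < C ∧ ∀ N : ℕ, 1 ≤ N → ∀ l : ℕ, cycleWeight α β N l / N ≤ C * (l : ℝ) ^ (-s) := by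
  obtain ⟨C, hC_pos, hC⟩ := h.exists_le_rpow
  refine ⟨2 * C, by positivity, fun N hN l => ?_⟩
  have : (0 : ℝ) < N := Nat.cast_pos.2 hN
  have hα : α l / N ≤ α l := div_le_self (h.alpha_nonneg l) (Nat.one_le_cast.2 hN)
  calc cycleWeight α β N l / N = α l / N + β l := by rw [cycleWeight]; field_simp
    _ ≤ 2 * C * (l : ℝ) ^ (-s) := by linarith [(hC l).1, (hC l).2]

theorem exists_weight_le (h : HeavyTail α β s c μ) {δ : ℝ} (hδ : 0 < δ) :
    ∃ C, 0 < C ∧ ∀ N : ℕ, 1 ≤ N → ∀ l : ℕ, δ * N ≤ l →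
      cycleWeight α β N l ≤ N * (N : ℝ) ^ (-s) * C := by
  obtain ⟨C, hC_pos, hC⟩ := h.exists_weight_div_le
  refine ⟨C * δ ^ (-s), by positivity, fun N hN l hl => ?_⟩
  have hN' : (0 : ℝ) < N := Nat.cast_pos.2 hN
  have hpow : (l : ℝ) ^ (-s) ≤ δ ^ (-s) * (N : ℝ) ^ (-s) := by
    rw [← Real.mul_rpow hδ.le hN'.le]
    exact Real.rpow_le_rpow_of_nonpos (by positivity) hl (by linarith [h.one_lt])
  calc cycleWeight α β N l = N * (cycleWeight α β N l / N) := by field_simp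
    _ ≤ N * (C * (δ ^ (-s) * (N : ℝ) ^ (-s))) := by
      gcongr
      exact (hC N hN l).trans (mul_le_mul_of_nonneg_left hpow hC_pos.le)
    _ = N * (N : ℝ) ^ (-s) * (C * δ ^ (-s)) := by ring

theorem eventually_beta_bounds (h : HeavyTail α β s c μ) {ε : ℝ} (hε : 0 < ε) :
    ∀ᶠ l : ℕ in atTop, (c - ε) * (l : ℝ) ^ (-s) ≤ β l ∧ β l ≤ (c + ε) * (l : ℝ) ^ (-s) := by
  filter_upwards [h.tendsto.eventually (le_mem_nhds (sub_lt_self c hε)),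
    h.tendsto.eventually (ge_mem_nhds (lt_add_of_pos_right c hε)), eventually_gt_atTop 0]
    with l hlow hup hl
  have hl' : (0 : ℝ) < l := Nat.cast_pos.2 hl
  have hpow : 0 < (l : ℝ) ^ s := Real.rpow_pos_of_pos hl' s
  rw [Real.rpow_neg hl'.le, ← div_eq_mul_inv, ← div_eq_mul_inv, le_div_iff₀ hpow,
    div_le_iff₀ hpow]
  exact ⟨hlow, hup⟩

theorem eventually_weight_le (h : HeavyTail α β s c μ) {ε δ : ℝ} (hε : 0 < ε) (hδ : 0 < δ) :
    ∀ᶠ N : ℕ in atTop, ∀ l : ℕ, δ * N ≤ l →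
      cycleWeight α β N l ≤ N * (N : ℝ) ^ (-s) * ((c + 2 * ε) * δ ^ (-s)) := by
  obtain ⟨C, -, hC⟩ := h.exists_le_rpow
  obtain ⟨L, hL⟩ := eventually_atTop.1 (h.eventually_beta_bounds hε)
  filter_upwards [eventually_le_mul_nat L hδ, eventually_le_mul_nat C hε, eventually_ge_atTop 1]
    with N hLN hCN hN l hl
  have hN' : (0 : ℝ) < N := Nat.cast_pos.2 hN
  have hc := h.c_pos
  have hpow : (l : ℝ) ^ (-s) ≤ δ ^ (-s) * (N : ℝ) ^ (-s) := by
    rw [← Real.mul_rpow hδ.le hN'.le]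
    exact Real.rpow_le_rpow_of_nonpos (by positivity) hl (by linarith [h.one_lt])
  calc cycleWeight α β N l
      ≤ ε * N * (l : ℝ) ^ (-s) + N * ((c + ε) * (l : ℝ) ^ (-s)) := by
        refine add_le_add ((hC l).1.trans ?_) ?_
        · exact mul_le_mul_of_nonneg_right hCN (by positivity)
        · exact mul_le_mul_of_nonneg_left (hL l (Nat.cast_le.1 (hLN.trans hl))).2 hN'.le
    _ = N * (c + 2 * ε) * (l : ℝ) ^ (-s) := by ring
    _ ≤ N * (c + 2 * ε) * (δ ^ (-s) * (N : ℝ) ^ (-s)) := by gcongr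
    _ = N * (N : ℝ) ^ (-s) * ((c + 2 * ε) * δ ^ (-s)) := by ring

theorem eventually_le_weight (h : HeavyTail α β s c μ) {ε δ δ' : ℝ} (hε : 0 < ε) (hεc : ε < c)
    (hδ : 0 < δ) (hδ' : 0 < δ') :
    ∀ᶠ N : ℕ in atTop, ∀ l : ℕ, δ * N ≤ l → l ≤ δ' * N →
      N * (N : ℝ) ^ (-s) * ((c - ε) * δ' ^ (-s)) ≤ cycleWeight α β N l := by
  obtain ⟨L, hL⟩ := eventually_atTop.1 (h.eventually_beta_bounds hε)
  filter_upwards [eventually_le_mul_nat L hδ, eventually_ge_atTop 1] with N hLN hN l hl hl'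
  have hN' : (0 : ℝ) < N := Nat.cast_pos.2 hN
  have hl_pos : (0 : ℝ) < l := lt_of_lt_of_le (by positivity) hl
  have hpow : δ' ^ (-s) * (N : ℝ) ^ (-s) ≤ (l : ℝ) ^ (-s) := by
    rw [← Real.mul_rpow hδ'.le hN'.le]
    exact Real.rpow_le_rpow_of_nonpos hl_pos hl' (by linarith [h.one_lt])
  have : 0 ≤ c - ε := sub_nonneg.2 hεc.le
  calc N * (N : ℝ) ^ (-s) * ((c - ε) * δ' ^ (-s))
      = N * ((c - ε) * (δ' ^ (-s) * (N : ℝ) ^ (-s))) := by ring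
    _ ≤ N * ((c - ε) * (l : ℝ) ^ (-s)) := by gcongr
    _ ≤ N * β l := mul_le_mul_of_nonneg_left (hL l (Nat.cast_le.1 (hLN.trans hl))).1 hN'.le
    _ ≤ cycleWeight α β N l := le_add_of_nonneg_left (h.alpha_nonneg l)

theorem tiltedWeight_nonneg (h : HeavyTail α β s c μ) (A δ : ℝ) (N l : ℕ) :
    0 ≤ tiltedWeight α β A δ N l := by
  have hweight := h.weight_nonneg N l
  rw [tiltedWeight]
  split_ifs <;> positivity

theorem exists_summable_tiltedWeight_le (h : HeavyTail α β s c μ) {A δ : ℝ} (hA : 0 ≤ A)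
    (hAδ : A * δ ≤ (s - 1) / 2) :
    ∃ g : ℕ → ℝ, Summable g ∧ ∀ N : ℕ, 1 ≤ N → ∀ l, tiltedWeight α β A δ N l ≤ g l := by
  obtain ⟨C, hC_pos, hC⟩ := h.exists_weight_div_le
  refine ⟨fun l : ℕ => C * Real.exp A * (l : ℝ) ^ (-s + (s - 1) / 2),
    (Real.summable_nat_rpow.2 (by linarith [h.one_lt])).mul_left _, fun N hN l => ?_⟩
  rw [tiltedWeight]
  split_ifs with hlN
  · rcases Nat.eq_zero_or_pos l with rfl | hl
    · rw [h.weight_zero, zero_div, zero_mul]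
      positivity
    have hl' : (1 : ℝ) ≤ l := Nat.one_le_cast.2 hl
    calc cycleWeight α β N l / N * Real.exp (A * Real.log N / N * l)
        ≤ C * (l : ℝ) ^ (-s) * (Real.exp A * (l : ℝ) ^ ((s - 1) / 2)) := by
          refine mul_le_mul (hC N hN l) ((exp_mul_log_div_mul_le hA hl hN hlN).trans ?_)
            (Real.exp_pos _).le (by positivity)
          gcongr
      _ = C * Real.exp A * (l : ℝ) ^ (-s + (s - 1) / 2) := by
          rw [Real.rpow_add (one_pos.trans_le hl')]
          ring
  · positivity

theorem tendsto_tiltedWeight (α β : ℕ → ℝ) (A : ℝ) {δ : ℝ} (hδ : 0 < δ) (l : ℕ) :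
    Tendsto (fun N => tiltedWeight α β A δ N l) atTop (𝓝 (β l)) := by
  have hlog : Tendsto (fun N : ℕ => Real.log N / N) atTop (𝓝 0) :=
    Real.isLittleO_log_id_atTop.tendsto_div_nhds_zero.comp tendsto_natCast_atTop_atTop
  have hlim : Tendsto (fun N : ℕ => (α l / N + β l) * Real.exp (A * (Real.log N / N) * l)) atTop
      (𝓝 (β l)) := by
    simpa using ((tendsto_const_div_atTop_nhds_zero_nat (α l)).add_const (β l)).mul
      ((hlog.const_mul A).mul_const (l : ℝ)).rexp
  refine hlim.congr' ?_
  filter_upwards [eventually_le_mul_nat l hδ, eventually_gt_atTop 0] with N hlN hN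
  have hN' : (0 : ℝ) < N := Nat.cast_pos.2 hN
  rw [tiltedWeight, if_pos hlN, cycleWeight, mul_div_assoc, add_div, mul_div_cancel_left₀ _ hN'.ne']

/-- Up to the distance `δ N` with a small `δ`, the total weight is essentially unaffected by an
exponential tilt at the rate `A log N / N`, which is why the recursion forgets its initial values
at a polynomial rate. -/
theorem eventually_sum_weight_mul_exp_le (h : HeavyTail α β s c μ) {A ε δ : ℝ} (hA : 0 ≤ A)
    (hε : 0 < ε) (hδ : 0 < δ) (hAδ : A * δ ≤ (s - 1) / 2) : ∀ᶠ N : ℕ in atTop,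
      ∑ l ∈ (Finset.Icc 1 N).filter (fun l : ℕ => (l : ℝ) ≤ δ * N),
        cycleWeight α β N l * Real.exp (A * Real.log N / N * l) ≤ (μ + ε) * N := by
  obtain ⟨g, hg_summable, hg⟩ := h.exists_summable_tiltedWeight_le hA hAδ
  have hnorm : ∀ N : ℕ, 1 ≤ N → ∀ l, ‖tiltedWeight α β A δ N l‖ ≤ g l := fun N hN l => by
    rw [Real.norm_of_nonneg (h.tiltedWeight_nonneg A δ N l)]
    exact hg N hN l
  have hlim := tendsto_tsum_of_dominated_convergence hg_summable (tendsto_tiltedWeight α β A hδ)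
    ((eventually_ge_atTop 1).mono hnorm)
  rw [h.hasSum.tsum_eq] at hlim
  filter_upwards [hlim.eventually (ge_mem_nhds (lt_add_of_pos_right μ hε)), eventually_ge_atTop 1]
    with N htsum hN
  have hN' : (0 : ℝ) < N := Nat.cast_pos.2 hN
  have hsummable := Summable.of_norm_bounded hg_summable (hnorm N hN)
  refine le_trans ?_ (mul_le_mul_of_nonneg_right
    ((hsummable.sum_le_tsum ((Finset.Icc 1 N).filter fun l : ℕ => (l : ℝ) ≤ δ * N)
      fun l _ => h.tiltedWeight_nonneg A δ N l).trans htsum) hN'.le)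
  rw [Finset.sum_mul]
  refine le_of_eq (Finset.sum_congr rfl fun l hl => ?_)
  rw [tiltedWeight, if_pos (Finset.mem_filter.1 hl).2]
  field_simp

theorem eventually_le_sum_weight (h : HeavyTail α β s c μ) {ε δ : ℝ} (hε : 0 < ε) (hδ : 0 < δ) :
    ∀ᶠ N : ℕ in atTop, ∀ n : ℕ, δ * N ≤ n → (μ - ε) * N ≤
      ∑ l ∈ (Finset.Icc 1 n).filter (fun l : ℕ => (l : ℝ) ≤ δ * N), cycleWeight α β N l := by
  obtain ⟨K, hK⟩ :=
    (h.hasSum.tendsto_sum_nat.eventually (lt_mem_nhds (sub_lt_self μ hε))).exists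
  filter_upwards [eventually_le_mul_nat K hδ] with N hKN n hn
  calc (μ - ε) * N ≤ (∑ l ∈ Finset.range K, β l) * N := by gcongr
    _ ≤ ∑ l ∈ Finset.range K, cycleWeight α β N l := by
        rw [Finset.sum_mul]
        refine Finset.sum_le_sum fun l _ => ?_
        rw [cycleWeight, mul_comm]
        exact le_add_of_nonneg_left (h.alpha_nonneg l)
    _ ≤ _ := by
        rw [← Finset.sum_filter_ne_zero]
        refine Finset.sum_le_sum_of_subset_of_nonneg (fun l hl => ?_)
          fun l _ _ => h.weight_nonneg N l
        rw [Finset.mem_filter, Finset.mem_range] at hl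
        have hl_ne : l ≠ 0 := fun hl_eq => hl.2 (hl_eq ▸ h.weight_zero N)
        have hlN : (l : ℝ) ≤ δ * N := (Nat.cast_le.2 hl.1.le).trans hKN
        exact Finset.mem_filter.2 ⟨Finset.mem_Icc.2 ⟨Nat.one_le_iff_ne_zero.2 hl_ne,
          Nat.cast_le.1 (hlN.trans hn)⟩, hlN⟩

theorem eventually_long_sum_le (h : HeavyTail α β s c μ) {ε δ : ℝ} (hε : 0 < ε) (hδ : 0 < δ)
    (hεν : 2 * ε < 1 - μ) : ∀ᶠ N : ℕ in atTop, ∀ n : ℕ, (1 - ε) * N < n →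
      ∑ l ∈ (Finset.Icc 1 n).filter (fun l : ℕ => ¬ (l : ℝ) ≤ δ * N),
          cycleWeight α β N l * massFn (cycleWeight α β N) (n - l)
        ≤ N * (N : ℝ) ^ (-s) * ((c + 2 * ε) * (1 - μ - 2 * ε) ^ (-s) + ε) := by
  have hc := h.c_pos
  have hν : 0 < 1 - μ - 2 * ε := by linarith
  obtain ⟨C, hC_pos, hC⟩ := h.exists_weight_le hδ
  filter_upwards [h.eventually_weight_le hε hν, eventually_ge_atTop 1,
    ((h.tendsto_farMass hε).const_mul C).eventually
      (ge_mem_nhds (show C * 0 < ε by rwa [mul_zero]))] with N hnear hN hfar n hn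
  have hterm : ∀ l ∈ (Finset.Icc 1 n).filter (fun l : ℕ => ¬ (l : ℝ) ≤ δ * N),
      cycleWeight α β N l * massFn (cycleWeight α β N) (n - l)
        ≤ N * (N : ℝ) ^ (-s) * ((c + 2 * ε) * (1 - μ - 2 * ε) ^ (-s))
            * massFn (cycleWeight α β N) (n - l)
          + N * (N : ℝ) ^ (-s) * C * farMassFn α β μ ε N (n - l) := by
    intro l hl
    rw [Finset.mem_filter, Finset.mem_Icc, not_le] at hl
    have hmass := h.massFn_nonneg N (n - l)
    rw [farMassFn]
    split_ifs with hfar_l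
    · exact le_add_of_nonneg_of_le (by positivity)
        (mul_le_mul_of_nonneg_right (hC N hN l hl.2.le) hmass)
    · rw [mul_zero, add_zero]
      refine mul_le_mul_of_nonneg_right (hnear l ?_) hmass
      rw [not_lt, Nat.cast_sub hl.1.2] at hfar_l
      linarith [(abs_le.1 hfar_l).2]
  refine (Finset.sum_le_sum hterm).trans ?_
  rw [Finset.sum_add_distrib, ← Finset.mul_sum, ← Finset.mul_sum]
  have hmass := sum_filter_sub_le_tsum (h.massFn_nonneg N) (h.hasSum_massFn N).summable n
    (fun l : ℕ => ¬ (l : ℝ) ≤ δ * N)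
  have hfarMass := sum_filter_sub_le_tsum (h.farMassFn_nonneg ε N) (h.summable_farMassFn ε N) n
    (fun l : ℕ => ¬ (l : ℝ) ≤ δ * N)
  rw [(h.hasSum_massFn N).tsum_eq] at hmass
  refine (add_le_add (mul_le_mul_of_nonneg_left hmass (by positivity))
    (mul_le_mul_of_nonneg_left hfarMass (by positivity))).trans ?_
  rw [mul_one, mul_assoc _ C, ← mul_add, ← farMass]
  exact mul_le_mul_of_nonneg_left (add_le_add_right hfar _) (by positivity)

theorem eventually_le_long_sum (h : HeavyTail α β s c μ) {ε δ : ℝ} (hε : 0 < ε) (hδ : 0 < δ)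
    (hδε : δ ≤ ε) (hεν : 4 * ε < 1 - μ) (hεc : ε < c) :
    ∀ᶠ N : ℕ in atTop, ∀ n : ℕ, n ≤ N → (1 - ε) * N < n →
      N * (N : ℝ) ^ (-s) * ((c - ε) * (1 - μ + ε) ^ (-s) * (1 - ε))
        ≤ ∑ l ∈ (Finset.Icc 1 n).filter (fun l : ℕ => ¬ (l : ℝ) ≤ δ * N),
          cycleWeight α β N l * massFn (cycleWeight α β N) (n - l) := by
  have : 0 < c - ε := sub_pos.2 hεc
  have hν : 0 < 1 - μ + ε := by linarith
  filter_upwards [h.eventually_le_weight hε hεc (show 0 < 1 - μ - 2 * ε by linarith) hν,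
    (h.tendsto_farMass hε).eventually (ge_mem_nhds hε)] with N hnear hfar n hnN hn
  have hlt : (μ + ε + δ) * N < n :=
    lt_of_le_of_lt (mul_le_mul_of_nonneg_right (by linarith) N.cast_nonneg) hn
  calc N * (N : ℝ) ^ (-s) * ((c - ε) * (1 - μ + ε) ^ (-s) * (1 - ε))
      ≤ N * (N : ℝ) ^ (-s) * ((c - ε) * (1 - μ + ε) ^ (-s) * (1 - farMass α β μ ε N)) := by
        gcongr
    _ = ∑ l ∈ (Finset.Icc 1 n).filter (fun l : ℕ => ¬ (l : ℝ) ≤ δ * N),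
          N * (N : ℝ) ^ (-s) * ((c - ε) * (1 - μ + ε) ^ (-s)) *
            (massFn (cycleWeight α β N) (n - l) - farMassFn α β μ ε N (n - l)) := by
        rw [← Finset.mul_sum, ← h.one_sub_farMass_eq_sum hδ.le hlt]
        ring
    _ ≤ _ := Finset.sum_le_sum fun l hl => by
        rw [Finset.mem_filter, Finset.mem_Icc, not_le] at hl
        have hmass := h.massFn_nonneg N (n - l)
        rw [farMassFn]
        split_ifs with hfar_l
        · rw [sub_self, mul_zero]
          exact mul_nonneg (h.weight_nonneg N l) hmass
        · have hnN' : (n : ℝ) ≤ N := Nat.cast_le.2 hnN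
          rw [not_lt, Nat.cast_sub hl.1.2, abs_le] at hfar_l
          rw [sub_zero]
          exact mul_le_mul_of_nonneg_right (hnear l (by linarith) (by linarith)) hmass

theorem exists_tilt (h : HeavyTail α β s c μ) {ε : ℝ} (hε : 0 < ε) :
    ∃ A δ : ℝ, 0 < A ∧ 0 < δ ∧ δ ≤ ε ∧ A * ε = 4 * s ∧ A * δ ≤ (s - 1) / 2 := by
  have hs := h.one_lt
  have hs' : 0 < s - 1 := sub_pos.2 hs
  refine ⟨4 * s / ε, min ε (ε * (s - 1) / (8 * s)), by positivity, by positivity,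
    min_le_left _ _, by field_simp, ?_⟩
  calc 4 * s / ε * min ε (ε * (s - 1) / (8 * s))
      ≤ 4 * s / ε * (ε * (s - 1) / (8 * s)) := by gcongr; exact min_le_right _ _
    _ = (s - 1) / 2 := by field_simp; norm_num

theorem eventually_massFn_le_exp_add (h : HeavyTail α β s c μ) {A ε δ : ℝ} (hA : 0 < A)
    (hε : 0 < ε) (hδ : 0 < δ) (hAδ : A * δ ≤ (s - 1) / 2) (hεν : 4 * ε < 1 - μ) :
    ∀ᶠ N : ℕ in atTop, ∀ n : ℕ, n ≤ N → massFn (cycleWeight α β N) n ≤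
      Real.exp (-(A * Real.log N / N * (n - (1 - ε) * N))) +
        (N : ℝ) ^ (-s) * (((c + 2 * ε) * (1 - μ - 2 * ε) ^ (-s) + ε) / (1 - μ - 2 * ε)) := by
  have hμ := h.mu_pos
  have hc := h.c_pos
  have hν : 0 < 1 - μ - 2 * ε := by linarith
  filter_upwards [h.eventually_sum_weight_mul_exp_le hA.le hε hδ hAδ,
    h.eventually_long_sum_le hε hδ (by linarith), eventually_ge_atTop 1] with N hexp hlong hN m hm
  have hN' : (0 : ℝ) < N := Nat.cast_pos.2 hN
  have : 0 ≤ Real.log N := Real.log_nonneg (Nat.one_le_cast.2 hN)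
  set e := (c + 2 * ε) * (1 - μ - 2 * ε) ^ (-s) + ε
  set D := (N : ℝ) ^ (-s) * (e / (1 - μ - 2 * ε)) with hD
  have hD_nonneg : 0 ≤ D := by positivity
  refine le_exp_add_of_recursion (P := fun l : ℕ => (l : ℝ) ≤ δ * N)
    (E := (1 - μ - 2 * ε) * N * D) (h.weight_nonneg N) (by positivity)
    (mul_nonneg (by linarith) hN'.le) hD_nonneg (fun n _ => h.massFn_le_one N n) ?_ ?_ ?_ hm
  · intro n _ hn
    rw [nat_mul_massFn, ← Finset.sum_filter_add_sum_filter_not _ (fun l : ℕ => (l : ℝ) ≤ δ * N)]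
    refine add_le_add_right ((hlong n hn).trans (le_of_eq ?_)) _
    rw [hD]
    field_simp
  · exact hexp.trans (mul_le_mul_of_nonneg_right (by linarith) hN'.le)
  · have hsum : ∑ l ∈ (Finset.Icc 1 N).filter (fun l : ℕ => (l : ℝ) ≤ δ * N),
        cycleWeight α β N l ≤ (μ + ε) * N :=
      (Finset.sum_le_sum fun l _ => le_mul_of_one_le_right (h.weight_nonneg N l)
        (Real.one_le_exp (by positivity))).trans hexp
    linarith [mul_le_mul_of_nonneg_right hsum hD_nonneg]

theorem eventually_massFn_le (h : HeavyTail α β s c μ) {ε : ℝ} (hε : 0 < ε)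
    (hεν : 4 * ε < 1 - μ) (k : ℕ) :
    ∀ᶠ N : ℕ in atTop, massFn (cycleWeight α β N) (N - k) * (N : ℝ) ^ s
      ≤ ε + ((c + 2 * ε) * (1 - μ - 2 * ε) ^ (-s) + ε) / (1 - μ - 2 * ε) := by
  obtain ⟨A, δ, hA, hδ, -, hAε, hAδ⟩ := h.exists_tilt hε
  have hpow : Tendsto (fun N : ℕ => (N : ℝ) ^ (-s)) atTop (𝓝 0) :=
    (tendsto_rpow_neg_atTop (one_pos.trans h.one_lt)).comp tendsto_natCast_atTop_atTop
  filter_upwards [h.eventually_massFn_le_exp_add hA hε hδ hAδ hεν, eventually_ge_atTop 1,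
    hpow.eventually (ge_mem_nhds hε), eventually_ge_atTop k, eventually_le_mul_nat (2 * k) hε]
    with N hbound hN hNε hkN hk
  have hN' : (0 : ℝ) < N := Nat.cast_pos.2 hN
  set D := ((c + 2 * ε) * (1 - μ - 2 * ε) ^ (-s) + ε) / (1 - μ - 2 * ε)
  calc massFn (cycleWeight α β N) (N - k) * (N : ℝ) ^ s
      ≤ ((N : ℝ) ^ (-(2 * s)) + (N : ℝ) ^ (-s) * D) * (N : ℝ) ^ s := by
        gcongr
        exact (hbound _ (Nat.sub_le N k)).trans
          (add_le_add_left (exp_neg_log_mul_le_rpow hAε.ge hA.le hN hk hkN) _)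
    _ = (N : ℝ) ^ (-s) + D := by
        rw [add_mul, mul_right_comm, ← Real.rpow_add hN', ← Real.rpow_add hN', neg_add_cancel,
          Real.rpow_zero, one_mul]
        ring_nf
    _ ≤ ε + D := add_le_add_left hNε _

theorem eventually_mul_one_sub_exp_le_massFn (h : HeavyTail α β s c μ) {A ε δ : ℝ} (hA : 0 < A)
    (hε : 0 < ε) (hδ : 0 < δ) (hδε : δ ≤ ε) (hAδ : A * δ ≤ (s - 1) / 2) (hεν : 4 * ε < 1 - μ)
    (hεc : ε < c) : ∀ᶠ N : ℕ in atTop, ∀ n : ℕ, n ≤ N →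
      (N : ℝ) ^ (-s) * ((c - ε) * (1 - μ + ε) ^ (-s) * (1 - ε) / (1 - μ + ε)) *
        (1 - Real.exp (-(A * Real.log N / N * (n - (1 - ε) * N))))
      ≤ massFn (cycleWeight α β N) n := by
  have hμ := h.mu_pos
  have hν : 0 < 1 - μ + ε := by linarith
  have hε_lt : 0 < 1 - ε := by linarith
  have : 0 < c - ε := sub_pos.2 hεc
  filter_upwards [h.eventually_sum_weight_mul_exp_le hA.le hε hδ hAδ,
    h.eventually_le_long_sum hε hδ hδε hεν hεc, h.eventually_le_sum_weight hε hδ,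
    eventually_ge_atTop 1] with N hexp hlong hshort hN m hm
  have hN' : (0 : ℝ) < N := Nat.cast_pos.2 hN
  have : 0 ≤ Real.log N := Real.log_nonneg (Nat.one_le_cast.2 hN)
  set e := (c - ε) * (1 - μ + ε) ^ (-s) * (1 - ε)
  set D := (N : ℝ) ^ (-s) * (e / (1 - μ + ε)) with hD
  have hD_nonneg : 0 ≤ D := by positivity
  refine ge_of_recursion (P := fun l : ℕ => (l : ℝ) ≤ δ * N)
    (E := (1 - μ + ε) * N * D) (h.weight_nonneg N) (by positivity)
    (mul_nonneg hε_lt.le hN'.le) hD_nonneg (h.massFn_nonneg N) ?_ ?_ ?_ hm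
  · intro n hnN hn
    rw [nat_mul_massFn, ← Finset.sum_filter_add_sum_filter_not (Finset.Icc 1 n)
      (fun l : ℕ => (l : ℝ) ≤ δ * N)
      (fun l => cycleWeight α β N l * massFn (cycleWeight α β N) (n - l))]
    refine add_le_add_right (le_trans (le_of_eq ?_) (hlong n hnN hn)) _
    rw [hD]
    field_simp
  · exact hexp.trans (mul_le_mul_of_nonneg_right (by linarith) hN'.le)
  · intro n hnN hn
    have hδn : δ * N ≤ n := (mul_le_mul_of_nonneg_right (by linarith) hN'.le).trans hn.le
    have hnD : (n : ℝ) * D ≤ N * D := by gcongr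
    linarith [mul_le_mul_of_nonneg_right (hshort n hδn) hD_nonneg]

theorem eventually_le_massFn (h : HeavyTail α β s c μ) {ε : ℝ} (hε : 0 < ε)
    (hεν : 4 * ε < 1 - μ) (hεc : ε < c) (k : ℕ) :
    ∀ᶠ N : ℕ in atTop, (c - ε) * (1 - μ + ε) ^ (-s) * (1 - ε) / (1 - μ + ε) * (1 - ε)
      ≤ massFn (cycleWeight α β N) (N - k) * (N : ℝ) ^ s := by
  have hμ := h.mu_pos
  have : 0 < 1 - μ + ε := by linarith
  have : 0 < 1 - ε := by linarith
  have : 0 < c - ε := sub_pos.2 hεc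
  obtain ⟨A, δ, hA, hδ, hδε, hAε, hAδ⟩ := h.exists_tilt hε
  have hpow : Tendsto (fun N : ℕ => (N : ℝ) ^ (-(2 * s))) atTop (𝓝 0) :=
    (tendsto_rpow_neg_atTop (by linarith [h.one_lt])).comp tendsto_natCast_atTop_atTop
  filter_upwards [h.eventually_mul_one_sub_exp_le_massFn hA hε hδ hδε hAδ hεν hεc,
    eventually_ge_atTop 1, hpow.eventually (ge_mem_nhds hε), eventually_ge_atTop k,
    eventually_le_mul_nat (2 * k) hε] with N hbound hN hNε hkN hk
  set D := (c - ε) * (1 - μ + ε) ^ (-s) * (1 - ε) / (1 - μ + ε)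
  calc D * (1 - ε) = (N : ℝ) ^ (-s) * D * (1 - ε) * (N : ℝ) ^ s := by
        rw [mul_assoc ((N : ℝ) ^ (-s)), mul_right_comm, ← Real.rpow_add (Nat.cast_pos.2 hN),
          neg_add_cancel, Real.rpow_zero, one_mul]
    _ ≤ massFn (cycleWeight α β N) (N - k) * (N : ℝ) ^ s := by
        gcongr
        refine le_trans ?_ (hbound _ (Nat.sub_le N k))
        gcongr
        exact (exp_neg_log_mul_le_rpow hAε.ge hA.le hN hk hkN).trans hNε

/-- The local limit theorem at the right edge: in the heavy-tailed situation, the mass at `N - k`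
far from the mean `μ N` is produced by a single large jump. -/
theorem tendsto_massFn_mul_rpow (h : HeavyTail α β s c μ) (k : ℕ) :
    Tendsto (fun N : ℕ => massFn (cycleWeight α β N) (N - k) * (N : ℝ) ^ s) atTop
      (𝓝 (c * (1 - μ) ^ (-s) / (1 - μ))) := by
  have hν : 0 < 1 - μ := sub_pos.2 h.mu_lt
  have hid : Tendsto (fun ε : ℝ => ε) (𝓝[>] 0) (𝓝 0) :=
    tendsto_nhdsWithin_of_tendsto_nhds tendsto_id
  have hsmall : ∀ᶠ ε : ℝ in 𝓝[>] 0, 0 < ε ∧ 4 * ε < 1 - μ ∧ ε < c := by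
    filter_upwards [self_mem_nhdsWithin, hid.eventually (gt_mem_nhds (div_pos hν four_pos)),
      hid.eventually (gt_mem_nhds h.c_pos)] with ε hε hεν hεc
    exact ⟨hε, by linarith, hεc⟩
  refine tendsto_order.2 ⟨fun b hb => ?_, fun b hb => ?_⟩
  · have hlim : Tendsto
        (fun ε : ℝ => (c - ε) * (1 - μ + ε) ^ (-s) * (1 - ε) / (1 - μ + ε) * (1 - ε)) (𝓝[>] 0)
        (𝓝 (c * (1 - μ) ^ (-s) / (1 - μ))) := by
      have hne : 1 - μ + 0 ≠ 0 := by linarith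
      have hadd := hid.const_add (1 - μ)
      simpa using ((((hid.const_sub c).mul (hadd.rpow_const (Or.inl hne))).mul
        (hid.const_sub 1)).div hadd hne).mul (hid.const_sub 1)
    obtain ⟨ε, hbε, hε, hεν, hεc⟩ := ((hlim.eventually (lt_mem_nhds hb)).and hsmall).exists
    filter_upwards [h.eventually_le_massFn hε hεν hεc k] with N hN
    exact hbε.trans_le hN
  · have hlim : Tendsto
        (fun ε : ℝ => ε + ((c + 2 * ε) * (1 - μ - 2 * ε) ^ (-s) + ε) / (1 - μ - 2 * ε)) (𝓝[>] 0)
        (𝓝 (c * (1 - μ) ^ (-s) / (1 - μ))) := by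
      have hne : 1 - μ - 2 * 0 ≠ 0 := by linarith
      have hsub := (hid.const_mul 2).const_sub (1 - μ)
      simpa using hid.add (((((hid.const_mul 2).const_add c).mul
        (hsub.rpow_const (Or.inl hne))).add hid).div hsub hne)
    obtain ⟨ε, hbε, hε, hεν, -⟩ := ((hlim.eventually (gt_mem_nhds hb)).and hsmall).exists
    filter_upwards [h.eventually_massFn_le hε hεν k] with N hN
    exact hN.trans_lt hbε

end HeavyTail

/-! ### Lower bounds for the joint distribution of the cycle lengths -/

theorem cycleStep_nonneg {x f : ℕ → ℝ} (hx : ∀ l, 0 ≤ x l) (hf : ∀ n, 0 ≤ f n) (A : Set ℕ)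
    (n : ℕ) : 0 ≤ cycleStep x A f n :=
  div_nonneg (Finset.sum_nonneg fun _ _ => mul_nonneg (hx _) (hf _)) n.cast_nonneg

theorem sum_div_le_cycleStep {x f : ℕ → ℝ} (hx : ∀ l, 0 ≤ x l) (hf : ∀ n, 0 ≤ f n) {A : Set ℕ}
    {n : ℕ} {T : Finset ℕ} (hT : ∀ l ∈ T, (1 ≤ l ∧ l ≤ n) ∧ l ∈ A) :
    (∑ l ∈ T, x l * f (n - l)) / n ≤ cycleStep x A f n := by
  classical
  rw [cycleStep]
  refine div_le_div_of_nonneg_right (Finset.sum_le_sum_of_subset_of_nonneg (fun l hl => ?_)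
    fun _ _ _ => mul_nonneg (hx _) (hf _)) n.cast_nonneg
  rw [Finset.mem_filter, Finset.mem_Icc]
  exact hT l hl

/-- The lexicographic coefficients in units of the total mass of the `expCoeff x`, so that the
empty list of constraints gives the probability mass function `massFn x`. -/
noncomputable def lexMass (x : ℕ → ℝ) (As : List (Set ℕ)) (n : ℕ) : ℝ :=
  lexCoeff x As n / ∑' k, expCoeff x k

theorem lexMass_cons (x : ℕ → ℝ) (A : Set ℕ) (As : List (Set ℕ)) :
    lexMass x (A :: As) = cycleStep x A (lexMass x As) := by
  ext n
  simp only [lexMass, lexCoeff, cycleStep, ← mul_div_assoc]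
  rw [← Finset.sum_div, div_right_comm]

theorem lexMass_nonneg {x : ℕ → ℝ} (hx : ∀ l, 0 ≤ x l) (As : List (Set ℕ)) (n : ℕ) :
    0 ≤ lexMass x As n := by
  induction As generalizing n with
  | nil => exact massFn_nonneg hx n
  | cons A As ih => exact lexMass_cons x A As ▸ cycleStep_nonneg hx ih A n

/-- The natural numbers below `N` in the `ε N`-neighbourhood of `μ N`. -/
noncomputable def bulk (μ ε : ℝ) (N : ℕ) : Finset ℕ :=
  (Finset.range N).filter fun n : ℕ => |(n : ℝ) - μ * N| ≤ ε * N

/-- `BulkGe μ F p` says that asymptotically `F N` puts at least the mass `p` close to `μ N`. -/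
def BulkGe (μ : ℝ) (F : ℕ → ℕ → ℝ) (p : ℝ) : Prop :=
  ∀ ε > 0, ∀ d < p, ∀ᶠ N : ℕ in atTop, d ≤ ∑ n ∈ bulk μ ε N, F N n

/-- `LocalGe s F d` says that asymptotically `F N` is at least `d N⁻ˢ` at every fixed distance to
the left of `N`. -/
def LocalGe (s : ℝ) (F : ℕ → ℕ → ℝ) (d : ℝ) : Prop :=
  ∀ k : ℕ, ∀ d' < d, ∀ᶠ N : ℕ in atTop, d' ≤ F N (N - k) * (N : ℝ) ^ s

/-- The possible lengths of a macroscopic cycle, those in the `ε N`-neighbourhood of `(1 - μ) N`.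
The length `0`, which stands for a missing cycle, is excluded. -/
def longWindow (μ ε : ℝ) (N : ℕ) : Set ℕ := {l | |(l : ℝ) - (1 - μ) * N| ≤ ε * N ∧ 1 ≤ l}

theorem mem_bulk {μ ε : ℝ} {N n : ℕ} :
    n ∈ bulk μ ε N ↔ n < N ∧ -(ε * N) ≤ n - μ * N ∧ n - μ * N ≤ ε * N := by
  rw [bulk, Finset.mem_filter, Finset.mem_range, abs_le]

theorem bulk_mono {μ ε ε' : ℝ} (hε : ε ≤ ε') (N : ℕ) : bulk μ ε N ⊆ bulk μ ε' N :=
  Finset.monotone_filter_right _ fun _ _ hn =>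
    hn.trans (mul_le_mul_of_nonneg_right hε N.cast_nonneg)

theorem add_mem_bulk {μ ε : ℝ} {N m l : ℕ} (hN : 0 < N) (hε : ε < 1 - μ)
    (hl : (l : ℝ) ≤ ε / 2 * N) (hm : m ∈ bulk μ (ε / 2) N) : m + l ∈ bulk μ ε N := by
  rw [mem_bulk] at hm ⊢
  have hlt : ε * N < (1 - μ) * N := mul_lt_mul_of_pos_right hε (Nat.cast_pos.2 hN)
  have : (0 : ℝ) ≤ l := l.cast_nonneg
  refine ⟨(Nat.cast_lt (α := ℝ)).1 ?_, ?_, ?_⟩ <;> push_cast <;> linarith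

theorem sub_mem_longWindow {μ ε : ℝ} {N m k : ℕ} (hN : 0 < N) (hε : ε < 1 - μ)
    (hk : (k : ℝ) ≤ ε / 2 * N) (hm : m ∈ bulk μ (ε / 2) N) :
    m < N - k ∧ N - k - m ∈ longWindow μ ε N := by
  have hmk := mem_bulk.1 (add_mem_bulk hN hε hk hm)
  have hlt : m < N - k := Nat.lt_sub_of_add_lt hmk.1
  have hk_nonneg : (0 : ℝ) ≤ k := k.cast_nonneg
  refine ⟨hlt, ?_, Nat.sub_pos_of_lt hlt⟩
  rw [Nat.sub_sub, Nat.cast_sub (by omega), abs_le]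
  push_cast at hmk ⊢
  rw [mem_bulk] at hm
  constructor <;> linarith

theorem longWindow_mono {μ ε ε' : ℝ} (hε : ε ≤ ε') (N : ℕ) :
    longWindow μ ε N ⊆ longWindow μ ε' N := fun _ hl =>
  ⟨hl.1.trans (mul_le_mul_of_nonneg_right hε N.cast_nonneg), hl.2⟩

theorem sum_bulk_le_sum_bulk_sub {μ ε : ℝ} {N l : ℕ} (hN : 0 < N) (hε : ε < 1 - μ)
    (hl : (l : ℝ) ≤ ε / 2 * N) {f : ℕ → ℝ} (hf : ∀ n, 0 ≤ f n) :
    ∑ m ∈ bulk μ (ε / 2) N, f m ≤ ∑ n ∈ bulk μ ε N, f (n - l) := by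
  have himage : ∑ m ∈ bulk μ (ε / 2) N, f m
      = ∑ n ∈ (bulk μ (ε / 2) N).map (addRightEmbedding l), f (n - l) := by
    rw [Finset.sum_map]
    exact Finset.sum_congr rfl fun m _ => by rw [addRightEmbedding_apply, Nat.add_sub_cancel]
  rw [himage]
  refine Finset.sum_le_sum_of_subset_of_nonneg (fun n hn => ?_) fun _ _ _ => hf _
  obtain ⟨m, hm, rfl⟩ := Finset.mem_map.1 hn
  exact add_mem_bulk hN hε hl hm

theorem exists_lt_of_tendsto_const_mul {g : ℝ → ℝ} {q p d : ℝ} (hg : Tendsto g (𝓝[>] 0) (𝓝 q))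
    (hd : d < q * p) {e : ℝ} (he : 0 < e) :
    ∃ ε, 0 < ε ∧ ε < e ∧ ∃ p' < p, d < g ε * p' := by
  obtain ⟨ε, hdε, hε⟩ :=
    (((hg.mul_const p).eventually (lt_mem_nhds hd)).and (Ioo_mem_nhdsGT he)).exists
  have hlim : Tendsto (fun p' => g ε * p') (𝓝[<] p) (𝓝 (g ε * p)) :=
    tendsto_nhdsWithin_of_tendsto_nhds (tendsto_id.const_mul _)
  obtain ⟨p', hdp', hp'⟩ := ((hlim.eventually (lt_mem_nhds hdε)).and self_mem_nhdsWithin).exists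
  exact ⟨ε, hε.1, hε.2, p', hp', hdp'⟩

theorem sum_bulk_div_le_cycleStep_longWindow {x f : ℕ → ℝ} (hx : ∀ l, 0 ≤ x l)
    (hf : ∀ n, 0 ≤ f n) {μ ε : ℝ} {N k : ℕ} (hkN : k < N) (hε : ε < 1 - μ)
    (hk : (k : ℝ) ≤ ε / 2 * N) :
    (∑ m ∈ bulk μ (ε / 2) N, x (N - k - m) * f m) / (N - k : ℕ)
      ≤ cycleStep x (longWindow μ ε N) f (N - k) := by
  have hmem := fun m (hm : m ∈ bulk μ (ε / 2) N) =>
    sub_mem_longWindow (k.zero_le.trans_lt hkN) hε hk hm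
  have hinj : Set.InjOn (N - k - ·) (bulk μ (ε / 2) N) := fun m hm m' hm' hmm' => by
    have hm_lt := (hmem m hm).1
    have hm'_lt := (hmem m' hm').1
    simp only at hmm'
    omega
  have himage : ∑ m ∈ bulk μ (ε / 2) N, x (N - k - m) * f m
      = ∑ l ∈ (bulk μ (ε / 2) N).image (N - k - ·), x l * f (N - k - l) := by
    rw [Finset.sum_image hinj]
    exact Finset.sum_congr rfl fun m hm => by rw [Nat.sub_sub_self (hmem m hm).1.le]
  rw [himage]
  refine sum_div_le_cycleStep hx hf fun l hl => ?_
  obtain ⟨m, hm, rfl⟩ := Finset.mem_image.1 hl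
  exact ⟨⟨(hmem m hm).2.2, Nat.sub_le _ _⟩, (hmem m hm).2⟩

theorem SummableWeights.sum_bulk_massFn {α β : ℕ → ℝ} {μ : ℝ} (h : SummableWeights α β μ) {ε : ℝ}
    (hε : ε < 1 - μ) {N : ℕ} (hN : 0 < N) :
    ∑ n ∈ bulk μ ε N, massFn (cycleWeight α β N) n = 1 - farMass α β μ ε N := by
  have hsum := ((h.hasSum_massFn N).sub (h.summable_farMassFn ε N).hasSum).tsum_eq
  rw [farMass, ← hsum, tsum_eq_sum (s := bulk μ ε N)]
  · refine Finset.sum_congr rfl fun n hn => ?_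
    rw [farMassFn, if_neg (not_lt.2 (abs_le.2 (mem_bulk.1 hn).2)), sub_zero]
  · intro n hn
    rw [farMassFn, if_pos, sub_self]
    contrapose! hn
    have hlt : ε * N < (1 - μ) * N := mul_lt_mul_of_pos_right hε (Nat.cast_pos.2 hN)
    have hnN : (n : ℝ) < N := by linarith [(abs_le.1 hn).2]
    exact mem_bulk.2 ⟨Nat.cast_lt.1 hnN, abs_le.1 hn⟩

theorem SummableWeights.nat_mul_le_cycleWeight {α β : ℕ → ℝ} {μ : ℝ} (h : SummableWeights α β μ)
    (N l : ℕ) : N * β l ≤ cycleWeight α β N l :=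
  le_add_of_nonneg_left (h.alpha_nonneg l)

namespace HeavyTail

variable {α β : ℕ → ℝ} {s c μ : ℝ}

theorem bulkGe_massFn (h : HeavyTail α β s c μ) :
    BulkGe μ (fun N => massFn (cycleWeight α β N)) 1 := by
  intro ε hε d hd
  obtain ⟨e, he, he_lt⟩ := exists_between (lt_min hε (sub_pos.2 h.mu_lt))
  filter_upwards [(h.tendsto_farMass he).eventually (ge_mem_nhds (sub_pos.2 hd)),
    eventually_gt_atTop 0] with N hfar hN
  calc d ≤ 1 - farMass α β μ e N := le_sub_comm.1 hfar
    _ = ∑ n ∈ bulk μ e N, massFn (cycleWeight α β N) n :=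
        (h.sum_bulk_massFn (he_lt.trans_le (min_le_right _ _)) hN).symm
    _ ≤ ∑ n ∈ bulk μ ε N, massFn (cycleWeight α β N) n :=
        Finset.sum_le_sum_of_subset_of_nonneg
          (bulk_mono (he_lt.le.trans (min_le_left _ _)) N) fun n _ _ => h.massFn_nonneg N n

theorem eventually_le_cycleStep_Icc (h : HeavyTail α β s c μ) {e : ℝ} (he : 0 < e) (heμ : e < μ)
    (K : ℕ) : ∀ᶠ N : ℕ in atTop, ∀ f : ℕ → ℝ, (∀ n, 0 ≤ f n) → ∀ n ∈ bulk μ e N,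
      (μ + e)⁻¹ * ∑ l ∈ Finset.Icc 1 K, β l * f (n - l)
        ≤ cycleStep (cycleWeight α β N) (Set.Icc 1 K) f n := by
  filter_upwards [eventually_le_mul_nat (K + 1) (sub_pos.2 heμ)] with N hK f hf n hn
  rw [mem_bulk] at hn
  have : (K : ℝ) + 1 ≤ n := by linarith
  have hn_pos : (0 : ℝ) < n := by linarith [(K.cast_nonneg : (0 : ℝ) ≤ K)]
  have hnN : (μ + e)⁻¹ * n ≤ N := by
    rw [inv_mul_le_iff₀ (by linarith)]
    linarith
  refine le_trans ?_ (sum_div_le_cycleStep (T := Finset.Icc 1 K) (h.weight_nonneg N) hf ?_)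
  · rw [le_div_iff₀ hn_pos, Finset.mul_sum, Finset.sum_mul]
    refine Finset.sum_le_sum fun l _ => ?_
    calc (μ + e)⁻¹ * (β l * f (n - l)) * n = (μ + e)⁻¹ * n * β l * f (n - l) := by ring
      _ ≤ cycleWeight α β N l * f (n - l) := mul_le_mul_of_nonneg_right
          ((mul_le_mul_of_nonneg_right hnN (h.beta_nonneg l)).trans
            (h.nat_mul_le_cycleWeight N l)) (hf _)
  · intro l hl
    rw [Finset.mem_Icc] at hl
    have hlK : (l : ℝ) ≤ K := Nat.cast_le.2 hl.2
    exact ⟨⟨hl.1, (Nat.cast_le (α := ℝ)).1 (by linarith)⟩, hl⟩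

theorem eventually_le_sum_bulk_cycleStep (h : HeavyTail α β s c μ) {e : ℝ} (he : 0 < e)
    (heμ : e < μ) (heν : e < 1 - μ) (K : ℕ) :
    ∀ᶠ N : ℕ in atTop, ∀ f : ℕ → ℝ, (∀ n, 0 ≤ f n) →
      (∑ l ∈ Finset.Icc 1 K, β l) / (μ + e) * ∑ m ∈ bulk μ (e / 2) N, f m
        ≤ ∑ n ∈ bulk μ e N, cycleStep (cycleWeight α β N) (Set.Icc 1 K) f n := by
  have hμ := h.mu_pos
  filter_upwards [h.eventually_le_cycleStep_Icc he heμ K, eventually_le_mul_nat K (half_pos he),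
    eventually_gt_atTop 0] with N hstep hK hN f hf
  have hshift : ∀ l ∈ Finset.Icc 1 K, β l * ∑ m ∈ bulk μ (e / 2) N, f m
      ≤ ∑ n ∈ bulk μ e N, β l * f (n - l) := fun l hl => by
    rw [← Finset.mul_sum]
    exact mul_le_mul_of_nonneg_left (sum_bulk_le_sum_bulk_sub hN heν
      ((Nat.cast_le.2 (Finset.mem_Icc.1 hl).2).trans hK) hf) (h.beta_nonneg l)
  calc (∑ l ∈ Finset.Icc 1 K, β l) / (μ + e) * ∑ m ∈ bulk μ (e / 2) N, f m
      = (μ + e)⁻¹ * ∑ l ∈ Finset.Icc 1 K, β l * ∑ m ∈ bulk μ (e / 2) N, f m := by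
        rw [← Finset.sum_mul]
        ring
    _ ≤ (μ + e)⁻¹ * ∑ l ∈ Finset.Icc 1 K, ∑ n ∈ bulk μ e N, β l * f (n - l) :=
        mul_le_mul_of_nonneg_left (Finset.sum_le_sum hshift) (by positivity)
    _ = ∑ n ∈ bulk μ e N, (μ + e)⁻¹ * ∑ l ∈ Finset.Icc 1 K, β l * f (n - l) := by
        rw [Finset.sum_comm, Finset.mul_sum]
    _ ≤ _ := Finset.sum_le_sum (hstep f hf)

theorem bulkGe_cycleStep (h : HeavyTail α β s c μ) {F : ℕ → ℕ → ℝ} (hF : ∀ N n, 0 ≤ F N n) {p : ℝ}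
    (hp : BulkGe μ F p) (K : ℕ) :
    BulkGe μ (fun N => cycleStep (cycleWeight α β N) (Set.Icc 1 K) (F N))
      ((∑ l ∈ Finset.Icc 1 K, β l) / μ * p) := by
  intro ε hε d hd
  have hμ := h.mu_pos
  have hlim : Tendsto (fun e : ℝ => (∑ l ∈ Finset.Icc 1 K, β l) / (μ + e)) (𝓝[>] 0)
      (𝓝 ((∑ l ∈ Finset.Icc 1 K, β l) / μ)) := by
    have hadd : Tendsto (fun e : ℝ => μ + e) (𝓝[>] 0) (𝓝 (μ + 0)) :=
      tendsto_nhdsWithin_of_tendsto_nhds (tendsto_id.const_add μ)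
    rw [add_zero] at hadd
    exact tendsto_const_nhds.div hadd hμ.ne'
  obtain ⟨e, he, he_lt, p', hp', hdp⟩ := exists_lt_of_tendsto_const_mul hlim hd
    (lt_min hε (lt_min hμ (sub_pos.2 h.mu_lt)))
  obtain ⟨heε, heμ, heν⟩ : e < ε ∧ e < μ ∧ e < 1 - μ := by simpa only [lt_min_iff] using he_lt
  filter_upwards [hp (e / 2) (half_pos he) p' hp',
    h.eventually_le_sum_bulk_cycleStep he heμ heν K] with N hN hstep
  have hβ : 0 ≤ ∑ l ∈ Finset.Icc 1 K, β l := Finset.sum_nonneg fun l _ => h.beta_nonneg l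
  calc d ≤ (∑ l ∈ Finset.Icc 1 K, β l) / (μ + e) * p' := hdp.le
    _ ≤ (∑ l ∈ Finset.Icc 1 K, β l) / (μ + e) * ∑ m ∈ bulk μ (e / 2) N, F N m :=
        mul_le_mul_of_nonneg_left hN (div_nonneg hβ (by linarith))
    _ ≤ ∑ n ∈ bulk μ e N, cycleStep (cycleWeight α β N) (Set.Icc 1 K) (F N) n := hstep _ (hF N)
    _ ≤ _ := Finset.sum_le_sum_of_subset_of_nonneg (bulk_mono heε.le N) fun n _ _ =>
        cycleStep_nonneg (h.weight_nonneg N) (hF N) _ n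

theorem localGe_massFn (h : HeavyTail α β s c μ) :
    LocalGe s (fun N => massFn (cycleWeight α β N)) (c * (1 - μ) ^ (-s) / (1 - μ)) := fun k _ hd =>
  (h.tendsto_massFn_mul_rpow k).eventually (le_mem_nhds hd)

theorem localGe_cycleStep_Icc (h : HeavyTail α β s c μ) {F : ℕ → ℕ → ℝ} (hF : ∀ N n, 0 ≤ F N n)
    {d : ℝ} (hd : LocalGe s F d) (K : ℕ) :
    LocalGe s (fun N => cycleStep (cycleWeight α β N) (Set.Icc 1 K) (F N))
      ((∑ l ∈ Finset.Icc 1 K, β l) * d) := by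
  intro k d₁ hd₁
  obtain ⟨-, -, -, d', hd', hlt⟩ := exists_lt_of_tendsto_const_mul
    (g := fun _ => ∑ l ∈ Finset.Icc 1 K, β l) tendsto_const_nhds hd₁ one_pos
  have hall : ∀ᶠ N : ℕ in atTop, ∀ l ∈ Finset.Icc 1 K, d' ≤ F N (N - (k + l)) * (N : ℝ) ^ s := by
    rw [eventually_all_finset]
    exact fun l _ => hd (k + l) d' hd'
  filter_upwards [hall, eventually_gt_atTop (k + K)] with N hN hNk
  have hn_pos : (0 : ℝ) < ((N - k : ℕ) : ℝ) := Nat.cast_pos.2 (by omega)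
  have hnN : ((N - k : ℕ) : ℝ) ≤ N := Nat.cast_le.2 (Nat.sub_le N k)
  have hpow : 0 ≤ (N : ℝ) ^ s := by positivity
  refine hlt.le.trans (le_trans ?_ (mul_le_mul_of_nonneg_right
    (sum_div_le_cycleStep (T := Finset.Icc 1 K) (h.weight_nonneg N) (hF N) fun l hl => ?_) hpow))
  · rw [div_mul_eq_mul_div, le_div_iff₀ hn_pos, Finset.sum_mul, Finset.sum_mul, Finset.sum_mul]
    refine Finset.sum_le_sum fun l hl => ?_
    have hβ := h.beta_nonneg l
    have hF_nonneg := hF N (N - k - l)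
    calc β l * d' * ((N - k : ℕ) : ℝ)
        ≤ β l * (F N (N - k - l) * (N : ℝ) ^ s) * ((N - k : ℕ) : ℝ) := by
          gcongr
          exact Nat.sub_sub N k l ▸ hN l hl
      _ ≤ β l * (F N (N - k - l) * (N : ℝ) ^ s) * N := by gcongr
      _ = N * β l * F N (N - k - l) * (N : ℝ) ^ s := by ring
      _ ≤ cycleWeight α β N l * F N (N - k - l) * (N : ℝ) ^ s := by
          gcongr
          exact h.nat_mul_le_cycleWeight N l
  · rw [Finset.mem_Icc] at hl
    exact ⟨⟨hl.1, by omega⟩, hl⟩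

theorem eventually_le_cycleStep_longWindow (h : HeavyTail α β s c μ) {e : ℝ} (he : 0 < e)
    (hec : e < c) (heν : e < 1 - μ) (k : ℕ) :
    ∀ᶠ N : ℕ in atTop, ∀ f : ℕ → ℝ, (∀ n, 0 ≤ f n) →
      (c - e) * (1 - μ + e) ^ (-s) * ∑ m ∈ bulk μ (e / 2) N, f m
        ≤ cycleStep (cycleWeight α β N) (longWindow μ e N) f (N - k) * (N : ℝ) ^ s := by
  have hν : 0 < 1 - μ + e := by linarith
  have : 0 < c - e := sub_pos.2 hec
  filter_upwards [h.eventually_le_weight he hec (sub_pos.2 heν) hν,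
    eventually_le_mul_nat k (half_pos he), eventually_gt_atTop k] with N hweight hk hkN f hf
  have hN' : (0 : ℝ) < N := Nat.cast_pos.2 (by omega)
  have hn_pos : (0 : ℝ) < ((N - k : ℕ) : ℝ) := Nat.cast_pos.2 (by omega)
  have hnN : ((N - k : ℕ) : ℝ) ≤ N := Nat.cast_le.2 (Nat.sub_le N k)
  have hsum : 0 ≤ ∑ m ∈ bulk μ (e / 2) N, f m := Finset.sum_nonneg fun m _ => hf m
  have hterm : ∀ m ∈ bulk μ (e / 2) N, N * (N : ℝ) ^ (-s) * ((c - e) * (1 - μ + e) ^ (-s)) * f m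
      ≤ cycleWeight α β N (N - k - m) * f m := fun m hm => by
    have habs := abs_le.1 (sub_mem_longWindow (by omega) heν hk hm).2.1
    exact mul_le_mul_of_nonneg_right (hweight _ (by linarith) (by linarith)) (hf m)
  calc (c - e) * (1 - μ + e) ^ (-s) * ∑ m ∈ bulk μ (e / 2) N, f m
      = N * (N : ℝ) ^ (-s) * ((c - e) * (1 - μ + e) ^ (-s)) * (∑ m ∈ bulk μ (e / 2) N, f m)
          / N * (N : ℝ) ^ s := by
        rw [Real.rpow_neg hN'.le]
        field_simp
    _ ≤ N * (N : ℝ) ^ (-s) * ((c - e) * (1 - μ + e) ^ (-s)) * (∑ m ∈ bulk μ (e / 2) N, f m)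
          / (N - k : ℕ) * (N : ℝ) ^ s := by gcongr
    _ ≤ (∑ m ∈ bulk μ (e / 2) N, cycleWeight α β N (N - k - m) * f m)
          / (N - k : ℕ) * (N : ℝ) ^ s := by
        rw [Finset.mul_sum]
        exact mul_le_mul_of_nonneg_right
          (div_le_div_of_nonneg_right (Finset.sum_le_sum hterm) hn_pos.le) (by positivity)
    _ ≤ _ := mul_le_mul_of_nonneg_right (sum_bulk_div_le_cycleStep_longWindow
        (h.weight_nonneg N) hf hkN heν hk) (by positivity)

theorem localGe_cycleStep_longWindow (h : HeavyTail α β s c μ) {F : ℕ → ℕ → ℝ}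
    (hF : ∀ N n, 0 ≤ F N n) {p : ℝ} (hp : BulkGe μ F p) {ε : ℝ} (hε : 0 < ε) :
    LocalGe s (fun N => cycleStep (cycleWeight α β N) (longWindow μ ε N) (F N))
      (c * (1 - μ) ^ (-s) * p) := by
  intro k d hd
  have hν : 0 < 1 - μ := sub_pos.2 h.mu_lt
  have hlim : Tendsto (fun e : ℝ => (c - e) * (1 - μ + e) ^ (-s)) (𝓝[>] 0)
      (𝓝 (c * (1 - μ) ^ (-s))) := by
    have hid : Tendsto (fun e : ℝ => e) (𝓝[>] 0) (𝓝 0) :=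
      tendsto_nhdsWithin_of_tendsto_nhds tendsto_id
    have hadd := hid.const_add (1 - μ)
    rw [add_zero] at hadd
    simpa using (hid.const_sub c).mul (hadd.rpow_const (Or.inl hν.ne'))
  obtain ⟨e, he, he_lt, p', hp', hdp⟩ := exists_lt_of_tendsto_const_mul hlim hd
    (lt_min hε (lt_min h.c_pos hν))
  obtain ⟨heε, hec, heν⟩ : e < ε ∧ e < c ∧ e < 1 - μ := by simpa only [lt_min_iff] using he_lt
  have : 0 < c - e := sub_pos.2 hec
  have : 0 < 1 - μ + e := by linarith
  filter_upwards [hp (e / 2) (half_pos he) p' hp',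
    h.eventually_le_cycleStep_longWindow he hec heν k] with N hN hstep
  calc d ≤ (c - e) * (1 - μ + e) ^ (-s) * p' := hdp.le
    _ ≤ (c - e) * (1 - μ + e) ^ (-s) * ∑ m ∈ bulk μ (e / 2) N, F N m := by gcongr
    _ ≤ cycleStep (cycleWeight α β N) (longWindow μ e N) (F N) (N - k) * (N : ℝ) ^ s :=
        hstep _ (hF N)
    _ ≤ cycleStep (cycleWeight α β N) (longWindow μ ε N) (F N) (N - k) * (N : ℝ) ^ s := by
        classical
        refine mul_le_mul_of_nonneg_right ?_ (by positivity)
        refine sum_div_le_cycleStep (h.weight_nonneg N) (hF N) fun l hl => ?_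
        rw [Finset.mem_filter, Finset.mem_Icc] at hl
        exact ⟨hl.1, longWindow_mono heε.le N hl.2⟩

theorem bulkGe_lexMass_replicate (h : HeavyTail α β s c μ) (K j : ℕ) :
    BulkGe μ (fun N => lexMass (cycleWeight α β N) (List.replicate j (Set.Icc 1 K)))
      (((∑ l ∈ Finset.Icc 1 K, β l) / μ) ^ j) := by
  induction j with
  | zero => exact h.bulkGe_massFn
  | succ j ih =>
    simp only [pow_succ', List.replicate_succ, lexMass_cons]
    exact h.bulkGe_cycleStep (fun N => lexMass_nonneg (h.weight_nonneg N) _) ih K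

theorem localGe_lexMass_replicate_append (h : HeavyTail α β s c μ) (K : ℕ)
    {As : ℕ → List (Set ℕ)} {d : ℝ} (hd : LocalGe s (fun N => lexMass (cycleWeight α β N) (As N)) d)
    (i : ℕ) :
    LocalGe s (fun N => lexMass (cycleWeight α β N) (List.replicate i (Set.Icc 1 K) ++ As N))
      ((∑ l ∈ Finset.Icc 1 K, β l) ^ i * d) := by
  induction i with
  | zero => simpa using hd
  | succ i ih =>
    simp only [pow_succ', mul_assoc, List.replicate_succ, List.cons_append, lexMass_cons]
    exact h.localGe_cycleStep_Icc (fun N => lexMass_nonneg (h.weight_nonneg N) _) ih K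

theorem eventually_massFn_pos (h : HeavyTail α β s c μ) :
    ∀ᶠ N : ℕ in atTop, 0 < massFn (cycleWeight α β N) N := by
  have hν : 0 < 1 - μ := sub_pos.2 h.mu_lt
  have hc := h.c_pos
  have hlimit : 0 < c * (1 - μ) ^ (-s) / (1 - μ) := by positivity
  filter_upwards [(h.tendsto_massFn_mul_rpow 0).eventually (lt_mem_nhds hlimit)] with N hN
  exact pos_of_mul_pos_left hN (by positivity)

theorem eventually_le_div_massFn (h : HeavyTail α β s c μ) {F : ℕ → ℕ → ℝ} {d : ℝ}
    (hF : LocalGe s F (c * (1 - μ) ^ (-s) / (1 - μ) * d)) {d' : ℝ} (hd' : d' < d) :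
    ∀ᶠ N : ℕ in atTop, d' ≤ F N N / massFn (cycleWeight α β N) N := by
  have hν : 0 < 1 - μ := sub_pos.2 h.mu_lt
  have hc := h.c_pos
  set L := c * (1 - μ) ^ (-s) / (1 - μ)
  have hL : 0 < L := by positivity
  obtain ⟨e, he, hed⟩ := exists_between hd'
  have hlim : Tendsto (fun N : ℕ => L * e / (massFn (cycleWeight α β N) N * (N : ℝ) ^ s)) atTop
      (𝓝 e) := by
    have hdiv := (tendsto_const_nhds (x := L * e)).div (h.tendsto_massFn_mul_rpow 0) hL.ne'
    rwa [mul_div_cancel_left₀ _ hL.ne'] at hdiv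
  filter_upwards [hF 0 (L * e) (mul_lt_mul_of_pos_left hed hL),
    hlim.eventually (le_mem_nhds he), h.eventually_massFn_pos, eventually_gt_atTop 0]
    with N hFN hle hmass hN
  have : (0 : ℝ) < N := Nat.cast_pos.2 hN
  calc d' ≤ L * e / (massFn (cycleWeight α β N) N * (N : ℝ) ^ s) := hle
    _ ≤ F N N * (N : ℝ) ^ s / (massFn (cycleWeight α β N) N * (N : ℝ) ^ s) :=
        div_le_div_of_nonneg_right hFN (by positivity)
    _ = F N N / massFn (cycleWeight α β N) N := mul_div_mul_right _ _ (by positivity)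

theorem tendsto_sum_beta (h : HeavyTail α β s c μ) :
    Tendsto (fun K => ∑ l ∈ Finset.Icc 1 K, β l) atTop (𝓝 μ) := by
  refine ((tendsto_add_atTop_iff_nat 1).2 h.hasSum.tendsto_sum_nat).congr fun K => ?_
  rw [Finset.range_eq_Ico, Finset.sum_eq_sum_Ico_succ_bot (by omega), h.beta_zero, zero_add,
    zero_add, Finset.Ico_add_one_right_eq_Icc]

theorem exists_eventually_le_short (h : HeavyTail α β s c μ) (m : ℕ) {d : ℝ} (hd : d < μ ^ m) :
    ∃ K : ℕ, ∀ᶠ N : ℕ in atTop, d ≤ lexMass (cycleWeight α β N)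
      (List.replicate m (Set.Icc 1 K)) N / massFn (cycleWeight α β N) N := by
  obtain ⟨K, hK⟩ := ((h.tendsto_sum_beta.pow m).eventually (lt_mem_nhds hd)).exists
  have hlocal := h.localGe_lexMass_replicate_append (As := fun _ => []) K h.localGe_massFn m
  simp only [List.append_nil] at hlocal
  rw [mul_comm] at hlocal
  exact ⟨K, h.eventually_le_div_massFn hlocal hK⟩

/-- The long cycle costs the weight `c ((1 - μ) N)⁻ˢ`, and each short one the size-biased weight
`β l` before and `β l / μ` after it: before it, there are still about `N` points left, afterwards
only `μ N`. -/
theorem exists_eventually_le_long (h : HeavyTail α β s c μ) (i j : ℕ) {d : ℝ}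
    (hd : d < μ ^ i * (1 - μ)) {ε : ℝ} (hε : 0 < ε) :
    ∃ K : ℕ, ∀ᶠ N : ℕ in atTop, d ≤ lexMass (cycleWeight α β N)
      (List.replicate i (Set.Icc 1 K) ++ longWindow μ ε N :: List.replicate j (Set.Icc 1 K)) N /
        massFn (cycleWeight α β N) N := by
  have hν : 0 < 1 - μ := sub_pos.2 h.mu_lt
  have hμ := h.mu_pos
  have hlim : Tendsto (fun K => (∑ l ∈ Finset.Icc 1 K, β l) ^ i * (1 - μ) *
      ((∑ l ∈ Finset.Icc 1 K, β l) / μ) ^ j) atTop (𝓝 (μ ^ i * (1 - μ))) := by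
    simpa [hμ.ne'] using
      ((h.tendsto_sum_beta.pow i).mul_const (1 - μ)).mul ((h.tendsto_sum_beta.div_const μ).pow j)
  obtain ⟨K, hK⟩ := (hlim.eventually (lt_mem_nhds hd)).exists
  have hlong : LocalGe s (fun N => lexMass (cycleWeight α β N)
      (longWindow μ ε N :: List.replicate j (Set.Icc 1 K)))
      (c * (1 - μ) ^ (-s) * ((∑ l ∈ Finset.Icc 1 K, β l) / μ) ^ j) := by
    simp only [lexMass_cons]
    exact h.localGe_cycleStep_longWindow (fun N => lexMass_nonneg (h.weight_nonneg N) _)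
      (h.bulkGe_lexMass_replicate K j) hε
  refine ⟨K, h.eventually_le_div_massFn ?_ hK⟩
  convert! h.localGe_lexMass_replicate_append K hlong i using 1
  field_simp

end HeavyTail

/-! ### Power series on a disk -/

theorem hasFPowerSeriesOnBall_of_hasSum {e : ℕ → ℂ} {E : ℂ → ℂ} {R : ℝ} (hR : 0 < R)
    (h : ∀ z : ℂ, ‖z‖ < R → HasSum (fun k => e k * z ^ k) (E z)) :
    HasFPowerSeriesOnBall E (FormalMultilinearSeries.ofScalars ℂ e) 0 (ENNReal.ofReal R) where
  r_le := by
    refine ENNReal.le_of_forall_nnreal_lt fun r hr => ?_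
    have hrR : (r : ℝ) < R := by
      rwa [← ENNReal.ofReal_coe_nnreal, ENNReal.ofReal_lt_ofReal_iff hR] at hr
    have hterm := (h (r : ℂ) (by simpa using hrR)).summable.tendsto_atTop_zero.norm
    refine FormalMultilinearSeries.le_radius_of_tendsto _ (l := 0) ?_
    simpa [FormalMultilinearSeries.ofScalars_norm] using hterm
  r_pos := ENNReal.ofReal_pos.2 hR
  hasSum := by
    intro y hy
    rw [Metric.eball_ofReal, mem_ball_zero_iff] at hy
    simpa [FormalMultilinearSeries.ofScalars, zero_add] using! h y hy

theorem differentiableOn_of_hasSum {e : ℕ → ℂ} {E : ℂ → ℂ} {R : ℝ} (hR : 0 < R)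
    (h : ∀ z : ℂ, ‖z‖ < R → HasSum (fun k => e k * z ^ k) (E z)) :
    DifferentiableOn ℂ E (Metric.ball 0 R) := by
  rw [← Metric.eball_ofReal]
  exact (hasFPowerSeriesOnBall_of_hasSum hR h).differentiableOn

theorem coeff_unique {e e' : ℕ → ℂ} {E : ℂ → ℂ} {R : ℝ} (hR : 0 < R)
    (h : ∀ z : ℂ, ‖z‖ < R → HasSum (fun k => e k * z ^ k) (E z))
    (h' : ∀ z : ℂ, ‖z‖ < R → HasSum (fun k => e' k * z ^ k) (E z)) : e = e' :=
  FormalMultilinearSeries.ofScalars_series_injective (𝕜 := ℂ) (E := ℂ)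
    (HasFPowerSeriesAt.eq_formalMultilinearSeries
      (hasFPowerSeriesOnBall_of_hasSum hR h).hasFPowerSeriesAt
      (hasFPowerSeriesOnBall_of_hasSum hR h').hasFPowerSeriesAt)

theorem hasSum_iteratedDeriv_on_ball {f : ℂ → ℂ} {R : ℝ}
    (hf : DifferentiableOn ℂ f (Metric.ball 0 R)) {z : ℂ} (hz : ‖z‖ < R) :
    HasSum (fun k => iteratedDeriv k f 0 / k.factorial * z ^ k) (f z) := by
  convert! Complex.hasSum_taylorSeries_on_ball hf (mem_ball_zero_iff.2 hz) using 2 with k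
  simp only [sub_zero, smul_eq_mul]
  ring

theorem analyticOnNhd_iteratedDeriv {f : ℂ → ℂ} {U : Set ℂ} (hU : IsOpen U)
    (hf : DifferentiableOn ℂ f U) (n : ℕ) : AnalyticOnNhd ℂ (iteratedDeriv n f) U := by
  rw [iteratedDeriv_eq_iterate]
  exact (hf.analyticOnNhd hU).iterated_deriv n

theorem hasSum_iteratedDeriv {e : ℕ → ℂ} {f : ℂ → ℂ} {R : ℝ} (hR : 0 < R)
    (h : ∀ z : ℂ, ‖z‖ < R → HasSum (fun k => e k * z ^ k) (f z)) (n : ℕ) {z : ℂ} (hz : ‖z‖ < R) :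
    HasSum (fun k => ((n + k).descFactorial n : ℂ) * e (n + k) * z ^ k) (iteratedDeriv n f z) := by
  have hf := differentiableOn_of_hasSum hR h
  have hfn : DifferentiableOn ℂ (iteratedDeriv n f) (Metric.ball 0 R) :=
    (analyticOnNhd_iteratedDeriv Metric.isOpen_ball hf n).differentiableOn
  have htaylor := coeff_unique hR h fun z hz => hasSum_iteratedDeriv_on_ball hf hz
  convert! hasSum_iteratedDeriv_on_ball hfn hz using 3 with k
  have hiter : iteratedDeriv k (iteratedDeriv n f) = iteratedDeriv (n + k) f := by
    simp only [iteratedDeriv_eq_iterate, add_comm n k, Function.iterate_add_apply]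
  have hfact : (k.factorial : ℂ) * (n + k).descFactorial n = (n + k).factorial := by
    have := Nat.factorial_mul_descFactorial (Nat.le_add_right n k)
    rw [Nat.add_sub_cancel_left] at this
    exact_mod_cast this
  have hk : (k.factorial : ℂ) ≠ 0 := by exact_mod_cast k.factorial_ne_zero
  have hnk : ((n + k).factorial : ℂ) ≠ 0 := by exact_mod_cast (n + k).factorial_ne_zero
  rw [hiter, htaylor]
  field_simp
  rw [← hfact]
  ring

theorem norm_coeff_le_circle_integral {e : ℕ → ℂ} {E : ℂ → ℂ} {R ρ : ℝ} (hρ : 0 < ρ) (hρR : ρ < R)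
    (hE : ∀ z : ℂ, ‖z‖ < R → HasSum (fun k => e k * z ^ k) (E z)) (k : ℕ) :
    ‖e k‖ ≤ (2 * Real.pi)⁻¹ * (∫ θ in (0 : ℝ)..2 * Real.pi, ‖E (circleMap 0 ρ θ)‖) * ρ⁻¹ ^ k := by
  have hR := hρ.trans hρR
  lift ρ to ℝ≥0 using hρ.le
  have hcauchy := ((differentiableOn_of_hasSum hR hE).mono
    (Metric.closedBall_subset_ball hρR)).hasFPowerSeriesOnBall hρ
  have hcoeff : ‖e k‖ = ‖cauchyPowerSeries E 0 ρ k‖ := by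
    have hseries := hcauchy.hasFPowerSeriesAt.eq_formalMultilinearSeries
      (hasFPowerSeriesOnBall_of_hasSum hR hE).hasFPowerSeriesAt
    exact (FormalMultilinearSeries.ofScalars_norm _ _ _).symm.trans
      (congrArg (fun p : FormalMultilinearSeries ℂ ℂ ℂ => ‖p k‖) hseries.symm)
  rw [hcoeff]
  simpa using norm_cauchyPowerSeries_le E 0 ρ k

/-! ### Singularity analysis -/

theorem norm_circleMap_sub_ofReal (ρ θ : ℝ) :
    ‖circleMap 0 1 θ - (ρ : ℂ)‖ = ‖1 - circleMap 0 ρ θ‖ := by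
  have hunit : circleMap 0 1 θ * (starRingEnd ℂ) (circleMap 0 1 θ) = 1 := by
    simp [Complex.mul_conj, Complex.normSq_eq_norm_sq]
  have hfactor : 1 - circleMap 0 ρ θ
      = circleMap 0 1 θ * (starRingEnd ℂ) (circleMap 0 1 θ - (ρ : ℂ)) := by
    rw [map_sub, mul_sub, hunit, Complex.conj_ofReal]
    simp only [circleMap, zero_add, Complex.ofReal_one, one_mul]
    ring
  rw [hfactor, norm_mul, Complex.norm_conj]
  simp

theorem integral_inv_norm_one_sub_circleMap_sq {ρ : ℝ} (hρ0 : 0 ≤ ρ) (hρ1 : ρ < 1) :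
    ∫ θ in (0 : ℝ)..2 * Real.pi, (‖1 - circleMap 0 ρ θ‖ ^ 2)⁻¹
      = 2 * Real.pi * (1 - ρ ^ 2)⁻¹ := by
  have hρ : (ρ : ℂ) ∈ Metric.ball (0 : ℂ) 1 := by simpa [abs_of_nonneg hρ0] using hρ1
  have hpoisson := (diffContOnCl_const (c := (1 : ℂ))).circleAverage_poissonKernel_smul' hρ
  have hkernel : ∀ θ : ℝ, ((‖circleMap 0 1 θ - 0‖ ^ 2 - ‖(ρ : ℂ) - 0‖ ^ 2) /
      ‖circleMap 0 1 θ - 0 - ((ρ : ℂ) - 0)‖ ^ 2) • (1 : ℂ)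
      = (((1 - ρ ^ 2) * (‖1 - circleMap 0 ρ θ‖ ^ 2)⁻¹ : ℝ) : ℂ) := by
    intro θ
    rw [sub_zero, sub_zero, norm_circleMap_sub_ofReal]
    simp [div_eq_mul_inv]
  rw [Real.circleAverage_def] at hpoisson
  simp only [hkernel] at hpoisson
  rw [intervalIntegral.integral_ofReal, intervalIntegral.integral_const_mul,
    Complex.real_smul] at hpoisson
  norm_cast at hpoisson
  rw [eq_mul_inv_iff_mul_eq₀ (by nlinarith), mul_comm]
  rwa [inv_mul_eq_iff_eq_mul₀ (by positivity), mul_one] at hpoisson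

theorem integral_norm_circleMap_le {E : ℂ → ℂ} {C b ρ : ℝ} (hb : 2 ≤ b) (hρ0 : 0 ≤ ρ) (hρ1 : ρ < 1)
    (hE : ∀ w : ℂ, ‖w‖ < 1 → ‖E w‖ ≤ C * ‖1 - w‖ ^ (-b)) :
    ∫ θ in (0 : ℝ)..2 * Real.pi, ‖E (circleMap 0 ρ θ)‖
      ≤ C * (1 - ρ) ^ (2 - b) * (2 * Real.pi * (1 - ρ ^ 2)⁻¹) := by
  have hC : 0 ≤ C := by simpa using (norm_nonneg _).trans (hE 0 (by simp))
  have hnorm (θ : ℝ) : ‖circleMap 0 ρ θ‖ = ρ := by simp [abs_of_nonneg hρ0]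
  have hdist (θ : ℝ) : 1 - ρ ≤ ‖1 - circleMap 0 ρ θ‖ := by
    simpa [hnorm] using norm_sub_norm_le (1 : ℂ) (circleMap 0 ρ θ)
  have hpos (θ : ℝ) : 0 < ‖1 - circleMap 0 ρ θ‖ := (sub_pos.2 hρ1).trans_le (hdist θ)
  have hpointwise (θ : ℝ) : ‖E (circleMap 0 ρ θ)‖
      ≤ C * (1 - ρ) ^ (2 - b) * (‖1 - circleMap 0 ρ θ‖ ^ 2)⁻¹ := by
    have hsplit : ‖1 - circleMap 0 ρ θ‖ ^ (-b)
        = ‖1 - circleMap 0 ρ θ‖ ^ (2 - b) * (‖1 - circleMap 0 ρ θ‖ ^ 2)⁻¹ := by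
      rw [show -b = (2 - b) - 2 by ring, Real.rpow_sub (hpos θ), div_eq_mul_inv, Real.rpow_two]
    refine (hE _ ((hnorm θ).trans_lt hρ1)).trans ?_
    rw [mul_assoc, hsplit]
    gcongr C * (?_ * _)
    exact Real.rpow_le_rpow_of_nonpos (sub_pos.2 hρ1) (hdist θ) (by linarith)
  have hcont : Continuous fun θ : ℝ => (‖1 - circleMap 0 ρ θ‖ ^ 2)⁻¹ :=
    Continuous.inv₀ (by fun_prop) fun θ => (pow_pos (hpos θ) 2).ne'
  rw [← integral_inv_norm_one_sub_circleMap_sq hρ0 hρ1, ← intervalIntegral.integral_const_mul,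
    intervalIntegral.integral_of_le (by positivity),
    intervalIntegral.integral_of_le (by positivity)]
  exact integral_mono_of_nonneg (.of_forall fun θ => norm_nonneg _)
    ((hcont.const_mul _).integrableOn_Ioc) (.of_forall hpointwise)

theorem inv_one_sub_one_div_pow_le_exp_two {k : ℕ} (hk : 2 ≤ k) :
    (1 - 1 / (k : ℝ))⁻¹ ^ k ≤ Real.exp 2 := by
  have hk0 : (0 : ℝ) < k := by positivity
  have hhalf : 1 / (k : ℝ) ≤ 1 / 2 := one_div_le_one_div_of_le two_pos (by exact_mod_cast hk)
  have hbase : (1 - 1 / (k : ℝ))⁻¹ ≤ Real.exp (2 / k) := by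
    refine le_trans ?_ (Real.add_one_le_exp _)
    rw [inv_le_iff_one_le_mul₀ (by linarith), show (2 : ℝ) / k = 2 * (1 / k) by ring]
    nlinarith [one_div_pos.2 hk0]
  calc (1 - 1 / (k : ℝ))⁻¹ ^ k ≤ Real.exp (2 / k) ^ k :=
        pow_le_pow_left₀ (inv_nonneg.2 (by linarith)) hbase k
    _ = Real.exp 2 := by rw [← Real.exp_nat_mul, mul_div_cancel₀ _ hk0.ne']

/-- Cauchy's estimate on the circle of radius `1 - 1 / k`. -/
theorem exists_norm_coeff_le_rpow {e : ℕ → ℂ} {E : ℂ → ℂ} {C b : ℝ} (hb : 2 ≤ b)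
    (hE : ∀ w : ℂ, ‖w‖ < 1 → HasSum (fun k => e k * w ^ k) (E w))
    (hbound : ∀ w : ℂ, ‖w‖ < 1 → ‖E w‖ ≤ C * ‖1 - w‖ ^ (-b)) :
    ∃ C', ∀ k : ℕ, 2 ≤ k → ‖e k‖ ≤ C' * (k : ℝ) ^ (b - 1) := by
  have hC : 0 ≤ C := by simpa using (norm_nonneg _).trans (hbound 0 (by simp))
  refine ⟨C * Real.exp 2, fun k hk => ?_⟩
  have hk0 : (0 : ℝ) < k := by positivity
  have hhalf : 1 / (k : ℝ) ≤ 1 / 2 := one_div_le_one_div_of_le two_pos (by exact_mod_cast hk)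
  set ρ : ℝ := 1 - 1 / k with hρ
  have hρ0 : 0 < ρ := by linarith
  have hρ1 : ρ < 1 := by linarith [one_div_pos.2 hk0]
  have hkernel : (1 - ρ ^ 2)⁻¹ ≤ (k : ℝ) := by
    rw [inv_le_comm₀ (by nlinarith) hk0, ← one_div, show 1 / (k : ℝ) = 1 - ρ by rw [hρ]; ring]
    nlinarith
  have hpow : (1 - ρ) ^ (2 - b) * k = (k : ℝ) ^ (b - 1) := by
    rw [show 1 - ρ = (k : ℝ)⁻¹ by rw [hρ]; ring, Real.inv_rpow hk0.le, ← Real.rpow_neg hk0.le,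
      ← Real.rpow_add_one hk0.ne']
    congr 1
    ring
  have hint : (2 * Real.pi)⁻¹ * ∫ θ in (0 : ℝ)..2 * Real.pi, ‖E (circleMap 0 ρ θ)‖
      ≤ C * (k : ℝ) ^ (b - 1) := by
    rw [inv_mul_le_iff₀ (by positivity)]
    calc ∫ θ in (0 : ℝ)..2 * Real.pi, ‖E (circleMap 0 ρ θ)‖
        ≤ C * (1 - ρ) ^ (2 - b) * (2 * Real.pi * (1 - ρ ^ 2)⁻¹) :=
          integral_norm_circleMap_le hb hρ0.le hρ1 hbound
      _ ≤ C * (1 - ρ) ^ (2 - b) * (2 * Real.pi * k) := by gcongr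
      _ = 2 * Real.pi * (C * (k : ℝ) ^ (b - 1)) := by rw [← hpow]; ring
  calc ‖e k‖ ≤ (2 * Real.pi)⁻¹ * (∫ θ in (0 : ℝ)..2 * Real.pi, ‖E (circleMap 0 ρ θ)‖) * ρ⁻¹ ^ k :=
        norm_coeff_le_circle_integral hρ0 hρ1 hE k
    _ ≤ C * (k : ℝ) ^ (b - 1) * Real.exp 2 := by
        gcongr
        exact inv_one_sub_one_div_pow_le_exp_two hk
    _ = C * Real.exp 2 * (k : ℝ) ^ (b - 1) := by ring

theorem ascPochhammer_smeval_eq_prod {R : Type*} [CommSemiring R] (r : R) (n : ℕ) :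
    (ascPochhammer ℕ n).smeval r = ∏ j ∈ Finset.range n, (r + j) := by
  induction n with
  | zero => simp
  | succ n ih =>
    rw [ascPochhammer_succ_right, Polynomial.smeval_mul, ih, Finset.prod_range_succ]
    simp [Polynomial.smeval_natCast]

/-- The coefficients of the negative binomial series `(1 - w)^{-α}`. -/
noncomputable def negBinom (α : ℝ) (k : ℕ) : ℝ := (∏ j ∈ Finset.range k, (α + j)) / k.factorial

theorem hasSum_negBinom (α : ℝ) {w : ℂ} (hw : ‖w‖ < 1) :
    HasSum (fun k => (negBinom α k : ℂ) * w ^ k) ((1 - w) ^ (-(α : ℂ))) := by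
  have hseries := (Complex.one_div_one_sub_cpow_hasFPowerSeriesOnBall_zero (α : ℂ)).hasSum (y := w)
    (by simpa [← ENNReal.ofReal_one, Metric.eball_ofReal] using hw)
  simp only [zero_add] at hseries
  rw [Complex.cpow_neg, ← one_div]
  convert! hseries using 2 with k
  have hfact : (k.factorial : ℂ) ≠ 0 := by exact_mod_cast k.factorial_ne_zero
  have hprod := Ring.factorial_nsmul_multichoose_eq_ascPochhammer (α : ℂ) k
  rw [Ring.multichoose_eq, ascPochhammer_smeval_eq_prod, nsmul_eq_mul] at hprod
  have hchoose : (negBinom α k : ℂ) = Ring.choose ((α : ℂ) + k - 1) k := by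
    rw [negBinom]
    push_cast
    rw [← hprod]
    field_simp
  rw [hchoose]
  simp [FormalMultilinearSeries.ofScalars]

theorem tendsto_negBinom {α : ℝ} (hα : 0 < α) :
    Tendsto (fun k : ℕ => negBinom α k / (k : ℝ) ^ (α - 1)) atTop (𝓝 (Real.Gamma α)⁻¹) := by
  have hlim := (tendsto_natCast_div_add_atTop α).mul
    ((Real.GammaSeq_tendsto_Gamma α).inv₀ (Real.Gamma_pos_of_pos hα).ne')
  rw [one_mul] at hlim
  refine hlim.congr' ?_
  filter_upwards [eventually_gt_atTop 0] with k hk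
  have hk' : (0 : ℝ) < k := by exact_mod_cast hk
  have hprod : ∏ j ∈ Finset.range k, (α + j) ≠ 0 :=
    Finset.prod_ne_zero_iff.2 fun j _ => by positivity
  rw [Real.GammaSeq, negBinom, Finset.prod_range_succ, Real.rpow_sub hk', Real.rpow_one,
    add_comm α k]
  field_simp

theorem tendsto_of_tendsto_descFactorial {p : ℕ → ℝ} {n : ℕ} {s c : ℝ}
    (h : Tendsto (fun k : ℕ => ((n + k).descFactorial n : ℝ) * p (n + k) / (k : ℝ) ^ (n - s - 1))
      atTop (𝓝 c)) : Tendsto (fun j : ℕ => p j * (j : ℝ) ^ (s + 1)) atTop (𝓝 c) := by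
  have hratio : Tendsto (fun k : ℕ => ((k + n : ℕ) : ℝ) / k) atTop (𝓝 1) := by
    simpa using (tendsto_natCast_div_add_atTop (n : ℝ)).inv₀ one_ne_zero
  have hdesc : Tendsto (fun k : ℕ => ((k + n : ℕ) : ℝ) ^ n / (k + n).descFactorial n)
      atTop (𝓝 1) := by
    have hequiv := (Asymptotics.isEquivalent_iff_tendsto_one ?_).1 (isEquivalent_descFactorial n)
    · simpa [Function.comp_def] using (hequiv.inv₀ one_ne_zero).comp (tendsto_add_atTop_nat n)
    · filter_upwards [eventually_gt_atTop 0] with k hk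
      positivity
  -- `p j j^{s+1}` is the given quotient times `j^n / (j)_n` and `(j / (j - n))^{s+1-n}`.
  have hlim := (h.mul hdesc).mul (hratio.rpow_const (p := s + 1 - n) (Or.inl one_ne_zero))
  rw [mul_one, Real.one_rpow, mul_one] at hlim
  rw [← tendsto_add_atTop_iff_nat n]
  refine hlim.congr' ?_
  filter_upwards [eventually_gt_atTop 0] with k hk
  have hk' : (0 : ℝ) < k := by exact_mod_cast hk
  have hkn : (0 : ℝ) < (k + n : ℕ) := by positivity
  have hd : ((k + n).descFactorial n : ℝ) ≠ 0 := by
    exact_mod_cast (Nat.descFactorial_pos.2 (Nat.le_add_left n k)).ne'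
  rw [add_comm n k, Real.div_rpow hkn.le hk'.le, show (n : ℝ) - s - 1 = -(s + 1 - n) by ring,
    Real.rpow_neg hk'.le, Real.rpow_sub_natCast hkn.ne']
  field_simp

/-! ### The domain of holomorphy -/

theorem mem_deltaDomain_iff {R η φ : ℝ} (hφ : 0 < φ) (hφ' : φ < Real.pi / 2) {z : ℂ} :
    z ∈ deltaDomain R η φ ↔ ‖z‖ < ‖(R : ℂ) * (1 + η * Complex.exp (φ * Complex.I))‖ ∧
      (z - R).re < Real.cos φ * ‖z - R‖ := by
  refine and_congr_right fun _ => ?_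
  by_cases hz : z = R
  · simp [hz]
  have hzR : z - R ≠ 0 := sub_ne_zero.2 hz
  have harg : φ < |Complex.arg (z - R)| ↔ Real.cos |Complex.arg (z - R)| < Real.cos φ :=
    (Real.strictAntiOn_cos.lt_iff_gt ⟨abs_nonneg _, Complex.abs_arg_le_pi _⟩
      ⟨hφ.le, by linarith [Real.pi_pos]⟩).symm
  rw [Real.cos_abs, Complex.cos_arg hzR, div_lt_iff₀ (norm_pos_iff.2 hzR)] at harg
  simp only [ne_eq, hz, not_false_eq_true, true_and, harg]

theorem isOpen_deltaDomain {R η φ : ℝ} (hφ : 0 < φ) (hφ' : φ < Real.pi / 2) :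
    IsOpen (deltaDomain R η φ) := by
  have hset : deltaDomain R η φ = {z : ℂ |
      ‖z‖ < ‖(R : ℂ) * (1 + η * Complex.exp (φ * Complex.I))‖ ∧
        (z - R).re < Real.cos φ * ‖z - R‖} := Set.ext fun z => mem_deltaDomain_iff hφ hφ'
  rw [hset]
  exact (isOpen_lt (by fun_prop) (by fun_prop)).and
    (isOpen_lt (Complex.continuous_re.comp (by fun_prop)) (by fun_prop))

theorem re_lt_of_norm_le {z : ℂ} {R : ℝ} (hz : ‖z‖ ≤ R) (hzR : z ≠ R) : z.re < R := by
  refine lt_of_le_of_ne ((Complex.re_le_norm z).trans hz) fun h => ?_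
  have hnorm : z.re = ‖z‖ := le_antisymm (Complex.re_le_norm z) (hz.trans_eq h.symm)
  exact hzR (Complex.ext (by simpa using h)
    (by simpa using (Complex.nonneg_iff.1 (Complex.re_eq_norm.1 hnorm)).2.symm))

theorem mem_deltaDomain_of_norm_le {R η φ : ℝ} (hR : 0 < R) (hη : 0 < η) (hφ : 0 < φ)
    (hφ' : φ < Real.pi / 2) {z : ℂ} (hz : ‖z‖ ≤ R) (hzR : z ≠ R) : z ∈ deltaDomain R η φ := by
  have hcos : 0 < Real.cos φ := Real.cos_pos_of_mem_Ioo ⟨by linarith, hφ'⟩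
  rw [mem_deltaDomain_iff hφ hφ']
  constructor
  · refine (hz.trans_lt ?_).trans_le (Complex.re_le_norm _)
    rw [Complex.re_ofReal_mul, Complex.add_re, Complex.one_re, Complex.re_ofReal_mul,
      Complex.exp_ofReal_mul_I_re]
    linarith [mul_pos hR (mul_pos hη hcos)]
  · have hneg : (z - R).re < 0 := by simpa using re_lt_of_norm_le hz hzR
    exact hneg.trans_le (by positivity)

theorem mul_mem_deltaDomain {R η φ : ℝ} (hR : 0 < R) (hη : 0 < η) (hφ : 0 < φ)
    (hφ' : φ < Real.pi / 2) {w : ℂ} (hw : ‖w‖ ≤ 1) (hw1 : w ≠ 1) :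
    (R : ℂ) * w ∈ deltaDomain R η φ := by
  refine mem_deltaDomain_of_norm_le hR hη hφ hφ' ?_ ?_
  · rw [norm_mul, Complex.norm_real, Real.norm_of_nonneg hR.le]
    exact mul_le_of_le_one_right hR.le hw
  · simpa [hR.ne'] using hw1

theorem exists_hasSum_of_analyticAt {e : ℕ → ℂ} {g : ℂ → ℂ} {R : ℝ} (hR : 0 < R)
    (hg : ∀ z : ℂ, ‖z‖ < R → HasSum (fun j => e j * z ^ j) (g z))
    (han : ∀ z : ℂ, ‖z‖ ≤ R → AnalyticAt ℂ g z) :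
    ∃ r, R < r ∧ ∀ z : ℂ, ‖z‖ < r → HasSum (fun j => e j * z ^ j) (g z) := by
  obtain ⟨δ, hδ, hsub⟩ := (isCompact_closedBall (0 : ℂ) R).exists_thickening_subset_open
    (isOpen_analyticAt ℂ g) fun z hz => han z (mem_closedBall_zero_iff.1 hz)
  rw [thickening_closedBall hδ hR.le, add_comm] at hsub
  have hd : DifferentiableOn ℂ g (Metric.ball 0 (R + δ)) := fun z hz =>
    (hsub hz).differentiableAt.differentiableWithinAt
  refine ⟨R + δ, by linarith, fun z hz => ?_⟩
  rw [coeff_unique hR hg fun z hz => hasSum_iteratedDeriv_on_ball hd (hz.trans (by linarith))]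
  exact hasSum_iteratedDeriv_on_ball hd hz

theorem exists_norm_mul_pow_mul_rpow_le {e : ℕ → ℂ} {R r : ℝ} (hR : 0 < R) (hRr : R < r)
    (hs : Summable fun j => e j * (r : ℂ) ^ j) (t : ℝ) :
    ∃ C, ∀ j : ℕ, ‖e j‖ * R ^ j * (j : ℝ) ^ t ≤ C := by
  have hr : 0 < r := hR.trans hRr
  obtain ⟨k, hk⟩ := exists_nat_ge t
  have hterm : Tendsto (fun j : ℕ => ‖e j‖ * r ^ j) atTop (𝓝 0) := by
    simpa [abs_of_pos hr] using hs.tendsto_atTop_zero.norm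
  have hgeom : Tendsto (fun j : ℕ => (j : ℝ) ^ k * (R / r) ^ j) atTop (𝓝 0) := by
    refine tendsto_pow_const_mul_const_pow_of_abs_lt_one k ?_
    rwa [abs_of_pos (by positivity), div_lt_one hr]
  obtain ⟨C, hC⟩ := (hterm.mul hgeom).bddAbove_range
  refine ⟨max C (‖e 0‖ * (0 : ℝ) ^ t), fun j => ?_⟩
  rcases Nat.eq_zero_or_pos j with rfl | hj
  · simp
  have hpow : (j : ℝ) ^ t ≤ (j : ℝ) ^ k := by
    rw [← Real.rpow_natCast]
    exact Real.rpow_le_rpow_of_exponent_le (by exact_mod_cast hj) hk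
  calc ‖e j‖ * R ^ j * (j : ℝ) ^ t ≤ ‖e j‖ * R ^ j * (j : ℝ) ^ k := by gcongr
    _ = ‖e j‖ * r ^ j * ((j : ℝ) ^ k * (R / r) ^ j) := by
        rw [div_pow]
        field_simp
    _ ≤ max C (‖e 0‖ * (0 : ℝ) ^ t) := (hC ⟨j, rfl⟩).trans (le_max_left _ _)

/-! ### The tail of the coefficients -/

theorem norm_genCoeff (x : ℕ → ℝ≥0) (j : ℕ) : ‖genCoeff x j‖ = (x j : ℝ) / j := by
  simp [genCoeff]

theorem singularExpansion_of_le {R s a : ℝ} {b : ℕ → ℝ} {n : ℕ} (h : ⌈s⌉₊ ≤ n) (z : ℂ) :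
    singularExpansion R s a b n z = (z / R) ^ n *
      (((Real.Gamma (-s + n) * a / Real.Gamma (-s) : ℝ) : ℂ) *
        (1 - z / R) ^ (-((n - s : ℝ) : ℂ))) := by
  rw [singularExpansion, Finset.Ico_eq_empty (by omega), Finset.sum_empty, zero_add,
    ← Complex.ofReal_neg, neg_sub]

theorem exists_norm_le_of_eventually_norm_le {D : ℂ → ℂ} {b C : ℝ} (hb : 0 ≤ b)
    (hcont : ∀ w : ℂ, ‖w‖ ≤ 1 → w ≠ 1 → ContinuousAt D w)
    (hnear : ∀ᶠ w in 𝓝 (1 : ℂ), ‖w‖ < 1 → ‖D w‖ ≤ C * ‖1 - w‖ ^ (-b)) :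
    ∃ C', ∀ w : ℂ, ‖w‖ < 1 → ‖D w‖ ≤ C' * ‖1 - w‖ ^ (-b) := by
  obtain ⟨ε, hε, hball⟩ := Metric.eventually_nhds_iff_ball.1 hnear
  have hcompact : IsCompact (Metric.closedBall (0 : ℂ) 1 \ Metric.ball 1 ε) :=
    (isCompact_closedBall _ _).diff Metric.isOpen_ball
  have hcontOn : ContinuousOn D (Metric.closedBall (0 : ℂ) 1 \ Metric.ball 1 ε) := fun w hw =>
    (hcont w (mem_closedBall_zero_iff.1 hw.1) fun h => hw.2 (by simp [h, hε])).continuousWithinAt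
  obtain ⟨M, hM⟩ := hcompact.exists_bound_of_continuousOn hcontOn
  refine ⟨max C (M * 2 ^ b), fun w hw => ?_⟩
  have hw1 : 0 < ‖1 - w‖ := norm_pos_iff.2 (sub_ne_zero.2 fun h => by simp [← h] at hw)
  by_cases hwε : w ∈ Metric.ball 1 ε
  · exact (hball w hwε hw).trans (mul_le_mul_of_nonneg_right (le_max_left _ _) (by positivity))
  have hDw := hM w ⟨mem_closedBall_zero_iff.2 hw.le, hwε⟩
  have hM0 : 0 ≤ M := (norm_nonneg _).trans hDw
  have hle2 : ‖1 - w‖ ≤ 2 := (norm_sub_le _ _).trans (by rw [norm_one]; linarith)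
  calc ‖D w‖ ≤ M := hDw
    _ = M * 2 ^ b * 2 ^ (-b) := by
      rw [mul_assoc, ← Real.rpow_add two_pos, add_neg_cancel, Real.rpow_zero, mul_one]
    _ ≤ M * 2 ^ b * ‖1 - w‖ ^ (-b) := by
      gcongr M * 2 ^ b * ?_
      exact Real.rpow_le_rpow_of_nonpos hw1 hle2 (by linarith)
    _ ≤ _ := mul_le_mul_of_nonneg_right (le_max_right _ _) (by positivity)

theorem continuousAt_one_sub_cpow {w : ℂ} (hw : ‖w‖ ≤ 1) (hw1 : w ≠ 1) (p : ℂ) :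
    ContinuousAt (fun w : ℂ => (1 - w) ^ p) w := by
  refine ContinuousAt.cpow (by fun_prop) continuousAt_const (Complex.mem_slitPlane_iff.2 (.inl ?_))
  simpa using re_lt_of_norm_le hw (by simpa using hw1)

theorem tendsto_coeff_of_singularity {d : ℕ → ℝ} {D : ℂ → ℂ} {A α b C : ℝ} (hb : 2 ≤ b)
    (hbα : b < α) (hD : ∀ w : ℂ, ‖w‖ < 1 → HasSum (fun k => (d k : ℂ) * w ^ k) (D w))
    (hcont : ∀ w : ℂ, ‖w‖ ≤ 1 → w ≠ 1 → ContinuousAt D w)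
    (hnear : ∀ᶠ w in 𝓝 (1 : ℂ), ‖w‖ < 1 →
      ‖D w - A * (1 - w) ^ (-(α : ℂ))‖ ≤ C * ‖1 - w‖ ^ (-b)) :
    Tendsto (fun k : ℕ => d k / (k : ℝ) ^ (α - 1)) atTop (𝓝 (A / Real.Gamma α)) := by
  have hseries : ∀ w : ℂ, ‖w‖ < 1 →
      HasSum (fun k => ((d k - A * negBinom α k : ℝ) : ℂ) * w ^ k)
        (D w - A * (1 - w) ^ (-(α : ℂ))) := by
    intro w hw
    convert! (hD w hw).sub ((hasSum_negBinom α hw).mul_left (A : ℂ)) using 2 with k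
    push_cast
    ring
  obtain ⟨C₁, hgrowth⟩ := exists_norm_le_of_eventually_norm_le (by linarith)
    (fun w hw hw1 => (hcont w hw hw1).sub
      (continuousAt_const.mul (continuousAt_one_sub_cpow hw hw1 _))) hnear
  obtain ⟨C₂, hcoeff⟩ := exists_norm_coeff_le_rpow hb hseries hgrowth
  have herror : Tendsto (fun k : ℕ => (d k - A * negBinom α k) / (k : ℝ) ^ (α - 1)) atTop
      (𝓝 0) := by
    have hpow : Tendsto (fun k : ℕ => C₂ * (k : ℝ) ^ (-(α - b))) atTop (𝓝 0) := by
      simpa using ((tendsto_rpow_neg_atTop (sub_pos.2 hbα)).comp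
        tendsto_natCast_atTop_atTop).const_mul C₂
    refine squeeze_zero_norm' ?_ hpow
    filter_upwards [eventually_ge_atTop 2] with k hk
    have hk' : (0 : ℝ) < k := by positivity
    rw [norm_div, Real.norm_of_nonneg (by positivity : 0 ≤ (k : ℝ) ^ (α - 1)),
      div_le_iff₀ (by positivity), mul_assoc, ← Real.rpow_add hk',
      show -(α - b) + (α - 1) = b - 1 by ring, ← Complex.norm_real]
    exact hcoeff k hk
  have hlim := ((tendsto_negBinom (α := α) (by linarith)).const_mul A).add herror
  rw [add_zero, ← div_eq_mul_inv] at hlim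
  refine hlim.congr fun k => ?_
  ring

theorem isBigO_rpow_of_exponent_le {ι : Type*} {l : Filter ι} {x : ι → ℝ}
    (h0 : ∀ᶠ i in l, 0 < x i) (h1 : ∀ᶠ i in l, x i ≤ 1) {p q : ℝ} (hpq : p ≤ q) :
    (fun i => x i ^ q) =O[l] fun i => x i ^ p := by
  refine Asymptotics.IsBigO.of_bound 1 ?_
  filter_upwards [h0, h1] with i hi0 hi1
  rw [one_mul, Real.norm_of_nonneg (by positivity), Real.norm_of_nonneg (by positivity)]
  exact Real.rpow_le_rpow_of_exponent_ge hi0 hi1 hpq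

theorem isBigO_norm_one_sub_div_rpow {R η φ p q : ℝ} (hR : R ≠ 0) (hpq : p ≤ q) :
    (fun z : ℂ => ‖1 - z / (R : ℂ)‖ ^ q)
      =O[𝓝[deltaDomain R η φ] (R : ℂ)] fun z : ℂ => ‖1 - z / (R : ℂ)‖ ^ p := by
  have hRc : (R : ℂ) ≠ 0 := by exact_mod_cast hR
  refine isBigO_rpow_of_exponent_le ?_ ?_ hpq
  · filter_upwards [self_mem_nhdsWithin] with z hz
    rw [norm_pos_iff, sub_ne_zero, ne_comm, Ne, div_eq_one_iff_eq hRc]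
    exact hz.2.1
  · have hcont : ContinuousAt (fun z : ℂ => ‖1 - z / (R : ℂ)‖) R := by fun_prop
    exact ((hcont.eventually_lt continuousAt_const (by simp [hRc])).filter_mono
      nhdsWithin_le_nhds).mono fun z hz => le_of_lt hz

theorem exists_norm_sub_le_of_isBigO_singularExpansion {g : ℂ → ℂ} {R η φ s a q : ℝ} {b : ℕ → ℝ}
    {n : ℕ} (hR : 0 < R) (hη : 0 < η) (hφ : 0 < φ) (hφ' : φ < Real.pi / 2) (hn : ⌈s⌉₊ ≤ n)
    (hO : (fun z : ℂ => modDeriv n g z - singularExpansion R s a b n z)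
        =O[𝓝[deltaDomain R η φ] (R : ℂ)] (fun z : ℂ => ‖1 - z / (R : ℂ)‖ ^ q)) :
    ∃ C, ∀ᶠ w in 𝓝 (1 : ℂ), ‖w‖ < 1 →
      ‖R ^ n * iteratedDeriv n g (R * w) - ((Real.Gamma (-s + n) * a / Real.Gamma (-s) : ℝ) : ℂ) *
        (1 - w) ^ (-((n - s : ℝ) : ℂ))‖ ≤ C * ‖1 - w‖ ^ q := by
  have hRc : (R : ℂ) ≠ 0 := by exact_mod_cast hR.ne'
  obtain ⟨C, hC⟩ := hO.bound
  rw [eventually_nhdsWithin_iff] at hC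
  have hmap : Tendsto (fun w : ℂ => (R : ℂ) * w) (𝓝 1) (𝓝 (R : ℂ)) := by
    have hcont : ContinuousAt (fun w : ℂ => (R : ℂ) * w) 1 := by fun_prop
    simpa [ContinuousAt] using hcont
  have hhalf : ∀ᶠ w in 𝓝 (1 : ℂ), 1 / 2 < ‖w‖ :=
    continuousAt_const.eventually_lt (by fun_prop) (by norm_num)
  refine ⟨2 ^ n * C, ?_⟩
  filter_upwards [hmap.eventually hC, hhalf] with w hbound hw_half hw
  have herror := hbound
    (mul_mem_deltaDomain hR hη hφ hφ' hw.le fun h => by simp [h] at hw)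
  rw [singularExpansion_of_le hn, modDeriv, mul_div_cancel_left₀ _ hRc, mul_pow,
    mul_comm ((R : ℂ) ^ n), mul_assoc, ← mul_sub, norm_mul, norm_pow,
    Real.norm_of_nonneg (by positivity)] at herror
  rw [mul_assoc, ← inv_mul_le_iff₀ (by positivity), ← inv_pow, ← one_div]
  refine le_trans ?_ herror
  gcongr

theorem tendsto_coeff_of_singularExpansion {e : ℕ → ℝ} {g : ℂ → ℂ} {R η φ s a : ℝ} {b : ℕ → ℝ}
    (hR : 0 < R) (hη : 0 < η) (hφ : 0 < φ) (hφ' : φ < Real.pi / 2)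
    (hg : ∀ z : ℂ, ‖z‖ < R → HasSum (fun j => (e j : ℂ) * z ^ j) (g z))
    (hol : DifferentiableOn ℂ g (deltaDomain R η φ))
    (hexp : ∀ n : ℕ, ∃ δ : ℝ, 0 < δ ∧
      (fun z : ℂ => modDeriv n g z - singularExpansion R s a b n z)
        =O[𝓝[deltaDomain R η φ] (R : ℂ)] (fun z : ℂ => ‖1 - z / (R : ℂ)‖ ^ (s - n + δ))) :
    Tendsto (fun j : ℕ => e j * R ^ j * (j : ℝ) ^ (s + 1)) atTop (𝓝 (a / Real.Gamma (-s))) := by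
  set n : ℕ := ⌈s⌉₊ + 3 with hn
  have hns : 3 ≤ (n : ℝ) - s := by
    rw [hn]
    push_cast
    linarith [Nat.le_ceil s]
  obtain ⟨δ, hδ, hO⟩ := hexp n
  have hO' := hO.trans (isBigO_norm_one_sub_div_rpow hR.ne' (p := -(n - s - min δ 1))
    (by linarith [min_le_left δ 1]))
  obtain ⟨C, hnear⟩ := exists_norm_sub_le_of_isBigO_singularExpansion hR hη hφ hφ' (by omega) hO'
  have hseries : ∀ w : ℂ, ‖w‖ < 1 → HasSum
      (fun k => (((n + k).descFactorial n * (e (n + k) * R ^ (n + k)) : ℝ) : ℂ) * w ^ k)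
      (R ^ n * iteratedDeriv n g (R * w)) := by
    intro w hw
    have hz : ‖(R : ℂ) * w‖ < R := by
      rw [norm_mul, Complex.norm_real, Real.norm_of_nonneg hR.le]
      exact mul_lt_of_lt_one_right hR hw
    convert! (hasSum_iteratedDeriv hR hg n hz).mul_left ((R : ℂ) ^ n) using 2 with k
    push_cast
    ring
  have hcont : ∀ w : ℂ, ‖w‖ ≤ 1 → w ≠ 1 →
      ContinuousAt (fun w => R ^ n * iteratedDeriv n g (R * w)) w := fun w hw hw1 =>
    continuousAt_const.mul (ContinuousAt.comp' (analyticOnNhd_iteratedDeriv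
      (isOpen_deltaDomain hφ hφ') hol n _ (mul_mem_deltaDomain hR hη hφ hφ' hw hw1)).continuousAt
      (by fun_prop))
  have hlim := tendsto_coeff_of_singularity (by linarith [min_le_right δ 1])
    (by linarith [lt_min hδ one_pos]) hseries hcont hnear
  refine tendsto_of_tendsto_descFactorial (n := n) ?_
  convert! hlim using 2
  have hΓ : Real.Gamma (n - s) ≠ 0 := (Real.Gamma_pos_of_pos (by linarith)).ne'
  rw [neg_add_eq_sub]
  field_simp

/-! ### Scaled weights -/

/-- The weights `x_j R^j`, `j ≥ 1`, with value zero at `j = 0`. Passing from `x_j` to `x_j R^j` does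
not change the measures `P_N`, and for `R` the radius of convergence it makes the `κ_j`
summable. -/
noncomputable def scaledCoeff (x : ℕ → ℝ≥0) (R : ℝ) (j : ℕ) : ℝ := if j = 0 then 0 else x j * R ^ j

theorem scaledCoeff_zero (x : ℕ → ℝ≥0) (R : ℝ) : scaledCoeff x R 0 = 0 := if_pos rfl

theorem scaledCoeff_of_ne_zero (x : ℕ → ℝ≥0) (R : ℝ) {j : ℕ} (hj : j ≠ 0) :
    scaledCoeff x R j = x j * R ^ j := if_neg hj

theorem scaledCoeff_nonneg (x : ℕ → ℝ≥0) {R : ℝ} (hR : 0 ≤ R) (j : ℕ) : 0 ≤ scaledCoeff x R j := by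
  rw [scaledCoeff]
  positivity

theorem scaledCoeff_mul_rpow (x : ℕ → ℝ≥0) (R s : ℝ) (j : ℕ) :
    scaledCoeff x R j * (j : ℝ) ^ s = (x j : ℝ) / j * R ^ j * (j : ℝ) ^ (s + 1) := by
  rcases eq_or_ne j 0 with rfl | hj
  · simp [scaledCoeff_zero]
  · have hj' : (j : ℝ) ≠ 0 := by exact_mod_cast hj
    rw [scaledCoeff_of_ne_zero x R hj, Real.rpow_add_one hj']
    field_simp

theorem summable_of_mul_rpow_le {x : ℕ → ℝ} {s C : ℝ} (hs : 1 < s) (hx : ∀ l, 0 ≤ x l)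
    (hC : ∀ l : ℕ, x l * (l : ℝ) ^ s ≤ C) : Summable x := by
  refine summable_of_isBigO_nat (Real.summable_nat_rpow.2 (by linarith : -s < -1))
    (Asymptotics.IsBigO.of_bound C ?_)
  filter_upwards [eventually_gt_atTop 0] with l hl
  have hl' : (0 : ℝ) < l := by exact_mod_cast hl
  rw [Real.norm_of_nonneg (hx l), Real.norm_of_nonneg (by positivity), Real.rpow_neg hl'.le,
    ← div_eq_mul_inv, le_div_iff₀ (by positivity)]
  exact hC l

theorem hasSum_modDeriv_one {κ : ℕ → ℝ≥0} {g : ℂ → ℂ} {R r : ℝ}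
    (hg : ∀ z : ℂ, ‖z‖ < R → HasSum (fun j : ℕ => genCoeff κ j * z ^ j) (g z))
    (hr0 : 0 ≤ r) (hr : r < R) :
    HasSum (fun n => scaledCoeff κ R n * (r / R) ^ n) (modDeriv 1 g (r : ℂ)).re := by
  have hR : 0 < R := hr0.trans_lt hr
  have hshift : HasSum (fun k : ℕ => ((scaledCoeff κ R (k + 1) * (r / R) ^ (k + 1) : ℝ) : ℂ))
      (modDeriv 1 g r) := by
    rw [modDeriv]
    convert! (hasSum_iteratedDeriv hR hg 1 (z := r) (by simpa [abs_of_nonneg hr0])).mul_left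
      ((r : ℂ) ^ 1) using 2 with k
    have hk : ((k + 1 : ℕ) : ℂ) ≠ 0 := by exact_mod_cast k.succ_ne_zero
    have hRc : (R : ℂ) ≠ 0 := by exact_mod_cast hR.ne'
    rw [Nat.descFactorial_one, add_comm 1 k, scaledCoeff_of_ne_zero κ R k.succ_ne_zero, genCoeff,
      div_pow]
    push_cast at hk ⊢
    field_simp
    ring
  have hre := Complex.reCLM.hasSum hshift
  simp only [Complex.reCLM_apply, Complex.ofReal_re] at hre
  have hsum := (hasSum_nat_add_iff (f := fun n => scaledCoeff κ R n * (r / R) ^ n) 1).1 hre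
  simpa [scaledCoeff_zero] using hsum

/-- By Abel's limit theorem. -/
theorem hasSum_scaledCoeff {κ : ℕ → ℝ≥0} {g : ℂ → ℂ} {R μ : ℝ} (hR : 0 < R)
    (hg : ∀ z : ℂ, ‖z‖ < R → HasSum (fun j : ℕ => genCoeff κ j * z ^ j) (g z))
    (hsum : Summable (scaledCoeff κ R))
    (hμ : Tendsto (fun r : ℝ => (modDeriv 1 g (r : ℂ)).re) (𝓝[<] R) (𝓝 μ)) :
    HasSum (scaledCoeff κ R) μ := by
  have hdiv : Tendsto (fun r : ℝ => r / R) (𝓝[<] R) (𝓝[<] 1) := by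
    refine tendsto_nhdsWithin_iff.2 ⟨?_, ?_⟩
    · have hcont : ContinuousAt (fun r : ℝ => r / R) R := by fun_prop
      simpa [ContinuousAt, div_self hR.ne'] using hcont.tendsto.mono_left nhdsWithin_le_nhds
    · filter_upwards [self_mem_nhdsWithin] with r hr
      exact (div_lt_one hR).2 hr
  have hseries : (fun r : ℝ => ∑' n, scaledCoeff κ R n * (r / R) ^ n) =ᶠ[𝓝[<] R]
      fun r : ℝ => (modDeriv 1 g (r : ℂ)).re := by
    filter_upwards [Ioo_mem_nhdsLT hR] with r hr
    exact (hasSum_modDeriv_one hg hr.1.le hr.2).tsum_eq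
  have habel := Real.tendsto_tsum_powerSeries_nhdsWithin_lt hsum.hasSum.tendsto_sum_nat
  rw [← tendsto_nhds_unique ((habel.comp hdiv).congr' hseries) hμ]
  exact hsum.hasSum

theorem exists_scaledCoeff_mul_rpow_le {θ : ℕ → ℝ≥0} {g : ℂ → ℂ} {R η φ : ℝ}
    (hR : 0 < R) (hη : 0 < η) (hφ : 0 < φ) (hφ' : φ < Real.pi / 2)
    (hg : ∀ z : ℂ, ‖z‖ < R → HasSum (fun j : ℕ => genCoeff θ j * z ^ j) (g z))
    (hol : DifferentiableOn ℂ g (deltaDomain R η φ)) (hreg : AnalyticAt ℂ g (R : ℂ)) (s : ℝ) :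
    ∃ C, ∀ l : ℕ, scaledCoeff θ R l * (l : ℝ) ^ s ≤ C := by
  have han : ∀ z : ℂ, ‖z‖ ≤ R → AnalyticAt ℂ g z := by
    intro z hz
    rcases eq_or_ne z R with rfl | hzR
    · exact hreg
    · exact hol.analyticAt ((isOpen_deltaDomain hφ hφ').mem_nhds
        (mem_deltaDomain_of_norm_le hR hη hφ hφ' hz hzR))
  obtain ⟨r, hRr, hsum⟩ := exists_hasSum_of_analyticAt hR hg han
  obtain ⟨r', hRr', hr'⟩ := exists_between hRr
  obtain ⟨C, hC⟩ := exists_norm_mul_pow_mul_rpow_le hR hRr'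
    (hsum r' (by simpa [abs_of_pos (hR.trans hRr')])).summable (s + 1)
  refine ⟨C, fun l => ?_⟩
  rw [scaledCoeff_mul_rpow θ R s, ← norm_genCoeff]
  exact hC l

theorem heavyTail_scaledCoeff {θ κ : ℕ → ℝ≥0} {R η φ s a : ℝ} {b : ℕ → ℝ} {gθ gκ : ℂ → ℂ}
    (hR : 0 < R) (hη : 0 < η) (hφ : 0 < φ) (hφ' : φ < Real.pi / 2)
    (hgθ : ∀ z : ℂ, ‖z‖ < R → HasSum (fun j : ℕ => genCoeff θ j * z ^ j) (gθ z))
    (hgκ : ∀ z : ℂ, ‖z‖ < R → HasSum (fun j : ℕ => genCoeff κ j * z ^ j) (gκ z))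
    (hgθ_hol : DifferentiableOn ℂ gθ (deltaDomain R η φ))
    (hgκ_hol : DifferentiableOn ℂ gκ (deltaDomain R η φ))
    (hgθ_reg : AnalyticAt ℂ gθ (R : ℂ)) (hs : 1 < s) (hs' : ∀ k : ℕ, s ≠ k)
    (hb : Tendsto (fun r : ℝ => (modDeriv 1 gκ (r : ℂ)).re) (𝓝[<] R) (𝓝 (b 1)))
    (ha : a ≠ 0)
    (hexp : ∀ n : ℕ, ∃ δ : ℝ, 0 < δ ∧
      (fun z : ℂ => modDeriv n gκ z - singularExpansion R s a b n z)
        =O[𝓝[deltaDomain R η φ] (R : ℂ)] (fun z : ℂ => ‖1 - z / (R : ℂ)‖ ^ (s - n + δ)))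
    (hsuper : b 1 < 1) :
    HeavyTail (scaledCoeff θ R) (scaledCoeff κ R) s (a / Real.Gamma (-s)) (b 1) := by
  have htend : Tendsto (fun l : ℕ => scaledCoeff κ R l * (l : ℝ) ^ s) atTop
      (𝓝 (a / Real.Gamma (-s))) := by
    simp only [scaledCoeff_mul_rpow κ R s]
    exact tendsto_coeff_of_singularExpansion hR hη hφ hφ' (by simpa [genCoeff] using hgκ) hgκ_hol
      hexp
  have hc : 0 < a / Real.Gamma (-s) := by
    have hΓ : Real.Gamma (-s) ≠ 0 := Real.Gamma_ne_zero fun k h => hs' k (neg_injective h)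
    refine lt_of_le_of_ne (ge_of_tendsto' htend fun l => ?_) (div_ne_zero ha hΓ).symm
    exact mul_nonneg (scaledCoeff_nonneg κ hR.le l) (by positivity)
  obtain ⟨Cθ, hCθ⟩ := exists_scaledCoeff_mul_rpow_le hR hη hφ hφ' hgθ hgθ_hol hgθ_reg s
  obtain ⟨Cκ, hCκ⟩ := htend.bddAbove_range
  have hκ_sum : Summable (scaledCoeff κ R) :=
    summable_of_mul_rpow_le hs (scaledCoeff_nonneg κ hR.le) fun l => hCκ ⟨l, rfl⟩
  exact {
    alpha_nonneg := scaledCoeff_nonneg θ hR.le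
    beta_nonneg := scaledCoeff_nonneg κ hR.le
    alpha_zero := scaledCoeff_zero θ R
    beta_zero := scaledCoeff_zero κ R
    summable_alpha := summable_of_mul_rpow_le hs (scaledCoeff_nonneg θ hR.le) hCθ
    hasSum := hasSum_scaledCoeff hR hgκ hκ_sum hb
    one_lt := hs
    c_pos := hc
    tendsto := htend
    bdd := ⟨Cθ, hCθ⟩
    mu_lt := hsuper }

theorem cycleStep_scale {𝕜 : Type*} [Field 𝕜] {x y f g : ℕ → 𝕜} {r : 𝕜}
    (hxy : ∀ l, l ≠ 0 → y l = x l * r ^ l) (A : Set ℕ) {n : ℕ} (hfg : ∀ m < n, g m = f m * r ^ m) :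
    cycleStep y A g n = cycleStep x A f n * r ^ n := by
  classical
  rw [cycleStep, cycleStep, div_mul_eq_mul_div, Finset.sum_mul]
  congr 1
  refine Finset.sum_congr rfl fun l hl => ?_
  simp only [Finset.mem_filter, Finset.mem_Icc] at hl
  have hpow : r ^ n = r ^ l * r ^ (n - l) := by rw [← pow_add, Nat.add_sub_cancel' hl.1.2]
  rw [hxy l (by omega), hfg (n - l) (by omega), hpow]
  ring

theorem expCoeff_scale {𝕜 : Type*} [Field 𝕜] {x y : ℕ → 𝕜} {r : 𝕜}
    (hxy : ∀ l, l ≠ 0 → y l = x l * r ^ l) (n : ℕ) : expCoeff y n = expCoeff x n * r ^ n := by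
  induction n using Nat.strong_induction_on with
  | _ n ih =>
    rcases eq_or_ne n 0 with rfl | hn
    · simp [expCoeff]
    · rw [expCoeff_eq_cycleStep y hn, expCoeff_eq_cycleStep x hn]
      exact cycleStep_scale hxy _ ih

theorem lexCoeff_scale {𝕜 : Type*} [Field 𝕜] {x y : ℕ → 𝕜} {r : 𝕜}
    (hxy : ∀ l, l ≠ 0 → y l = x l * r ^ l) (As : List (Set ℕ)) (n : ℕ) :
    lexCoeff y As n = lexCoeff x As n * r ^ n := by
  induction As generalizing n with
  | nil => exact expCoeff_scale hxy n
  | cons A As ih => exact cycleStep_scale hxy A fun m _ => ih m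

theorem cycleWeight_scaledCoeff (θ κ : ℕ → ℝ≥0) (R : ℝ) (N : ℕ) {l : ℕ} (hl : l ≠ 0) :
    cycleWeight (scaledCoeff θ R) (scaledCoeff κ R) N l = cycleWeight (θ ·) (κ ·) N l * R ^ l := by
  simp only [cycleWeight, scaledCoeff_of_ne_zero _ R hl]
  ring

theorem lexCoeff_div_expCoeff (θ κ : ℕ → ℝ≥0) {R : ℝ} (hR : R ≠ 0) {N : ℕ}
    (hN : massFn (cycleWeight (scaledCoeff θ R) (scaledCoeff κ R) N) N ≠ 0) (As : List (Set ℕ)) :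
    lexCoeff (cycleWeight (θ ·) (κ ·) N) As N / expCoeff (cycleWeight (θ ·) (κ ·) N) N
      = lexMass (cycleWeight (scaledCoeff θ R) (scaledCoeff κ R) N) As N
        / massFn (cycleWeight (scaledCoeff θ R) (scaledCoeff κ R) N) N := by
  have hscale := fun l (hl : l ≠ 0) => cycleWeight_scaledCoeff θ κ R N hl
  have htotal := (div_ne_zero_iff.1 hN).2
  rw [lexMass, massFn, div_div_div_cancel_right₀ htotal, lexCoeff_scale hscale,
    expCoeff_scale hscale, mul_div_mul_right _ _ (pow_ne_zero N hR)]

theorem normConst_pos_of_massFn_ne_zero (θ κ : ℕ → ℝ≥0) (R : ℝ) {N : ℕ}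
    (hN : massFn (cycleWeight (scaledCoeff θ R) (scaledCoeff κ R) N) N ≠ 0) :
    0 < normConst θ κ N := by
  refine pos_iff_ne_zero.2 fun h0 => (div_ne_zero_iff.1 hN).1 ?_
  rw [expCoeff_scale fun l hl => cycleWeight_scaledCoeff θ κ R N hl, ← normConst_eq_expCoeff, h0]
  simp

/-! ### The fraction of points in long cycles -/

theorem lexMass_Ioi (x : ℕ → ℝ) {K n : ℕ} (hKn : K ≤ n) (hn : n ≠ 0) :
    lexMass x [Set.Ioi K] n
      = massFn x n - (∑ l ∈ Finset.Icc 1 K, x l * massFn x (n - l)) / n := by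
  classical
  have hn' : (n : ℝ) ≠ 0 := Nat.cast_ne_zero.2 hn
  have hshort : (Finset.Icc 1 n).filter (· ∉ Set.Ioi K) = Finset.Icc 1 K := by
    ext l
    simp only [Finset.mem_filter, Finset.mem_Icc, Set.mem_Ioi]
    omega
  rw [lexMass_cons, cycleStep, eq_sub_iff_add_eq, ← add_div, div_eq_iff hn', mul_comm,
    nat_mul_massFn, ← Finset.sum_filter_add_sum_filter_not (Finset.Icc 1 n) (· ∈ Set.Ioi K), hshort]
  congr!

theorem tendsto_cycleWeight_div (α β : ℕ → ℝ) (l : ℕ) :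
    Tendsto (fun N : ℕ => cycleWeight α β N l / N) atTop (𝓝 (β l)) := by
  have hlim := (tendsto_const_div_atTop_nhds_zero_nat (α l)).add_const (β l)
  rw [zero_add] at hlim
  refine hlim.congr' ?_
  filter_upwards [eventually_ne_atTop 0] with N hN
  rw [cycleWeight, add_div, mul_div_cancel_left₀ _ (Nat.cast_ne_zero.2 hN)]

theorem HeavyTail.tendsto_massFn_sub_div_massFn {α β : ℕ → ℝ} {s c μ : ℝ} (h : HeavyTail α β s c μ)
    (l : ℕ) :
    Tendsto (fun N : ℕ => massFn (cycleWeight α β N) (N - l) / massFn (cycleWeight α β N) N) atTop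
      (𝓝 1) := by
  have hν : 0 < 1 - μ := sub_pos.2 h.mu_lt
  have hc := h.c_pos
  have hne : c * (1 - μ) ^ (-s) / (1 - μ) ≠ 0 := by positivity
  have hlim := (h.tendsto_massFn_mul_rpow l).div (h.tendsto_massFn_mul_rpow 0) hne
  rw [div_self hne] at hlim
  refine hlim.congr' ?_
  filter_upwards [eventually_gt_atTop 0] with N hN
  exact mul_div_mul_right _ _ (Real.rpow_pos_of_pos (Nat.cast_pos.2 hN) s).ne'

theorem HeavyTail.tendsto_lexMass_Ioi {α β : ℕ → ℝ} {s c μ : ℝ} (h : HeavyTail α β s c μ) (K : ℕ) :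
    Tendsto (fun N : ℕ => lexMass (cycleWeight α β N) [Set.Ioi K] N / massFn (cycleWeight α β N) N)
      atTop (𝓝 (1 - ∑ l ∈ Finset.Icc 1 K, β l)) := by
  have hlim := (tendsto_finsetSum (Finset.Icc 1 K) fun l _ =>
    (tendsto_cycleWeight_div α β l).mul (h.tendsto_massFn_sub_div_massFn l)).const_sub 1
  simp only [mul_one] at hlim
  refine hlim.congr' ?_
  filter_upwards [eventually_ge_atTop K, eventually_ne_atTop 0, h.eventually_massFn_pos]
    with N hKN hN hpos
  rw [lexMass_Ioi _ hKN hN, sub_div, div_self hpos.ne', Finset.sum_div, Finset.sum_div]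
  simp only [div_mul_div_comm, div_div]

theorem tendsto_longFraction {θ κ : ℕ → ℝ≥0} {R s c μ : ℝ} (hR : R ≠ 0)
    (h : HeavyTail (scaledCoeff θ R) (scaledCoeff κ R) s c μ) :
    Tendsto (longFraction θ κ) atTop (𝓝 (1 - μ)) := by
  refine (h.tendsto_sum_beta.const_sub 1).congr fun K => ?_
  refine (Tendsto.liminf_eq ((h.tendsto_lexMass_Ioi K).congr' ?_)).symm
  filter_upwards [eventually_ne_atTop 0, h.eventually_massFn_pos] with N hN hpos
  rw [integral_sum_Ioc_mul_cycleCount θ κ (normConst_pos_of_massFn_ne_zero θ κ R hpos.ne').ne' K,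
    lexCoeff_div_expCoeff θ κ hR hpos.ne', ← mul_assoc,
    one_div_mul_cancel (Nat.cast_ne_zero.2 hN), one_mul]

/-! ### The first success -/

section FirstSuccess

variable {Ω : Type*} {ξ : ℕ → Ω → Bool}

theorem firstSuccess_eq_succ_iff {ω : Ω} {k : ℕ} :
    firstSuccess ξ ω = k + 1 ↔ (∀ i < k, ξ i ω = false) ∧ ξ k ω = true := by
  rw [firstSuccess]
  constructor
  · intro h
    obtain ⟨n, hn, hξ⟩ := Nat.sInf_mem (Nat.nonempty_of_sInf_eq_succ h)
    obtain rfl : k = n := by omega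
    refine ⟨fun i hi => ?_, hξ⟩
    by_contra hne
    have hle : sInf {k | ∃ n, k = n + 1 ∧ ξ n ω = true} ≤ i + 1 :=
      Nat.sInf_le ⟨i, rfl, by simpa using hne⟩
    omega
  · rintro ⟨hfalse, htrue⟩
    refine le_antisymm (Nat.sInf_le ⟨k, rfl, htrue⟩) (le_csInf ⟨_, k, rfl, htrue⟩ ?_)
    rintro _ ⟨n, rfl, hn⟩
    by_contra! hlt
    simp [hfalse n (by omega)] at hn

theorem forall_firstSuccess_ne_iff {ω : Ω} {m : ℕ} :
    (∀ i < m, firstSuccess ξ ω ≠ i + 1) ↔ ∀ i < m, ξ i ω = false := by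
  constructor
  · intro h i
    induction i using Nat.strong_induction_on with
    | _ i ih =>
      intro hi
      by_contra hne
      exact h i hi (firstSuccess_eq_succ_iff.2
        ⟨fun j hj => ih j hj (hj.trans hi), by simpa using hne⟩)
  · intro h i hi heq
    exact absurd (h i hi) (by simp [(firstSuccess_eq_succ_iff.1 heq).2])

theorem setOf_firstSuccess_eq_iInter (k : ℕ) :
    {ω | firstSuccess ξ ω = k + 1}
      = ⋂ i ∈ Finset.range (k + 1), ξ i ⁻¹' (if i = k then {true} else {false}) := by
  ext ω
  simp only [Set.mem_ofPred_eq, firstSuccess_eq_succ_iff, Finset.mem_range,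
    Nat.lt_succ_iff_lt_or_eq, Set.mem_iInter, Set.mem_preimage]
  constructor
  · rintro ⟨hfalse, htrue⟩ i (hi | rfl)
    · simpa [hi.ne] using hfalse i hi
    · simpa using htrue
  · intro h
    exact ⟨fun i hi => by simpa [hi.ne] using h i (.inl hi), by simpa using h k (.inr rfl)⟩

variable [MeasurableSpace Ω]

theorem measurableSet_firstSuccess_eq (hξm : ∀ n, Measurable (ξ n)) (k : ℕ) :
    MeasurableSet {ω | firstSuccess ξ ω = k + 1} := by
  simp only [firstSuccess_eq_succ_iff]
  measurability

variable {P : Measure Ω} [IsProbabilityMeasure P] {p : ℝ}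

theorem measure_preimage_false (hp : 0 ≤ p) (hξm : ∀ n, Measurable (ξ n))
    (hξ : ∀ n, P {ω | ξ n ω = true} = ENNReal.ofReal p) (n : ℕ) :
    P (ξ n ⁻¹' {false}) = ENNReal.ofReal (1 - p) := by
  have hcompl : ξ n ⁻¹' {false} = {ω | ξ n ω = true}ᶜ := by
    ext ω
    simp
  have hmeas : MeasurableSet {ω | ξ n ω = true} := hξm n (measurableSet_singleton true)
  rw [hcompl, prob_compl_eq_one_sub hmeas, hξ, ← ENNReal.ofReal_one, ← ENNReal.ofReal_sub _ hp]

theorem measure_forall_false (hp : 0 ≤ p) (hp1 : p ≤ 1) (hξm : ∀ n, Measurable (ξ n))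
    (hind : iIndepFun ξ P) (hξ : ∀ n, P {ω | ξ n ω = true} = ENNReal.ofReal p) (m : ℕ) :
    P {ω | ∀ i < m, ξ i ω = false} = ENNReal.ofReal ((1 - p) ^ m) := by
  have hinter : {ω | ∀ i < m, ξ i ω = false} = ⋂ i ∈ Finset.range m, ξ i ⁻¹' {false} := by
    ext ω
    simp
  rw [hinter, hind.measure_inter_preimage_eq_mul _ fun i _ => measurableSet_singleton _]
  simp only [measure_preimage_false hp hξm hξ, Finset.prod_const, Finset.card_range]
  rw [ENNReal.ofReal_pow (sub_nonneg.2 hp1)]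

theorem measure_firstSuccess_eq (hp : 0 ≤ p) (hp1 : p ≤ 1) (hξm : ∀ n, Measurable (ξ n))
    (hind : iIndepFun ξ P) (hξ : ∀ n, P {ω | ξ n ω = true} = ENNReal.ofReal p) (k : ℕ) :
    P {ω | firstSuccess ξ ω = k + 1} = ENNReal.ofReal ((1 - p) ^ k * p) := by
  have hfalse : ∀ i ∈ Finset.range k,
      P (ξ i ⁻¹' (if i = k then {true} else {false})) = ENNReal.ofReal (1 - p) := fun i hi => by
    rw [if_neg (Finset.mem_range.1 hi).ne, measure_preimage_false hp hξm hξ]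
  have htrue : P (ξ k ⁻¹' {true}) = ENNReal.ofReal p := hξ k
  rw [setOf_firstSuccess_eq_iInter,
    hind.measure_inter_preimage_eq_mul _ fun i _ => MeasurableSet.of_discrete,
    Finset.prod_range_succ, Finset.prod_congr rfl hfalse, Finset.prod_const, Finset.card_range,
    if_pos rfl, htrue, ENNReal.ofReal_mul (pow_nonneg (sub_nonneg.2 hp1) k),
    ENNReal.ofReal_pow (sub_nonneg.2 hp1)]

end FirstSuccess

/-! ### Convergence to a discrete limit -/

/-- A form of the portmanteau theorem. -/
theorem tendstoInDistribution_of_isOpen {E : Type*} [PseudoEMetricSpace E] [MeasurableSpace E]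
    [BorelSpace E] {S : ℕ → Type*} [∀ N, MeasurableSpace (S N)] {ν : (N : ℕ) → Measure (S N)}
    [∀ N, IsProbabilityMeasure (ν N)] {Ω : Type*} [MeasurableSpace Ω] {P : Measure Ω}
    [IsProbabilityMeasure P] {X : (N : ℕ) → S N → E} {Z : Ω → E} (hX : ∀ N, Measurable (X N))
    (hZ : Measurable Z)
    (h : ∀ G, IsOpen G → ∀ d < P.real (Z ⁻¹' G), ∀ᶠ N in atTop, d ≤ (ν N).real (X N ⁻¹' G)) :
    TendstoInDistribution X atTop Z ν P where
  forall_aemeasurable N := (hX N).aemeasurable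
  aemeasurable_limit := hZ.aemeasurable
  tendsto := by
    refine tendsto_of_forall_isOpen_le_liminf' fun G hG => ?_
    change (P.map Z) G ≤ liminf (fun N => ((ν N).map (X N)) G) atTop
    rw [Measure.map_apply hZ hG.measurableSet]
    refine le_of_forall_lt fun e he => ?_
    obtain ⟨d, hed, hd⟩ := exists_between he
    have hd_ne_top : d ≠ ⊤ := ne_top_of_lt hd
    refine hed.trans_le (le_liminf_of_le (by isBoundedDefault) ?_)
    filter_upwards [h G hG d.toReal
      ((ENNReal.toReal_lt_toReal hd_ne_top (measure_ne_top _ _)).2 hd)] with N hN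
    rw [Measure.map_apply (hX N) hG.measurableSet]
    exact (ENNReal.toReal_le_toReal hd_ne_top (measure_ne_top _ _)).1 hN

theorem exists_forall_lt_of_lt_sum {ι : Type*} {J : Finset ι} {p : ι → ℝ} {d : ℝ}
    (hd : d < ∑ j ∈ J, p j) : ∃ q : ι → ℝ, (∀ j, q j < p j) ∧ d ≤ ∑ j ∈ J, q j := by
  set t : ℝ := (∑ j ∈ J, p j - d) / (J.card + 1) with ht
  have ht_pos : 0 < t := div_pos (sub_pos.2 hd) (by positivity)
  have ht_mul : t * (J.card + 1) = ∑ j ∈ J, p j - d := div_mul_cancel₀ _ (by positivity)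
  refine ⟨fun j => p j - t, fun j => sub_lt_self _ ht_pos, ?_⟩
  rw [Finset.sum_sub_distrib, Finset.sum_const, nsmul_eq_mul]
  linarith

theorem tendstoInDistribution_of_eventually_le {ι : Type*} [Finite ι] {E : Type*}
    [PseudoEMetricSpace E] [T2Space E] [MeasurableSpace E] [BorelSpace E]
    {S : ℕ → Type*} [∀ N, MeasurableSpace (S N)] {ν : (N : ℕ) → Measure (S N)}
    [∀ N, IsProbabilityMeasure (ν N)] {Ω : Type*} [MeasurableSpace Ω] {P : Measure Ω}
    [IsProbabilityMeasure P] {X : (N : ℕ) → S N → E} {Z : Ω → E} {x : ι → E}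
    (hx : Function.Injective x) (hX : ∀ N, Measurable (X N)) (hZ : Measurable Z)
    (hZx : ∀ ω, ∃ j, Z ω = x j)
    (h : ∀ j, ∀ U ∈ 𝓝 (x j), ∀ d < P.real (Z ⁻¹' {x j}),
      ∀ᶠ N in atTop, d ≤ (ν N).real (X N ⁻¹' U)) :
    TendstoInDistribution X atTop Z ν P := by
  classical
  have := Fintype.ofFinite ι
  refine tendstoInDistribution_of_isOpen hX hZ fun G hG d hd => ?_
  set J : Finset ι := Finset.univ.filter (x · ∈ G)
  obtain ⟨U, hU, hU_disjoint⟩ := (Set.finite_range x).t2_separation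
  have hJ : ∀ {j}, j ∈ J ↔ x j ∈ G := by simp [J]
  have hopen := fun j => (hU (x j)).2.inter hG
  have hsub : Z ⁻¹' G ⊆ ⋃ j ∈ J, Z ⁻¹' {x j} := fun ω hω => by
    obtain ⟨j, hj⟩ := hZx ω
    exact Set.mem_biUnion (hJ.2 (hj ▸ hω)) hj
  have hunion := (measureReal_mono hsub (measure_ne_top P _)).trans
    (measureReal_biUnion_finset_le J _)
  obtain ⟨q, hq, hdq⟩ := exists_forall_lt_of_lt_sum (hd.trans_le hunion)
  have hlower : ∀ᶠ N in atTop, ∀ j ∈ J, q j ≤ (ν N).real (X N ⁻¹' (U (x j) ∩ G)) :=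
    (eventually_all_finset J).2 fun j hj =>
      h j _ ((hopen j).mem_nhds ⟨(hU (x j)).1, hJ.1 hj⟩) _ (hq j)
  filter_upwards [hlower] with N hN
  have hdisjoint : Set.PairwiseDisjoint ↑J fun j => X N ⁻¹' (U (x j) ∩ G) := fun i _ j _ hij =>
    Disjoint.preimage _ ((hU_disjoint ⟨i, rfl⟩ ⟨j, rfl⟩ (hx.ne hij)).mono Set.inter_subset_left
      Set.inter_subset_left)
  calc d ≤ ∑ j ∈ J, q j := hdq
    _ ≤ ∑ j ∈ J, (ν N).real (X N ⁻¹' (U (x j) ∩ G)) := Finset.sum_le_sum hN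
    _ = (ν N).real (⋃ j ∈ J, X N ⁻¹' (U (x j) ∩ G)) :=
      (measureReal_biUnion_finset hdisjoint fun j _ => hX N (hopen j).measurableSet).symm
    _ ≤ (ν N).real (X N ⁻¹' G) :=
      measureReal_mono (Set.iUnion₂_subset fun _ _ => Set.preimage_mono Set.inter_subset_right)

/-! ### Convergence of the cycle lengths -/

/-- The zero vector and the unit vectors, the possible values of the limit. -/
def zeroOrUnit {m : ℕ} (j : Option (Fin m)) : Fin m → ℝ := j.elim 0 fun i => Pi.single i 1

theorem zeroOrUnit_injective {m : ℕ} : Function.Injective (zeroOrUnit (m := m)) := by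
  have hne : ∀ i : Fin m, Pi.single i 1 ≠ (0 : Fin m → ℝ) := fun i =>
    Pi.single_ne_zero_iff.2 one_ne_zero
  rintro (_ | i) (_ | j) hij
  · rfl
  · exact absurd hij.symm (hne j)
  · exact absurd hij (hne i)
  · by_contra hne
    simpa [zeroOrUnit, show i ≠ j from mt (congrArg some) hne] using congrFun hij i

/-- The vector `(X₁, …, X_m)` of the indicators of the events that the first success occurs in the
first, …, `m`-th trial; the trials and the coordinates are numbered from zero. -/
noncomputable def successIndicator {Ω : Type*} (ξ : ℕ → Ω → Bool) (m : ℕ) (ω : Ω) : Fin m → ℝ :=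
  fun i => if firstSuccess ξ ω = (i : ℕ) + 1 then 1 else 0

section SuccessIndicator

variable {Ω : Type*} {ξ : ℕ → Ω → Bool} {m : ℕ} {ω : Ω}

theorem successIndicator_eq_some_iff {i : Fin m} :
    successIndicator ξ m ω = zeroOrUnit (some i) ↔ firstSuccess ξ ω = (i : ℕ) + 1 := by
  constructor
  · intro h
    simpa [successIndicator, zeroOrUnit] using congrFun h i
  · intro h
    ext k
    simp [successIndicator, zeroOrUnit, h, Pi.single_apply, Fin.val_inj, eq_comm]

theorem successIndicator_eq_none_iff :
    successIndicator ξ m ω = zeroOrUnit none ↔ ∀ i < m, firstSuccess ξ ω ≠ i + 1 := by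
  simp [successIndicator, zeroOrUnit, funext_iff, Fin.forall_iff]

theorem exists_successIndicator_eq_zeroOrUnit (ξ : ℕ → Ω → Bool) (m : ℕ) (ω : Ω) :
    ∃ j, successIndicator ξ m ω = zeroOrUnit j := by
  by_cases h : ∀ i < m, firstSuccess ξ ω ≠ i + 1
  · exact ⟨none, successIndicator_eq_none_iff.2 h⟩
  · push Not at h
    obtain ⟨i, hi, heq⟩ := h
    exact ⟨some ⟨i, hi⟩, successIndicator_eq_some_iff.2 heq⟩

variable [MeasurableSpace Ω]

theorem measurable_successIndicator (hξm : ∀ n, Measurable (ξ n)) (m : ℕ) :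
    Measurable (successIndicator ξ m) :=
  measurable_pi_iff.2 fun i =>
    Measurable.ite (measurableSet_firstSuccess_eq hξm i) measurable_const measurable_const

variable {P : Measure Ω} [IsProbabilityMeasure P] {p : ℝ}

theorem measureReal_successIndicator_eq_none (hp : 0 ≤ p) (hp1 : p ≤ 1)
    (hξm : ∀ n, Measurable (ξ n)) (hind : iIndepFun ξ P)
    (hξ : ∀ n, P {ω | ξ n ω = true} = ENNReal.ofReal p) (m : ℕ) :
    P.real (successIndicator ξ m ⁻¹' {zeroOrUnit none}) = (1 - p) ^ m := by
  have hset : successIndicator ξ m ⁻¹' {zeroOrUnit none} = {ω | ∀ i < m, ξ i ω = false} := by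
    ext ω
    exact successIndicator_eq_none_iff.trans forall_firstSuccess_ne_iff
  rw [hset, measureReal_def, measure_forall_false hp hp1 hξm hind hξ,
    ENNReal.toReal_ofReal (pow_nonneg (sub_nonneg.2 hp1) m)]

theorem measureReal_successIndicator_eq_some (hp : 0 ≤ p) (hp1 : p ≤ 1)
    (hξm : ∀ n, Measurable (ξ n)) (hind : iIndepFun ξ P)
    (hξ : ∀ n, P {ω | ξ n ω = true} = ENNReal.ofReal p) (i : Fin m) :
    P.real (successIndicator ξ m ⁻¹' {zeroOrUnit (some i)}) = (1 - p) ^ (i : ℕ) * p := by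
  have hset : successIndicator ξ m ⁻¹' {zeroOrUnit (some i)}
      = {ω | firstSuccess ξ ω = (i : ℕ) + 1} := by
    ext ω
    exact successIndicator_eq_some_iff
  rw [hset, measureReal_def, measure_firstSuccess_eq hp hp1 hξm hind hξ,
    ENNReal.toReal_ofReal (mul_nonneg (pow_nonneg (sub_nonneg.2 hp1) _) hp)]

end SuccessIndicator

theorem getElem_replicate_append_cons {T : Type*} (A B : T) {i j k : ℕ}
    (hk : k < (List.replicate i A ++ B :: List.replicate j A).length) :
    (List.replicate i A ++ B :: List.replicate j A)[k] = if k = i then B else A := by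
  rw [List.getElem_append]
  simp only [List.length_replicate, List.getElem_cons, List.getElem_replicate]
  split_ifs <;> first | rfl | omega

theorem eventually_forall_le_abs_div_lt {a ε : ℝ} (ha : 0 < a) (hε : 0 < ε) (K : ℕ) :
    ∀ᶠ N : ℕ in atTop, ∀ L ≤ K, |(L : ℝ) / (N * a)| < ε := by
  filter_upwards [(tendsto_const_div_atTop_nhds_zero_nat ((K : ℝ) / a)).eventually
    (gt_mem_nhds hε)] with N hN L hL
  rw [abs_of_nonneg (by positivity), mul_comm, ← div_div]
  exact lt_of_le_of_lt (by gcongr) hN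

theorem abs_div_sub_one_lt_of_mem_longWindow {μ ε : ℝ} (hμ : μ < 1) (hε : 0 < ε) {N L : ℕ}
    (hN : 0 < N) (hL : L ∈ longWindow μ (ε / 2 * (1 - μ)) N) :
    |(L : ℝ) / (N * (1 - μ)) - 1| < ε := by
  have hpos : 0 < (N : ℝ) * (1 - μ) := mul_pos (Nat.cast_pos.2 hN) (sub_pos.2 hμ)
  rw [div_sub_one hpos.ne', abs_div, abs_of_pos hpos, div_lt_iff₀ hpos, mul_comm (N : ℝ)]
  refine hL.1.trans_lt ?_
  linarith [mul_pos hε hpos]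

theorem zero_notMem_of_mem_replicate_Icc {m K : ℕ} {A : Set ℕ}
    (hA : A ∈ List.replicate m (Set.Icc 1 K)) : 0 ∉ A := by
  rw [List.eq_of_mem_replicate hA]
  simp

theorem zero_notMem_of_mem_replicate_append {i j K N : ℕ} {μ ε : ℝ} {A : Set ℕ}
    (hA : A ∈ List.replicate i (Set.Icc 1 K) ++
      longWindow μ ε N :: List.replicate j (Set.Icc 1 K)) : 0 ∉ A := by
  rcases List.mem_append.1 hA with hA | hA
  · exact zero_notMem_of_mem_replicate_Icc hA
  · rcases List.mem_cons.1 hA with rfl | hA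
    · exact fun h0 => absurd h0.2 (by omega)
    · exact zero_notMem_of_mem_replicate_Icc hA

theorem measureReal_lexLength_eq_lexMass (θ κ : ℕ → ℝ≥0) {R : ℝ} (hR : R ≠ 0) {N : ℕ}
    (hN : massFn (cycleWeight (scaledCoeff θ R) (scaledCoeff κ R) N) N ≠ 0) (As : List (Set ℕ))
    (h0 : ∀ A ∈ As, 0 ∉ A) :
    (surrogateMeasure θ κ N).real {σ | ∀ (i : ℕ) (hi : i < As.length), lexLength σ i ∈ As[i]}
      = lexMass (cycleWeight (scaledCoeff θ R) (scaledCoeff κ R) N) As N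
        / massFn (cycleWeight (scaledCoeff θ R) (scaledCoeff κ R) N) N := by
  rw [measureReal_lexLength θ κ (normConst_pos_of_massFn_ne_zero θ κ R hN).ne' As h0,
    lexCoeff_div_expCoeff θ κ hR hN]

/-- The vector of the first `m` cycle lengths in units of `a N`. -/
noncomputable def scaledLengths (a : ℝ) (m : ℕ) {N : ℕ} (σ : Equiv.Perm (Fin N)) : Fin m → ℝ :=
  fun i => (lexLength σ (i : ℕ) : ℝ) / (N * a)

namespace HeavyTail

variable {θ κ : ℕ → ℝ≥0} {R s c μ : ℝ} {m : ℕ}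

theorem eventually_le_measureReal_ball_none (hR : R ≠ 0)
    (h : HeavyTail (scaledCoeff θ R) (scaledCoeff κ R) s c μ) {d : ℝ} (hd : d < μ ^ m) {ε : ℝ}
    (hε : 0 < ε) :
    ∀ᶠ N : ℕ in atTop, d ≤ (surrogateMeasure θ κ N).real
      (scaledLengths (1 - μ) m ⁻¹' Metric.ball (zeroOrUnit none) ε) := by
  obtain ⟨K, hK⟩ := h.exists_eventually_le_short m hd
  filter_upwards [hK, h.eventually_massFn_pos,
    eventually_forall_le_abs_div_lt (sub_pos.2 h.mu_lt) hε K] with N hdN hpos hshort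
  rw [← measureReal_lexLength_eq_lexMass θ κ hR hpos.ne' _ fun A hA =>
    zero_notMem_of_mem_replicate_Icc hA] at hdN
  refine hdN.trans (measureReal_mono (fun σ hσ => ?_) (measure_ne_top _ _))
  rw [Set.mem_preimage, Metric.mem_ball, dist_pi_lt_iff hε]
  intro k
  have hk := hσ k (by simp)
  rw [List.getElem_replicate] at hk
  simpa only [scaledLengths, zeroOrUnit, Option.elim_none, Pi.zero_apply, Real.dist_eq, sub_zero]
    using hshort _ hk.2

theorem eventually_le_measureReal_ball_some (hR : R ≠ 0)
    (h : HeavyTail (scaledCoeff θ R) (scaledCoeff κ R) s c μ) (i : Fin m) {d : ℝ}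
    (hd : d < μ ^ (i : ℕ) * (1 - μ)) {ε : ℝ} (hε : 0 < ε) :
    ∀ᶠ N : ℕ in atTop, d ≤ (surrogateMeasure θ κ N).real
      (scaledLengths (1 - μ) m ⁻¹' Metric.ball (zeroOrUnit (some i)) ε) := by
  have hν : 0 < 1 - μ := sub_pos.2 h.mu_lt
  have hlength : (i : ℕ) + (m - 1 - i + 1) = m := by have := i.2; omega
  obtain ⟨K, hK⟩ := h.exists_eventually_le_long i (m - 1 - i) hd (mul_pos (half_pos hε) hν)
  filter_upwards [hK, h.eventually_massFn_pos, eventually_gt_atTop 0,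
    eventually_forall_le_abs_div_lt hν hε K] with N hdN hpos hN hshort
  rw [← measureReal_lexLength_eq_lexMass θ κ hR hpos.ne' _ fun A hA =>
    zero_notMem_of_mem_replicate_append hA] at hdN
  refine hdN.trans (measureReal_mono (fun σ hσ => ?_) (measure_ne_top _ _))
  rw [Set.mem_preimage, Metric.mem_ball, dist_pi_lt_iff hε]
  intro k
  have hk := hσ k (by simp [hlength])
  rw [getElem_replicate_append_cons] at hk
  by_cases hki : k = i
  · subst hki
    rw [if_pos rfl] at hk
    simpa [scaledLengths, zeroOrUnit, Real.dist_eq] using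
      abs_div_sub_one_lt_of_mem_longWindow h.mu_lt hε hN hk
  · rw [if_neg fun heq => hki (Fin.ext heq)] at hk
    simpa only [scaledLengths, zeroOrUnit, Option.elim_some, Pi.single_eq_of_ne hki, Real.dist_eq,
      sub_zero] using hshort _ hk.2

theorem tendstoInDistribution_scaledLengths (hR : R ≠ 0)
    (h : HeavyTail (scaledCoeff θ R) (scaledCoeff κ R) s c μ)
    {Ω : Type*} [MeasurableSpace Ω] {P : Measure Ω} [IsProbabilityMeasure P] {ξ : ℕ → Ω → Bool}
    (hξm : ∀ n, Measurable (ξ n)) (hind : iIndepFun ξ P)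
    (hξ : ∀ n, P {ω | ξ n ω = true} = ENNReal.ofReal (1 - μ)) (m : ℕ) :
    TendstoInDistribution (fun (N : ℕ) (σ : Equiv.Perm (Fin N)) => scaledLengths (1 - μ) m σ) atTop
      (successIndicator ξ m) (fun N : ℕ => surrogateMeasure θ κ N) P := by
  have hν : 0 ≤ 1 - μ := sub_nonneg.2 h.mu_lt.le
  have hν1 : 1 - μ ≤ 1 := sub_le_self 1 h.mu_pos.le
  refine tendstoInDistribution_of_eventually_le zeroOrUnit_injective
    (fun N => measurable_of_finite _) (measurable_successIndicator hξm m)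
    (exists_successIndicator_eq_zeroOrUnit ξ m) fun j U hU d hd => ?_
  obtain ⟨ε, hε, hball⟩ := Metric.mem_nhds_iff.1 hU
  suffices hle : ∀ᶠ N : ℕ in atTop, d ≤ (surrogateMeasure θ κ N).real
      (scaledLengths (1 - μ) m ⁻¹' Metric.ball (zeroOrUnit j) ε) by
    filter_upwards [hle] with N hN
    exact hN.trans (measureReal_mono (Set.preimage_mono hball))
  rcases j with _ | i
  · rw [measureReal_successIndicator_eq_none hν hν1 hξm hind hξ, sub_sub_cancel] at hd
    exact h.eventually_le_measureReal_ball_none hR hd hε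
  · rw [measureReal_successIndicator_eq_some hν hν1 hξm hind hξ, sub_sub_cancel] at hd
    exact h.eventually_le_measureReal_ball_some hR i hd hε

end HeavyTail

end SurrogateSpatial

theorem mainTheorem7
    (θ κ : ℕ → ℝ≥0)
    -- `κ` is non-arithmetic and non-degenerate
    (hna : ¬ ∃ j₀ : ℕ, 1 < j₀ ∧ ∀ j, 1 ≤ j → κ j ≠ 0 → j₀ ∣ j)
    (hnd : ∃ j, 2 ≤ j ∧ 0 < κ j)
    -- `R` is the radius of convergence of the generating function of `κ`
    (R : ℝ) (hR : 0 < R)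
    (hrad : (FormalMultilinearSeries.ofScalars ℂ (SurrogateSpatial.genCoeff κ)).radius
      = ENNReal.ofReal R)
    -- both generating functions are holomorphic in `Δ₀`, and that of `θ` is regular at `R`
    (η φ : ℝ) (hη : 0 < η) (hφ : 0 < φ) (hφ' : φ < Real.pi / 2)
    (gθ gκ : ℂ → ℂ)
    (hgθ : ∀ z : ℂ, ‖z‖ < R → HasSum (fun j : ℕ => SurrogateSpatial.genCoeff θ j * z ^ j) (gθ z))
    (hgκ : ∀ z : ℂ, ‖z‖ < R → HasSum (fun j : ℕ => SurrogateSpatial.genCoeff κ j * z ^ j) (gκ z))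
    (hgθ_hol : DifferentiableOn ℂ gθ (SurrogateSpatial.deltaDomain R η φ))
    (hgκ_hol : DifferentiableOn ℂ gκ (SurrogateSpatial.deltaDomain R η φ))
    (hgθ_reg : AnalyticAt ℂ gθ (R : ℂ))
    -- `b n` is the boundary value of the `n`-th modified derivative of `gκ`, finite for `n < s`
    (s : ℝ) (hs : 1 < s) (hs' : ∀ k : ℕ, s ≠ k)
    (b : ℕ → ℝ)
    (hb : ∀ n : ℕ, (n : ℝ) < s →
      Tendsto (fun r : ℝ => (SurrogateSpatial.modDeriv n gκ (r : ℂ)).re) (𝓝[<] R) (𝓝 (b n)))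
    (hinf : ∀ n : ℕ, s < n →
      Tendsto (fun r : ℝ => (SurrogateSpatial.modDeriv n gκ (r : ℂ)).re) (𝓝[<] R) atTop)
    -- the expansions of `gκ` and of its derivatives at `R`
    (a : ℝ) (ha : a ≠ 0)
    (hexp : ∀ n : ℕ, ∃ δ : ℝ, 0 < δ ∧
      (fun z : ℂ => SurrogateSpatial.modDeriv n gκ z
          - SurrogateSpatial.singularExpansion R s a b n z)
        =O[𝓝[SurrogateSpatial.deltaDomain R η φ] (R : ℂ)]
      (fun z : ℂ => ‖1 - z / (R : ℂ)‖ ^ (s - n + δ)))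
    -- the supercritical case
    (hsuper : b 1 < 1)
    -- independent Bernoulli trials with success probability `1 - b 1`
    {Ω : Type*} [MeasurableSpace Ω] (P : Measure Ω) [IsProbabilityMeasure P]
    (ξ : ℕ → Ω → Bool) (hξm : ∀ n, Measurable (ξ n)) (hξ_indep : iIndepFun ξ P)
    (hξ : ∀ n, P {ω | ξ n ω = true} = ENNReal.ofReal (1 - b 1)) :
    (∀ᶠ N : ℕ in atTop, 0 < SurrogateSpatial.normConst θ κ N) ∧
    Tendsto (SurrogateSpatial.longFraction θ κ) atTop (𝓝 (1 - b 1)) ∧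
    (∀ k : ℕ, 1 ≤ k → P {ω | SurrogateSpatial.firstSuccess ξ ω = k}
      = ENNReal.ofReal ((1 - (1 - b 1)) ^ (k - 1) * (1 - b 1))) ∧
    ∀ m : ℕ, TendstoInDistribution
      (fun (N : ℕ) (σ : Equiv.Perm (Fin N)) (i : Fin m) =>
        (SurrogateSpatial.lexLength σ (i : ℕ) : ℝ) / ((N : ℝ) * (1 - b 1)))
      atTop
      (fun (ω : Ω) (i : Fin m) =>
        if SurrogateSpatial.firstSuccess ξ ω = (i : ℕ) + 1 then (1 : ℝ) else 0)
      (fun N : ℕ => SurrogateSpatial.surrogateMeasure θ κ N) P := by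
  have h := SurrogateSpatial.heavyTail_scaledCoeff (b := b) hR hη hφ hφ' hgθ hgκ hgθ_hol hgκ_hol
    hgθ_reg hs hs' (hb 1 (by exact_mod_cast hs)) ha hexp hsuper
  refine ⟨?_, SurrogateSpatial.tendsto_longFraction hR.ne' h, fun k hk => ?_, fun m =>
    h.tendstoInDistribution_scaledLengths hR.ne' hξm hξ_indep hξ m⟩
  · filter_upwards [h.eventually_massFn_pos] with N hN
    exact SurrogateSpatial.normConst_pos_of_massFn_ne_zero θ κ R hN.ne'
  · obtain ⟨n, rfl⟩ := Nat.exists_eq_add_of_le' hk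
    exact SurrogateSpatial.measure_firstSuccess_eq (sub_nonneg.2 hsuper.le)
      (sub_le_self 1 h.mu_pos.le) hξm hξ_indep hξ n
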